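/- **Setting.** A Bernstein function is $f(x)=a+bx+\int_0^\infty(1-e^{-xs})\,\bar\nu(ds)$, $x>0$, with $a,b\ge 0$ and $\bar\nu$ a measure on $(0,\infty)$ with $\int_0^\infty (s\wedge 1)\,\bar\nu(ds)<\infty$. Put $\nu(s)=a+\bar\nu(s,\infty)$. The generalized Caputo–Djrbashian derivative with respect to $f$ of an absolutely continuous function $u$ is $$\mathcal D^f_t u(t)=b\,u'(t)+\int_0^t \frac{\partial}{\partial t}u(t-s)\,\nu(s)\,ds .$$ A subordinator with Laplace exponent $f$ is a nondecreasing right-continuous process $H^f$ with $H^f(0)=0$, independent stationary increments and $\mathbb E e^{-\theta H^f(t)}=e^{-tf(\theta)}$, $\theta>0$ (killed at rate $a$, i.e. sent to the value $\infty$, if $a>0$; $e^{-\infty}=0$). Its inverse is $Y^f(t)=\inf\{s\ge0: H^f(s)>t\}$, and $\tilde\ell_f(t,\theta)=\mathbb E e^{-\theta Y^f(t)}$ is the Laplace transform of the law of $Y^f(t)$. Let $k\ge1$, $\lambda_1,\dots,\lambda_k>0$, $\Lambda=\sum_{j=1}^k\lambda_j$, $\Omega(k,n)=\{x\in\mathbb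 N_0^k:\sum_{j=1}^k jx_j=n\}$, and $z_k=\sum_{j=1}^k x_j$ for $x\in\Omega(k,n)$. The generalized counting process $M$ is the nondecreasing right-continuous $\mathbb N_0$-valued process with $M(0)=0$, independent stationary increments and $P\{M(t)=n\}=\sum_{\Omega(k,n)}\prod_{j=1}^k\frac{(\lambda_jt)^{x_j}}{x_j!}\,e^{-\Lambda t}$. **Theorem.** Let $\psi$ and $f$ be Bernstein functions, where the Lévy measure of $f$ satisfies $\bar\nu(0,\infty)=\infty$ and the tail $\nu$ of $f$ is absolutely continuous on compact subintervals of $(0,\infty)$. Let $M$, $H^\psi$ and $Y^f$ be independent, and $\mathsf M^{\psi,f}(t)=M(H^\psi(Y^f(t)))$, $t\ge0$ (with $M(\infty)=\infty$). Write $\tilde p_n(t)=P\{\mathsf M^{\psi,f}(t)=n\}$, and $\tilde G(u,t)=\mathbb E\,u^{\mathsf M^{\psi,f}(t)}$ for $|u|<1$ (with $u^\infty=0$). 1. The functions $\psi$ and $y\mapsto\tilde\ell_f(t,\psi(y))$, $t\ge0$, are smooth on $(0,\infty)$, and for all $n\ge0$, $t\ge 0$, $$\tilde p_n(t)=\sum_{\Omega(k,n)}\prod_{j=1}^k\frac{\lambda_j^{x_j}}{x_j!}\,(-\partial_\Lambda)^{z_k}\,\tilde\ell_f(t,\psi(\Lambda)),$$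 where $\partial_\Lambda$ acts on $y\mapsto\tilde\ell_f(t,\psi(y))$ and is evaluated at $y=\Lambda$. 2. For every $n\ge0$ the function $\tilde p_n$ is absolutely continuous on bounded intervals of $[0,\infty)$, $\mathcal D^f_t\tilde p_n(t)$ is well defined for every $t>0$, and $$\mathcal D^f_t\tilde p_n(t)=-\psi(\Lambda)\tilde p_n(t)-\sum_{m=1}^n\sum_{\Omega(k,m)}\psi^{(z_k)}(\Lambda)\prod_{j=1}^k\frac{(-\lambda_j)^{x_j}}{x_j!}\,\tilde p_{n-m}(t),\qquad t>0,$$ with $\tilde p_0(0)=1$ and $\tilde p_n(0)=0$ for $n\ge1$. 3. For every real $u$ with $|u|<1$ and $t\ge 0$, $$\tilde G(u,t)=\tilde\ell_f\Big(t,\psi\Big(\sum_{j=1}^k\lambda_j(1-u^j)\Big)\Big);$$ this function is absolutely continuous in $t$ on bounded intervals of $[0,\infty)$, its derivative $\mathcal D^f_t$ is well defined for every $t>0$, and $$\mathcal D^f_t\tilde G(u,t)=-\psi\Big(\sum_{j=1}^k\lambda_j(1-u^j)\Big)\tilde G(u,t),\quad t>0,\qquad \tilde G(u,0)=1 .$$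 -/

import Mathlib

open MeasureTheory ProbabilityTheory Set
open scoped NNReal ENNReal Nat

noncomputable section

/-- The characteristics `(a, b, ν)` of a Bernstein function: `a, b ≥ 0` and a Lévy measure `ν`
on `(0, ∞)` with `∫ (s ∧ 1) ν(ds) < ∞`. -/
structure BernsteinTriplet where
  /-- the killing rate -/
  a : ℝ
  /-- the drift -/
  b : ℝ
  /-- the Lévy measure, as a measure on the line that is carried by `(0, ∞)` -/
  levy : Measure ℝ
  a_nonneg : 0 ≤ a
  b_nonneg : 0 ≤ b
  levy_Iic : levy (Iic 0) = 0
  lintegral_min_lt_top : ∫⁻ s, ENNReal.ofReal (min s 1) ∂levy < ∞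

namespace BernsteinTriplet

/-- The Bernstein function `x ↦ a + b x + ∫ (1 - e^{-x s}) ν(ds)` (for `x > 0`). -/
def toFun (B : BernsteinTriplet) (x : ℝ) : ℝ :=
  B.a + B.b * x + ∫ s, (1 - Real.exp (-(x * s))) ∂B.levy

/-- The tail `s ↦ a + ν(s, ∞)` (for `s > 0`). -/
def tail (B : BernsteinTriplet) (s : ℝ) : ℝ :=
  B.a + B.levy.real (Ioi s)

/-- The Lévy measure is infinite, and its tail is absolutely continuous on `(0, ∞)`, that is,
on every compact subinterval. -/
def ConditionI (B : BernsteinTriplet) : Prop :=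
  B.levy (Ioi 0) = ∞ ∧
    ∀ c d : ℝ, 0 < c → c ≤ d → AbsolutelyContinuousOnInterval B.tail c d

/-- The generalized Caputo-Djrbashian (convolution-type) derivative with respect to `B`:
`b u'(t) + ∫_0^t (∂/∂t) u(t - s) tail(s) ds`. -/
def caputo (B : BernsteinTriplet) (u : ℝ → ℝ) (t : ℝ) : ℝ :=
  B.b * deriv u t + ∫ s in (0 : ℝ)..t, deriv (fun r => u (r - s)) t * B.tail s

/-- The terms of `B.caputo u t` are meaningful: `u'(t)` exists if it occurs at all, and the
integral converges absolutely. -/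
def CaputoDefinedAt (B : BernsteinTriplet) (u : ℝ → ℝ) (t : ℝ) : Prop :=
  (B.b ≠ 0 → DifferentiableAt ℝ u t) ∧
    IntervalIntegrable (fun s => deriv (fun r => u (r - s)) t * B.tail s) volume 0 t

end BernsteinTriplet

/-- `e^{-θ x}` for `x ∈ [0, ∞]` and `θ > 0`, with `e^{-∞} = 0`. -/
def expNeg (θ : ℝ) (x : ℝ≥0∞) : ℝ :=
  if x = ∞ then 0 else Real.exp (-(θ * x.toReal))

/-- `H` is a subordinator whose Laplace exponent is the Bernstein function of `B`: a
nondecreasing right-continuous process started at `0` with independent and stationary increments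
and `E e^{-θ H_t} = e^{-t B(θ)}`. If `B.a > 0` then it is killed at rate `B.a`; the value `∞` is
the cemetery, and the increment after time `s` is considered on the event `H_s < ∞`, on which it
is independent of `(H_r)_{r ≤ s}` and has the law of `H_h`. -/
structure IsSubordinator {Ω : Type*} [MeasurableSpace Ω] (P : Measure Ω) (B : BernsteinTriplet)
    (H : ℝ≥0 → Ω → ℝ≥0∞) : Prop where
  measurable : ∀ t, Measurable (H t)
  zero : ∀ᵐ ω ∂P, H 0 ω = 0
  mono : ∀ᵐ ω ∂P, Monotone (fun t => H t ω)
  right_continuous : ∀ᵐ ω ∂P, ∀ t, ContinuousWithinAt (fun s => H s ω) (Ici t) t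
  increments : ∀ (s h : ℝ≥0) (A : Set Ω) (C : Set ℝ≥0∞),
    MeasurableSet[⨆ r : Iic s, MeasurableSpace.comap (H r) inferInstance] A → MeasurableSet C →
    P (A ∩ {ω | H s ω < ∞ ∧ H (s + h) ω - H s ω ∈ C}) =
      P (A ∩ {ω | H s ω < ∞}) * P {ω | H h ω ∈ C}
  laplace : ∀ (t : ℝ≥0) (θ : ℝ), 0 < θ →
    ∫ ω, expNeg θ (H t ω) ∂P = Real.exp (-(t * B.toFun θ))

/-- The inverse process `Y(t) = inf {s ≥ 0 : H(s) > t}`. -/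
def inverseProcess {Ω : Type*} (H : ℝ≥0 → Ω → ℝ≥0∞) (t : ℝ≥0) (ω : Ω) : ℝ≥0 :=
  sInf {s : ℝ≥0 | (t : ℝ≥0∞) < H s ω}

/-- The Laplace transform `E e^{-θ Y(t)}` of the law of `Y(t)`, for `t ≥ 0`. -/
def laplaceOf {Ω : Type*} [MeasurableSpace Ω] (P : Measure Ω) (Y : ℝ≥0 → Ω → ℝ≥0)
    (t θ : ℝ) : ℝ :=
  ∫ ω, Real.exp (-(θ * Y t.toNNReal ω)) ∂P

/-- The set `Ω(k, n)` of all `(x_1, …, x_k)` in `ℕ^k` with `∑ j x_j = n`; the coordinate with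
index `j : Fin k` is `x_{j+1}`. -/
def OmegaSet (k n : ℕ) : Finset (Fin k → ℕ) :=
  (Fintype.piFinset fun _ : Fin k => Finset.range (n + 1)).filter
    fun x => ∑ j : Fin k, ((j : ℕ) + 1) * x j = n

theorem mem_OmegaSet {k n : ℕ} {x : Fin k → ℕ} :
    x ∈ OmegaSet k n ↔ ∑ j : Fin k, ((j : ℕ) + 1) * x j = n := by
  simp only [OmegaSet, Finset.mem_filter, Fintype.mem_piFinset, Finset.mem_range,
    and_iff_right_iff_imp]
  intro h j
  have h1 : ((j : ℕ) + 1) * x j ≤ ∑ i : Fin k, ((i : ℕ) + 1) * x i :=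
    Finset.single_le_sum (f := fun i : Fin k => ((i : ℕ) + 1) * x i)
      (fun _ _ => Nat.zero_le _) (Finset.mem_univ j)
  nlinarith [Nat.zero_le ((j : ℕ) * x j)]

/-- The probabilities `∑_{Ω(k,n)} ∏_j (λ_j t)^{x_j} / x_j! · e^{-Λ t}` of the generalized counting
process, `Λ = ∑_j λ_j`. -/
def gcpProb {k : ℕ} (lam : Fin k → ℝ) (n : ℕ) (t : ℝ) : ℝ :=
  ∑ x ∈ OmegaSet k n, (∏ j, (lam j * t) ^ x j / (x j)!) * Real.exp (-((∑ j, lam j) * t))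

/-- `M` is a generalized counting process with jump sizes `1, …, k` and rates `lam`: a
nondecreasing right-continuous process in `ℕ` started at `0`, with independent increments, the
increments over intervals of length `h` having the probabilities `gcpProb lam n h`. -/
structure IsGCP {Ω : Type*} [MeasurableSpace Ω] (P : Measure Ω) {k : ℕ} (lam : Fin k → ℝ)
    (M : ℝ≥0 → Ω → ℕ) : Prop where
  measurable : ∀ t, Measurable (M t)
  zero : ∀ᵐ ω ∂P, M 0 ω = 0
  mono : ∀ᵐ ω ∂P, Monotone (fun t => M t ω)
  right_continuous : ∀ᵐ ω ∂P, ∀ t, ContinuousWithinAt (fun s => M s ω) (Ici t) t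
  indep_increments : HasIndepIncrements (fun t ω => (M t ω : ℝ)) P
  increments_law : ∀ (s h : ℝ≥0) (n : ℕ),
    P.real {ω | M (s + h) ω = M s ω + n} = gcpProb lam n h

/-- The time-changed process `M(H(Y(t)))`; it is in the cemetery `⊤` if `H(Y(t)) = ∞`. -/
def timeChanged {Ω : Type*} (M : ℝ≥0 → Ω → ℕ) (H : ℝ≥0 → Ω → ℝ≥0∞) (Y : ℝ≥0 → Ω → ℝ≥0)
    (t : ℝ≥0) (ω : Ω) : ℕ∞ :=
  if H (Y t ω) ω = ∞ then ⊤ else (M (H (Y t ω) ω).toNNReal ω : ℕ∞)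

/-- The probabilities `p_n(t) = P(X(t) = n)`, for `t ≥ 0`. -/
def processProb {Ω : Type*} [MeasurableSpace Ω] (P : Measure Ω) (X : ℝ≥0 → Ω → ℕ∞)
    (n : ℕ) (t : ℝ) : ℝ :=
  P.real {ω | X t.toNNReal ω = (n : ℕ∞)}

/-- The probability generating function `E u^{X(t)}`, for `t ≥ 0` and `|u| < 1`, with
`u^∞ = 0`. -/
def processPGF {Ω : Type*} [MeasurableSpace Ω] (P : Measure Ω) (X : ℝ≥0 → Ω → ℕ∞)
    (u t : ℝ) : ℝ :=
  ∫ ω, (if X t.toNNReal ω = ⊤ then 0 else u ^ (X t.toNNReal ω).toNat) ∂P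

end

noncomputable section


/-! Put `Z = Hψ (Y t)`. Since `M` is independent of `Z`, conditioning turns the probabilities of `M`
into a finite combination of the moments `E Z^z e^{-ΛZ}` over `Z < ∞`. These are derivatives at `Λ`
of `y ↦ E e^{-yZ}`, and conditioning on `Y` identifies that function as `laplaceOf P Y t (ψ y)`.
This gives the formula for the probabilities; the same argument with `u ^ M` gives the generating
function.

For the governing equation, condition on `Y` only. The derivatives of `e^{-sψ}` at `Λ` are
polynomials in `s` times `e^{-sψ(Λ)}`, so `p_n(t) = E q_n(Y_t) e^{-cY_t}` with `c = ψ(Λ)`. From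
`e^{-(h+s)ψ} = e^{-hψ} e^{-sψ}` one gets `q_n(h+s) = ∑ q_i(h) q_{n-i}(s)`, and differentiating in
`h` at `0` expresses `q_n'` through the lower polynomials (`exists_polynomial_OmegaSet`). It remains
to see that the Caputo-Djrbashian derivative of `E g(Y_t)` is `E g'(Y_t)` for `g = q e^{-c·}`
(`hasCaputo_polynomial`).

By linearity take `g_j(s) = s^j/j! e^{-cs}`. Since `Y_t > s` means `H_s ≤ t` up to a null set of
`s`, `E ∫_0^{Y_t} g_j` is the mass `U_j[0,t]` of a weighted potential measure of the subordinator
with exponent `f`, whose Laplace transform is `(c + f)^{-(j+1)}`. Integrating `g_j'` gives `E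
g_j(Y_t) = U_{j-1}[0,t] - c U_j[0,t]`, with `1` in place of `U_{-1}`. So everything reduces to the
Caputo-Djrbashian derivatives of the functions `U_j[0,t]` (`hasCaputo_potentials`).

The analytic core is that `U_0` has a density `u` with `b u + u * (ν + c) = 1` at every point of
`(0,∞)` (`IsPotential.exists_density`). Laplace transforms give this only almost everywhere. If `b >
0`, define `u` by the equation and prove continuity by semicontinuity. If `b = 0`, split at the
first jump larger than `ε`: the part of the potential before that jump has total mass tending to `0`
because the Lévy measure is infinite, which gives both the density and the equation at each point.
Convolution powers of `u` then handle all `U_j`. -/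

/-! ### Laplace transforms of measures on the half-line and their uniqueness. -/

/-- The Laplace transform of a measure on the line, as an extended nonnegative number. -/
def lap (μ : Measure ℝ) (θ : ℝ) : ℝ≥0∞ :=
  ∫⁻ x, ENNReal.ofReal (Real.exp (-(θ * x))) ∂μ

theorem measurable_ofReal_exp_neg_mul (θ : ℝ) :
    Measurable fun x : ℝ => ENNReal.ofReal (Real.exp (-(θ * x))) := by fun_prop

theorem lap_conv (μ ν : Measure ℝ) [SFinite ν] (θ : ℝ) :
    lap (μ ∗ ν) θ = lap μ θ * lap ν θ := by
  unfold lap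
  rw [Measure.lintegral_conv (measurable_ofReal_exp_neg_mul θ),
    ← lintegral_mul_const _ (measurable_ofReal_exp_neg_mul θ)]
  refine lintegral_congr fun x => ?_
  rw [← lintegral_const_mul _ (measurable_ofReal_exp_neg_mul θ)]
  refine lintegral_congr fun y => ?_
  rw [← ENNReal.ofReal_mul (Real.exp_nonneg _), ← Real.exp_add]
  congr 2; ring

theorem lap_smul (c : ℝ≥0∞) (μ : Measure ℝ) (θ : ℝ) : lap (c • μ) θ = c * lap μ θ := by
  simp [lap]

theorem lap_add (μ ν : Measure ℝ) (θ : ℝ) : lap (μ + ν) θ = lap μ θ + lap ν θ := by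
  simp [lap]

theorem conv_Iio_zero {μ ν : Measure ℝ} [SFinite ν] (hμ : μ (Iio 0) = 0) (hν : ν (Iio 0) = 0) :
    (μ ∗ ν) (Iio 0) = 0 := by
  rw [← lintegral_indicator_one measurableSet_Iio,
    Measure.lintegral_conv (measurable_one.indicator measurableSet_Iio)]
  have h1 : ∀ᵐ x ∂μ, 0 ≤ x := by rw [ae_iff]; simpa [Iio_def] using hμ
  have h2 : ∀ᵐ x ∂ν, 0 ≤ x := by rw [ae_iff]; simpa [Iio_def] using hν
  rw [lintegral_eq_zero_of_ae_eq_zero]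
  filter_upwards [h1] with x hx
  rw [lintegral_eq_zero_of_ae_eq_zero]
  · rfl
  filter_upwards [h2] with y hy
  simp [hx, hy, add_nonneg]

/-- Weierstrass: the continuous functions with equal integrals form a closed set, and it contains
the polynomials. -/
theorem integral_eq_of_forall_polynomial {μ ν : Measure (Icc (0 : ℝ) 1)} [IsFiniteMeasure μ]
    [IsFiniteMeasure ν] (h : ∀ n : ℕ, ∫ y, (y : ℝ) ^ n ∂μ = ∫ y, (y : ℝ) ^ n ∂ν) : μ = ν := by
  have hint : ∀ (m : Measure (Icc (0 : ℝ) 1)) [IsFiniteMeasure m] (g : C(Icc (0 : ℝ) 1, ℝ)),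
      Integrable g m := fun m _ g =>
    (BoundedContinuousFunction.mkOfCompact g).integrable m
  have hcont : ∀ (m : Measure (Icc (0 : ℝ) 1)) [IsFiniteMeasure m],
      Continuous fun g : C(Icc (0 : ℝ) 1, ℝ) => ∫ y, g y ∂m := by
    intro m _
    refine continuous_of_linear_of_bound (𝕜 := ℝ) (C := m.real univ) ?_ ?_ ?_
    · intro f g; exact integral_add (hint m f) (hint m g)
    · intro c f; simpa using integral_const_mul c f
    · intro f
      rw [mul_comm]
      exact norm_integral_le_of_norm_le_const (Filter.Eventually.of_forall f.norm_coe_le_norm)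
  have hclosed : IsClosed {g : C(Icc (0 : ℝ) 1, ℝ) | ∫ y, g y ∂μ = ∫ y, g y ∂ν} :=
    isClosed_eq (hcont μ) (hcont ν)
  have hpoly : ∀ p : Polynomial ℝ,
      ∫ y, p.toContinuousMapOn (Icc (0 : ℝ) 1) y ∂μ = ∫ y, p.toContinuousMapOn (Icc (0 : ℝ) 1) y ∂ν := by
    intro p
    induction p using Polynomial.induction_on' with
    | add p q hp hq =>
      have e : ∀ m : Measure (Icc (0 : ℝ) 1), ∀ [IsFiniteMeasure m],
          ∫ y, (p + q).toContinuousMapOn (Icc (0 : ℝ) 1) y ∂m =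
          ∫ y, p.toContinuousMapOn (Icc (0 : ℝ) 1) y ∂m + ∫ y, q.toContinuousMapOn (Icc (0 : ℝ) 1) y ∂m := by
        intro m _
        rw [← integral_add (hint m _) (hint m _)]
        simp
      rw [e, e, hp, hq]
    | monomial n a =>
      simp only [Polynomial.toContinuousMapOn_apply, Polynomial.toContinuousMap_apply,
        Polynomial.eval_monomial, integral_const_mul, h n]
  refine ext_of_forall_integral_eq_of_IsFiniteMeasure fun f => ?_
  have hmem := continuousMap_mem_polynomialFunctions_closure 0 1 f.toContinuousMap
  have hsub : (polynomialFunctions (Icc (0 : ℝ) 1) : Set C(Icc (0 : ℝ) 1, ℝ)) ⊆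
      {g : C(Icc (0 : ℝ) 1, ℝ) | ∫ y, g y ∂μ = ∫ y, g y ∂ν} := by
    intro g hg
    rw [polynomialFunctions_coe] at hg
    obtain ⟨p, rfl⟩ := hg
    exact hpoly p
  exact closure_minimal hsub hclosed hmem

/-- The map `x ↦ e^{-x}` from the half-line to the unit interval. -/
def expUnit (x : ℝ) : Icc (0 : ℝ) 1 := projIcc 0 1 zero_le_one (Real.exp (-x))

theorem measurable_expUnit : Measurable expUnit :=
  (continuous_projIcc.comp (by fun_prop : Continuous fun x : ℝ => Real.exp (-x))).measurable

theorem coe_expUnit {x : ℝ} (hx : 0 ≤ x) : (expUnit x : ℝ) = Real.exp (-x) := by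
  rw [expUnit, projIcc_of_mem zero_le_one ⟨Real.exp_nonneg _, by simpa using hx⟩]

/-- Tilting by `e^{-x}` makes the measures finite, and the map `e^{-x}` carries them to the unit
interval, where the `n`-th moment is the Laplace transform at `n + 1`. Both operations can be
undone. Infinite measures such as Lebesgue measure on the half-line are covered. -/
theorem lap_ext {μ ν : Measure ℝ} (hμ : μ (Iio 0) = 0) (hν : ν (Iio 0) = 0)
    (hfin : ∀ θ > 0, lap μ θ ≠ ∞) (h : ∀ θ > 0, lap μ θ = lap ν θ) : μ = ν := by
  set e : ℝ → ℝ≥0∞ := fun x => ENNReal.ofReal (Real.exp (-(1 * x))) with he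
  have hem : Measurable e := measurable_ofReal_exp_neg_mul 1
  have key : ∀ m : Measure ℝ, m (Iio 0) = 0 → (∀ θ > 0, lap m θ ≠ ∞) →
      IsFiniteMeasure (m.withDensity e) ∧
      (∀ n : ℕ, ∫ y, (y : ℝ) ^ n ∂((m.withDensity e).map expUnit) = (lap m (n + 1)).toReal) ∧
      m = (((m.withDensity e).map expUnit).map (fun y : Icc (0 : ℝ) 1 => -Real.log y)).withDensity (fun x => (e x)⁻¹) := by
    intro m hm hf
    have h0 : ∀ᵐ x ∂m, 0 ≤ x := by rw [ae_iff]; simpa [Iio_def] using hm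
    have h0' : ∀ᵐ x ∂(m.withDensity e), 0 ≤ x := (withDensity_absolutelyContinuous m e).ae_le h0
    refine ⟨isFiniteMeasure_withDensity (hf 1 one_pos), fun n => ?_, ?_⟩
    · rw [integral_map measurable_expUnit.aemeasurable (by fun_prop),
        integral_eq_lintegral_of_nonneg_ae (Filter.Eventually.of_forall fun x =>
          pow_nonneg (expUnit x).2.1 n) (by have := measurable_expUnit; fun_prop)]
      congr 1
      rw [lap, lintegral_withDensity_eq_lintegral_mul _ hem
        (by have := measurable_expUnit; fun_prop)]
      refine lintegral_congr_ae ?_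
      filter_upwards [h0] with x hx
      simp only [Pi.mul_apply, he]
      rw [coe_expUnit hx, ← ENNReal.ofReal_mul (Real.exp_nonneg _), ← Real.exp_nat_mul,
        ← Real.exp_add]
      congr 2; ring
    · rw [Measure.map_map (by fun_prop) measurable_expUnit]
      have : (m.withDensity e).map ((fun y : Icc (0 : ℝ) 1 => -Real.log y) ∘ expUnit)
          = m.withDensity e := by
        conv_rhs => rw [← Measure.map_id (μ := m.withDensity e)]
        refine Measure.map_congr ?_
        filter_upwards [h0'] with x hx
        simp [coe_expUnit hx]
      rw [this, withDensity_inv_same hem]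
      · exact Filter.Eventually.of_forall fun x => by simp [he, Real.exp_pos]
      · exact Filter.Eventually.of_forall fun x => by simp [he]
  obtain ⟨a1, a2, a3⟩ := key μ hμ hfin
  obtain ⟨b1, b2, b3⟩ := key ν hν fun θ hθ => h θ hθ ▸ hfin θ hθ
  have : (μ.withDensity e).map expUnit = (ν.withDensity e).map expUnit := by
    have := Measure.isFiniteMeasure_map (μ.withDensity e) expUnit
    have := Measure.isFiniteMeasure_map (ν.withDensity e) expUnit
    refine integral_eq_of_forall_polynomial fun n => ?_
    rw [a2, b2, h _ (by positivity)]
  rw [a3, b3, this]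

/-! ### Convolutions of measures with functions. -/

/-- The convolution `t ↦ ∫ T(t - x) μ(dx)` of a measure and a function. -/
def convFun (μ : Measure ℝ) (T : ℝ → ℝ≥0∞) (t : ℝ) : ℝ≥0∞ := ∫⁻ x, T (t - x) ∂μ

theorem measurable_convFun (μ : Measure ℝ) [SFinite μ] {T : ℝ → ℝ≥0∞} (hT : Measurable T) :
    Measurable (convFun μ T) := by
  unfold convFun
  exact Measurable.lintegral_prod_right' (f := fun p : ℝ × ℝ => T (p.1 - p.2)) (by fun_prop)

theorem convFun_conv (μ ν : Measure ℝ) [SFinite ν] {T : ℝ → ℝ≥0∞} (hT : Measurable T) :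
    convFun (μ ∗ ν) T = convFun μ (convFun ν T) := by
  ext t
  unfold convFun
  rw [Measure.lintegral_conv (by fun_prop)]
  simp only [sub_sub]

theorem conv_withDensity (μ : Measure ℝ) [SFinite μ] {T : ℝ → ℝ≥0∞} (hT : Measurable T) :
    μ ∗ (volume.withDensity T) = volume.withDensity (convFun μ T) := by
  refine Measure.ext_of_lintegral _ fun g hg => ?_
  rw [Measure.lintegral_conv hg, lintegral_withDensity_eq_lintegral_mul _
    (measurable_convFun μ hT) hg]
  have h1 : ∀ x, ∫⁻ y, g (x + y) ∂(volume.withDensity T) = ∫⁻ y, T (y - x) * g y := by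
    intro x
    rw [lintegral_withDensity_eq_lintegral_mul _ hT (by fun_prop)]
    rw [← lintegral_add_right_eq_self (fun y => T (y - x) * g y) x]
    simp [add_comm]
  simp only [h1]
  rw [lintegral_lintegral_swap (by fun_prop)]
  refine lintegral_congr fun y => ?_
  simp only [Pi.mul_apply, convFun]
  rw [lintegral_mul_const _ (by fun_prop)]

/-! ### Resolvents of pure jump subordinators. -/

/-- `∫ (1 - e^{-θ s}) ν(ds)`, as an extended nonnegative number. -/
def jumpExponent (ν : Measure ℝ) (θ : ℝ) : ℝ≥0∞ :=
  ∫⁻ s, ENNReal.ofReal (1 - Real.exp (-(θ * s))) ∂ν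

theorem jumpExponent_add_lap {ν : Measure ℝ} (hν : ν (Iio 0) = 0) {θ : ℝ} (hθ : 0 ≤ θ) :
    jumpExponent ν θ + lap ν θ = ν univ := by
  have h0 : ∀ᵐ x ∂ν, 0 ≤ x := by rw [ae_iff]; simpa [Iio_def] using hν
  unfold jumpExponent lap
  rw [← lintegral_add_left (by fun_prop), ← lintegral_one]
  refine lintegral_congr_ae ?_
  filter_upwards [h0] with x hx
  rw [← ENNReal.ofReal_add _ (Real.exp_nonneg _)]
  · simp
  · rw [sub_nonneg, Real.exp_le_one_iff]
    nlinarith [mul_nonneg hθ hx]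

theorem lap_zero (μ : Measure ℝ) : lap μ 0 = μ univ := by simp [lap]

/-- The convolution powers of a measure. -/
def convPow (ρ : Measure ℝ) : ℕ → Measure ℝ
  | 0 => Measure.dirac 0
  | n + 1 => ρ ∗ convPow ρ n

instance convPow_isFinite (ρ : Measure ℝ) [IsFiniteMeasure ρ] (n : ℕ) :
    IsFiniteMeasure (convPow ρ n) := by
  induction n with
  | zero => unfold convPow; infer_instance
  | succ n ih => unfold convPow; infer_instance

theorem lap_convPow (ρ : Measure ℝ) [IsFiniteMeasure ρ] (n : ℕ) (θ : ℝ) :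
    lap (convPow ρ n) θ = lap ρ θ ^ n := by
  induction n with
  | zero => simp [convPow, lap]
  | succ n ih => rw [convPow, lap_conv, ih, pow_succ']

theorem convPow_Iio {ρ : Measure ℝ} [IsFiniteMeasure ρ] (hρ : ρ (Iio 0) = 0) (n : ℕ) :
    convPow ρ n (Iio 0) = 0 := by
  induction n with
  | zero => simp [convPow]
  | succ n ih => exact conv_Iio_zero hρ ih

/-- The resolvent of a compound Poisson process with jump measure `ρ`. -/
def compoundResolvent (ρ : Measure ℝ) (q : ℝ≥0∞) : Measure ℝ :=
  Measure.sum fun n => ((q + ρ univ)⁻¹) ^ (n + 1) • convPow ρ n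

theorem compoundResolvent_Iio {ρ : Measure ℝ} [IsFiniteMeasure ρ] (hρ : ρ (Iio 0) = 0)
    (q : ℝ≥0∞) : compoundResolvent ρ q (Iio 0) = 0 := by
  simp [compoundResolvent, Measure.sum_apply _ measurableSet_Iio, convPow_Iio hρ]

/-- A geometric series with ratio `lap ρ θ / (q + ρ univ)`; by `jumpExponent_add_lap` the difference
`q + ρ univ - lap ρ θ` is `q + jumpExponent ρ θ`. -/
theorem lap_compoundResolvent {ρ : Measure ℝ} [IsFiniteMeasure ρ] (hρ : ρ (Iio 0) = 0)
    {q : ℝ≥0∞} (hq : q ≠ 0) (hq' : q ≠ ∞) {θ : ℝ} (hθ : 0 ≤ θ) :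
    lap (compoundResolvent ρ q) θ = (q + jumpExponent ρ θ)⁻¹ := by
  have hC : ρ univ ≠ ∞ := measure_ne_top _ _
  have hJ := jumpExponent_add_lap hρ hθ
  have hr : lap ρ θ ≠ ∞ := fun h => hC (by rw [← hJ, h]; simp)
  have hQ0 : q + ρ univ ≠ 0 := by simp [hq]
  have hQ : q + ρ univ ≠ ∞ := by simp [hq', hC]
  have h1 : lap (compoundResolvent ρ q) θ
      = ∑' n : ℕ, (q + ρ univ)⁻¹ * (lap ρ θ / (q + ρ univ)) ^ n := by
    unfold compoundResolvent
    rw [lap, lintegral_sum_measure]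
    refine tsum_congr fun n => ?_
    change lap _ θ = _
    rw [lap_smul, lap_convPow, div_eq_mul_inv, mul_pow, pow_succ]
    ring
  rw [h1, ENNReal.tsum_mul_left, ENNReal.tsum_geometric,
    ← ENNReal.mul_inv (Or.inl hQ0) (Or.inl hQ)]
  congr 1
  rw [ENNReal.mul_sub (fun _ _ => hQ), mul_one, ENNReal.mul_div_cancel hQ0 hQ, ← hJ, ← add_assoc,
    ENNReal.add_sub_cancel_right hr]

theorem jumpExponent_restrict_tendsto {ν : Measure ℝ} (hν : ν (Iic 0) = 0) (θ : ℝ) :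
    Filter.Tendsto (fun n : ℕ => jumpExponent (ν.restrict (Ioi (1 / ((n : ℝ) + 1)))) θ)
      Filter.atTop (nhds (jumpExponent ν θ)) := by
  have hmono : Monotone fun n : ℕ => Ioi (1 / ((n : ℝ) + 1)) := fun m n hmn =>
    Ioi_subset_Ioi (one_div_le_one_div_of_le (by positivity) (by gcongr))
  have hU : ⋃ n : ℕ, Ioi (1 / ((n : ℝ) + 1)) = Ioi 0 := by
    ext x
    simp only [mem_iUnion, mem_Ioi]
    refine ⟨fun ⟨n, hn⟩ => lt_trans (by positivity) hn, fun hx => exists_nat_one_div_lt hx⟩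
  have h1 : jumpExponent ν θ =
      ⨆ n : ℕ, jumpExponent (ν.restrict (Ioi (1 / ((n : ℝ) + 1)))) θ := by
    unfold jumpExponent
    rw [← setLIntegral_iUnion_of_directed _ hmono.directed_le, hU]
    rw [← lintegral_add_compl _ (measurableSet_Ioi : MeasurableSet (Ioi (0:ℝ)))]
    simp [Measure.restrict_eq_zero.2 hν]
  rw [h1]
  refine tendsto_atTop_iSup fun m n hmn => ?_
  exact lintegral_mono' (Measure.restrict_mono (hmono hmn) le_rfl) le_rfl

theorem lap_eq_lintegral_expUnit {μ : Measure ℝ} (hμ : μ (Iio 0) = 0) (θ : ℝ) :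
    lap μ θ = ∫⁻ y, ENNReal.ofReal ((y : ℝ) ^ θ) ∂(μ.map expUnit) := by
  have h0 : ∀ᵐ x ∂μ, 0 ≤ x := by rw [ae_iff]; simpa [Iio_def] using hμ
  rw [lintegral_map (by fun_prop) measurable_expUnit, lap]
  refine lintegral_congr_ae ?_
  filter_upwards [h0] with x hx
  rw [coe_expUnit hx, ← Real.exp_mul]
  congr 2; ring

/-- The resolvent of a pure jump subordinator, given its Lévy measure. -/
theorem exists_resolvent {ν : Measure ℝ} (hν : ν (Iic 0) = 0)
    (hfin : ∀ ε > 0, ν (Ioi ε) ≠ ∞)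
    {q : ℝ≥0∞} (hq : q ≠ 0) (hq' : q ≠ ∞) :
    ∃ V : Measure ℝ, V (Iio 0) = 0 ∧ V univ ≤ q⁻¹ ∧
      ∀ θ > 0, lap V θ = (q + jumpExponent ν θ)⁻¹ := by
  -- Truncating the small jumps gives compound Poisson processes with explicit resolvents; the
  -- desired measure is a weak limit of these, transported to the compact interval by `expUnit`.
  set ρ : ℕ → Measure ℝ := fun n => ν.restrict (Ioi (1 / ((n : ℝ) + 1)))
  have hρf : ∀ n, IsFiniteMeasure (ρ n) := fun n =>
    isFiniteMeasure_restrict.2 (hfin _ (by positivity))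
  have hρ0 : ∀ n, ρ n (Iio 0) = 0 := fun n =>
    le_antisymm ((Measure.restrict_apply_le _ _).trans
      ((measure_mono Iio_subset_Iic_self).trans hν.le)) zero_le
  set W : ℕ → Measure ℝ := fun n => compoundResolvent (ρ n) q
  have hW0 : ∀ n, W n (Iio 0) = 0 := fun n => compoundResolvent_Iio (hρ0 n) q
  have hprob : ∀ n, IsProbabilityMeasure ((q • W n).map expUnit) := fun n => by
    have : IsProbabilityMeasure (q • W n) := ⟨by
      rw [← lap_zero, lap_smul, lap_compoundResolvent (hρ0 n) hq hq' le_rfl]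
      simp [jumpExponent, ENNReal.mul_inv_cancel hq hq']⟩
    exact Measure.isProbabilityMeasure_map measurable_expUnit.aemeasurable
  set P : ℕ → ProbabilityMeasure (Icc (0 : ℝ) 1) := fun n => ⟨_, hprob n⟩
  -- Compactness through an ultrafilter limit avoids extracting a subsequence.
  set F : Ultrafilter (ProbabilityMeasure (Icc (0 : ℝ) 1)) := (Filter.hyperfilter ℕ).map P
  have hlim : Filter.Tendsto P (Filter.hyperfilter ℕ) (nhds F.lim) := F.le_nhds_lim
  set Q : ProbabilityMeasure (Icc (0 : ℝ) 1) := F.lim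
  have hQ : ∀ θ > 0, ∫⁻ y, ENNReal.ofReal ((y : ℝ) ^ θ) ∂(Q : Measure (Icc (0 : ℝ) 1)) =
      q * (q + jumpExponent ν θ)⁻¹ := by
    intro θ hθ
    let g : BoundedContinuousFunction (Icc (0 : ℝ) 1) ℝ≥0 :=
      BoundedContinuousFunction.mkOfCompact
        ⟨fun y => Real.toNNReal ((y : ℝ) ^ θ), by
          refine continuous_real_toNNReal.comp ?_
          exact (Real.continuous_rpow_const hθ.le).comp continuous_subtype_val⟩
    have h1 := (ProbabilityMeasure.tendsto_iff_forall_lintegral_tendsto.1 hlim) g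
    refine tendsto_nhds_unique h1 (Filter.Tendsto.mono_left ?_ Nat.hyperfilter_le_atTop)
    have h2 : ∀ n, ∫⁻ y, (g y : ℝ≥0∞) ∂(P n : Measure (Icc (0 : ℝ) 1)) =
        q * (q + jumpExponent (ρ n) θ)⁻¹ := fun n => by
      have : lap (q • W n) θ = q * (q + jumpExponent (ρ n) θ)⁻¹ := by
        rw [lap_smul, lap_compoundResolvent (hρ0 n) hq hq' hθ.le]
      rw [← this, lap_eq_lintegral_expUnit (by simp [hW0 n])]
      rfl
    simp only [h2]
    refine ENNReal.Tendsto.const_mul ?_ (Or.inr hq')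
    exact ((jumpExponent_restrict_tendsto hν θ).const_add q).inv
  have hlog : Measurable fun y : Icc (0 : ℝ) 1 => -Real.log y := by fun_prop
  -- Mass of the limit at `y = 0` has escaped to `x = ∞` and is discarded. This does not change the
  -- Laplace transform, as `0 ^ θ = 0` for `θ > 0`, but it leaves only an inequality for the total
  -- mass.
  refine ⟨q⁻¹ • (((Q : Measure (Icc (0 : ℝ) 1)).restrict {y | 0 < (y : ℝ)}).map
    (fun y : Icc (0 : ℝ) 1 => -Real.log y)), ?_, ?_, fun θ hθ => ?_⟩
  · rw [Measure.smul_apply, Measure.map_apply hlog measurableSet_Iio]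
    have : (fun y : Icc (0 : ℝ) 1 => -Real.log y) ⁻¹' Iio 0 = ∅ := by
      ext y
      simpa using Real.log_nonpos y.2.1 y.2.2
    simp [this]
  · rw [Measure.smul_apply, Measure.map_apply hlog MeasurableSet.univ, smul_eq_mul]
    exact mul_le_of_le_one_right zero_le ((Measure.restrict_apply_le _ _).trans prob_le_one)
  · rw [lap_smul, lap, lintegral_map (measurable_ofReal_exp_neg_mul θ) hlog]
    have hms : MeasurableSet {y : Icc (0 : ℝ) 1 | 0 < (y : ℝ)} :=
      measurableSet_lt measurable_const measurable_subtype_coe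
    have : ∫⁻ y in {y : Icc (0 : ℝ) 1 | 0 < (y : ℝ)}, ENNReal.ofReal (Real.exp (-(θ * -Real.log y)))
        ∂(Q : Measure (Icc (0 : ℝ) 1)) = q * (q + jumpExponent ν θ)⁻¹ := by
      rw [← hQ θ hθ, ← lintegral_indicator hms]
      refine lintegral_congr fun y => ?_
      by_cases hy : 0 < (y : ℝ)
      · rw [indicator_of_mem (by exact hy), Real.rpow_def_of_pos hy]
        congr 2; ring
      · rw [indicator_of_notMem (by exact hy), le_antisymm (not_lt.1 hy) y.2.1,
          Real.zero_rpow hθ.ne']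
        simp
    rw [this, ← mul_assoc, ENNReal.inv_mul_cancel hq hq', one_mul]

/-! ### Tails of Lévy measures and semicontinuity of their convolutions. -/

/-- The function `y ↦ κ + ν(y, ∞)` for `y > 0`, extended by zero. -/
def tailFn (κ : ℝ≥0∞) (ν : Measure ℝ) (y : ℝ) : ℝ≥0∞ := if 0 < y then κ + ν (Ioi y) else 0

theorem measurable_tailFn (κ : ℝ≥0∞) (ν : Measure ℝ) : Measurable (tailFn κ ν) := by
  refine Measurable.ite measurableSet_Ioi (measurable_const.add ?_) measurable_const
  exact Antitone.measurable fun x y hxy => measure_mono (Ioi_subset_Ioi hxy)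

theorem setLIntegral_Ioo_exp {θ s : ℝ} (hs : 0 ≤ s) (hθ : 0 < θ) :
    ∫⁻ y in Ioo 0 s, ENNReal.ofReal (θ * Real.exp (-(θ * y))) =
      ENNReal.ofReal (1 - Real.exp (-(θ * s))) := by
  rw [← ofReal_integral_eq_lintegral_ofReal]
  · rw [← integral_Ioc_eq_integral_Ioo, ← intervalIntegral.integral_of_le hs,
      intervalIntegral.integral_eq_sub_of_hasDerivAt (f := fun y => -Real.exp (-(θ * y)))]
    · congr 1; simp; ring
    · intro x _
      have h : HasDerivAt (fun y : ℝ => -(θ * y)) (-θ) x := by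
        simpa using ((hasDerivAt_id x).const_mul θ).fun_neg
      simpa [mul_comm] using h.exp.fun_neg
    · exact Continuous.intervalIntegrable (by fun_prop) _ _
  · exact (Continuous.integrableOn_Icc (by fun_prop)).mono_set Ioo_subset_Icc_self
  · exact Filter.Eventually.of_forall fun x => by positivity

theorem setLIntegral_Ioi_exp {θ : ℝ} (hθ : 0 < θ) :
    ∫⁻ y in Ioi 0, ENNReal.ofReal (θ * Real.exp (-(θ * y))) = 1 := by
  rw [← ofReal_integral_eq_lintegral_ofReal]
  · rw [integral_const_mul]
    have := integral_exp_mul_Ioi (neg_lt_zero.2 hθ) 0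
    simp only [neg_mul] at this
    rw [this]
    simp [hθ.ne']
  · have := exp_neg_integrableOn_Ioi 0 hθ
    simp only [neg_mul] at this
    exact this.const_mul θ
  · exact Filter.Eventually.of_forall fun x => by positivity

theorem lap_restrict_Ioi {θ : ℝ} (hθ : 0 < θ) :
    ENNReal.ofReal θ * lap (volume.restrict (Ioi 0)) θ = 1 := by
  rw [lap, ← lintegral_const_mul _ (measurable_ofReal_exp_neg_mul θ), ← setLIntegral_Ioi_exp hθ]
  simp only [ENNReal.ofReal_mul hθ.le]

/-- Tonelli applied to `θ e^{-θy}` on the region `0 < y < s`. This identity links the kernel of the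
Caputo-Djrbashian derivative to the Bernstein function. -/
theorem lap_tailFn {κ : ℝ≥0∞} {ν : Measure ℝ} [SFinite ν] (hν : ν (Iic 0) = 0) {θ : ℝ}
    (hθ : 0 < θ) :
    ENNReal.ofReal θ * lap (volume.withDensity (tailFn κ ν)) θ = κ + jumpExponent ν θ := by
  have h0 : ∀ᵐ x ∂ν, 0 ≤ x := by
    rw [ae_iff]
    exact measure_mono_null (fun x hx => le_of_not_ge hx) hν
  have hm : Measurable fun y : ℝ => ENNReal.ofReal (θ * Real.exp (-(θ * y))) := by fun_prop
  have h1 : ENNReal.ofReal θ * lap (volume.withDensity (tailFn κ ν)) θ =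
      ∫⁻ y in Ioi 0, (κ * ENNReal.ofReal (θ * Real.exp (-(θ * y))) +
        ν (Ioi y) * ENNReal.ofReal (θ * Real.exp (-(θ * y)))) := by
    rw [lap, lintegral_withDensity_eq_lintegral_mul _ (measurable_tailFn κ ν)
      (measurable_ofReal_exp_neg_mul θ), ← lintegral_const_mul _
      ((measurable_tailFn κ ν).mul (measurable_ofReal_exp_neg_mul θ)),
      ← lintegral_indicator measurableSet_Ioi]
    refine lintegral_congr fun y => ?_
    by_cases hy : 0 < y
    · simp only [Pi.mul_apply, tailFn, if_pos hy, indicator_of_mem (mem_Ioi.2 hy),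
        ENNReal.ofReal_mul hθ.le]
      ring
    · simp only [Pi.mul_apply, tailFn, if_neg hy, indicator_of_notMem (show y ∉ Ioi 0 from hy)]
      simp
  rw [h1, lintegral_add_left (by fun_prop), lintegral_const_mul _ hm, setLIntegral_Ioi_exp hθ,
    mul_one]
  congr 1
  have h2 : ∀ y, ν (Ioi y) * ENNReal.ofReal (θ * Real.exp (-(θ * y))) =
      ∫⁻ s, (Ioi y).indicator (fun _ => ENNReal.ofReal (θ * Real.exp (-(θ * y)))) s ∂ν := by
    intro y
    rw [lintegral_indicator measurableSet_Ioi]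
    simp [mul_comm]
  simp only [h2]
  rw [lintegral_lintegral_swap]
  · unfold jumpExponent
    refine lintegral_congr_ae ?_
    filter_upwards [h0] with s hs
    rw [← setLIntegral_Ioo_exp hs hθ, ← lintegral_indicator measurableSet_Ioi,
      ← lintegral_indicator measurableSet_Ioo]
    refine lintegral_congr fun y => ?_
    simp only [indicator, mem_Ioi, mem_Ioo]
    split_ifs <;> first | rfl | (exfalso; tauto)
  · refine Measurable.aemeasurable ?_
    change Measurable fun p : ℝ × ℝ =>
      {p : ℝ × ℝ | p.1 < p.2}.indicator (fun p => ENNReal.ofReal (θ * Real.exp (-(θ * p.1)))) p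
    exact Measurable.indicator (by fun_prop) (measurableSet_lt measurable_fst measurable_snd)

theorem lowerSemicontinuous_tailFn (κ : ℝ≥0∞) (ν : Measure ℝ) :
    LowerSemicontinuous (tailFn κ ν) := by
  intro y a ha
  have hy : 0 < y := by
    by_contra h
    simp [tailFn, h] at ha
  rw [tailFn, if_pos hy] at ha
  have hU : ⋃ n : ℕ, Ioi (y + 1 / ((n : ℝ) + 1)) = Ioi y := by
    ext x
    simp only [mem_iUnion, mem_Ioi]
    refine ⟨fun ⟨n, hn⟩ => lt_trans (lt_add_of_pos_right y (by positivity)) hn, fun hx => ?_⟩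
    obtain ⟨n, hn⟩ := exists_nat_one_div_lt (sub_pos.2 hx)
    exact ⟨n, by linarith⟩
  have hmono : Monotone fun n : ℕ => Ioi (y + 1 / ((n : ℝ) + 1)) := fun m n hmn =>
    Ioi_subset_Ioi (by gcongr)
  rw [← hU, hmono.measure_iUnion, ENNReal.add_iSup, gt_iff_lt, lt_iSup_iff] at ha
  obtain ⟨n, hn⟩ := ha
  have hlt : y < y + 1 / ((n : ℝ) + 1) := lt_add_of_pos_right y (by positivity)
  filter_upwards [Ioo_mem_nhds hy hlt] with z hz
  rw [tailFn, if_pos hz.1]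
  refine hn.trans_le ?_
  gcongr
  exact hz.2.le

/-- Fatou's lemma along sequences. Lower semicontinuity is what upgrades almost everywhere
statements about the convolution to pointwise ones. -/
theorem lowerSemicontinuous_convFun (μ : Measure ℝ) {T : ℝ → ℝ≥0∞} (hT : Measurable T)
    (hl : LowerSemicontinuous T) : LowerSemicontinuous (convFun μ T) := by
  intro t a ha
  rw [Filter.eventually_iff_seq_eventually]
  intro s hs
  have h1 : convFun μ T t ≤ Filter.liminf (fun n => convFun μ T (s n)) Filter.atTop := by
    refine le_trans (lintegral_mono fun x => ?_)
      (lintegral_liminf_le (μ := μ) (f := fun n x => T (s n - x)) fun n => by fun_prop)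
    have h2 := lowerSemicontinuousAt_iff_le_liminf.1 (hl (t - x))
    refine h2.trans ?_
    have h3 : Filter.Tendsto (fun n => s n - x) Filter.atTop (nhds (t - x)) := hs.sub_const x
    exact (Filter.liminf_le_liminf_of_le h3).trans_eq (by rw [← Filter.liminf_comp]; rfl)
  exact Filter.eventually_lt_of_lt_liminf (ha.trans_le h1)

theorem convFun_add_measure (μ ν : Measure ℝ) (T : ℝ → ℝ≥0∞) (t : ℝ) :
    convFun (μ + ν) T t = convFun μ T t + convFun ν T t := by
  simp [convFun]

theorem convFun_tailFn_of_nonpos {μ : Measure ℝ} (hμ : μ (Iio 0) = 0) (κ : ℝ≥0∞) (ν : Measure ℝ)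
    {t : ℝ} (ht : t ≤ 0) : convFun μ (tailFn κ ν) t = 0 := by
  have h0 : ∀ᵐ x ∂μ, 0 ≤ x := by rw [ae_iff]; simpa [Iio_def] using hμ
  refine lintegral_eq_zero_of_ae_eq_zero ?_
  filter_upwards [h0] with x hx
  simp [tailFn, show ¬ x < t by linarith]

/-- Morally `f = R - g` is upper semicontinuous as well; the work is in avoiding subtraction of
infinities. -/
theorem tendsto_of_lowerSemicontinuousAt_add {f g R : ℝ → ℝ≥0∞} {t : ℝ}
    (hf : LowerSemicontinuousAt f t) (hg : LowerSemicontinuousAt g t) (hR : ContinuousAt R t)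
    (hfin : R t ≠ ∞) (h : ∀ s, f s + g s = R s) : ContinuousAt f t := by
  have hgt : g t ≠ ∞ := fun h' => hfin (by rw [← h, h']; simp)
  refine tendsto_order.2 ⟨fun a ha => hf a ha, fun a ha => ?_⟩
  by_cases ha' : a = ∞
  · subst ha'
    filter_upwards [hR.eventually_lt_const (lt_top_iff_ne_top.2 hfin)] with s hs
    exact lt_of_le_of_lt (by rw [← h]; exact le_self_add) hs
  have h1 : R t < a + g t := by
    rw [← h]; exact ENNReal.add_lt_add_right hgt ha
  have hRf : ∀ s, R s < ∞ → g s ≠ ∞ := fun s hs h' => by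
    rw [← h, h'] at hs; simp at hs
  by_cases h0 : g t = 0
  · rw [h0, add_zero] at h1
    filter_upwards [hR.eventually_lt_const h1] with s hs
    exact lt_of_le_of_lt (by rw [← h]; exact le_self_add) hs
  · have h2 : ContinuousAt (fun c => a + c) (g t) := by fun_prop
    have h3 := h2.eventually_const_lt h1
    have hne : (nhdsWithin (g t) (Iio (g t))).NeBot :=
      nhdsLT_neBot_of_exists_lt ⟨0, pos_iff_ne_zero.2 h0⟩
    obtain ⟨c, hc1, hc2⟩ := ((h3.filter_mono nhdsWithin_le_nhds).and
      (self_mem_nhdsWithin (s := Iio (g t)))).exists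
    filter_upwards [hg c hc2, hR.eventually_lt_const hc1,
      hR.eventually_lt_const (lt_top_iff_ne_top.2 hfin)] with s hs1 hs2 hs3
    have h4 : f s + g s < a + g s := by
      rw [h]; exact hs2.trans_le (by gcongr)
    exact (ENNReal.add_lt_add_iff_right (hRf s hs3)).1 h4

/-! ### Potential measures and the renewal equation at every point. -/

/-- `U` is the potential measure of a subordinator with drift `b`, killing rate `κ` and Lévy
measure `ν`. -/
structure IsPotential (b κ : ℝ≥0∞) (ν U : Measure ℝ) : Prop where
  drift_ne_top : b ≠ ∞
  killing_ne_zero : κ ≠ 0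
  killing_ne_top : κ ≠ ∞
  levy_Iic : ν (Iic 0) = 0
  levy_Ioi : ∀ ε > 0, ν (Ioi ε) ≠ ∞
  jump_ne_top : ∀ θ > 0, jumpExponent ν θ ≠ ∞
  potential_Iio : U (Iio 0) = 0
  lap_mul : ∀ θ > 0, lap U θ * (b * ENNReal.ofReal θ + κ + jumpExponent ν θ) = 1

theorem iUnion_Ioi_one_div : ⋃ n : ℕ, Ioi (1 / ((n : ℝ) + 1)) = Ioi 0 := by
  ext x
  simp only [mem_iUnion, mem_Ioi]
  refine ⟨fun ⟨n, hn⟩ => lt_trans (by positivity) hn, fun hx => exists_nat_one_div_lt hx⟩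

theorem monotone_Ioi_one_div : Monotone fun n : ℕ => Ioi (1 / ((n : ℝ) + 1)) := fun m n hmn =>
  Ioi_subset_Ioi (one_div_le_one_div_of_le (by positivity) (by gcongr))

theorem sigmaFinite_of_Ioi {ν : Measure ℝ} (hν : ν (Iic 0) = 0)
    (hfin : ∀ ε > 0, ν (Ioi ε) ≠ ∞) : SigmaFinite ν := by
  refine ⟨⟨⟨fun n => Iic 0 ∪ Ioi (1 / ((n : ℝ) + 1)), fun n => mem_univ _, fun n => ?_, ?_⟩⟩⟩
  · refine (measure_union_le _ _).trans_lt ?_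
    rw [hν, zero_add]
    exact lt_top_iff_ne_top.2 (hfin _ (by positivity))
  · rw [← union_iUnion, iUnion_Ioi_one_div, Iic_union_Ioi]

/-- On `y < t` one has `1 ≤ e^t e^{-y}`, so the Laplace transform at `1` dominates. -/
theorem lintegral_Iio_tailFn_ne_top {κ : ℝ≥0∞} {ν : Measure ℝ} (hν : ν (Iic 0) = 0)
    (hfin : ∀ ε > 0, ν (Ioi ε) ≠ ∞) (hJ : ∀ θ > 0, jumpExponent ν θ ≠ ∞) (hκ : κ ≠ ∞) (t : ℝ) :
    ∫⁻ y in Iio t, tailFn κ ν y ≠ ∞ := by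
  have := sigmaFinite_of_Ioi hν hfin
  have h1 : lap (volume.withDensity (tailFn κ ν)) 1 ≠ ∞ := by
    have := lap_tailFn (κ := κ) hν one_pos
    rw [ENNReal.ofReal_one, one_mul] at this
    rw [this]
    simp [hκ, hJ 1 one_pos]
  have h2 : ∫⁻ y in Iio t, tailFn κ ν y ≤
      ENNReal.ofReal (Real.exp t) * lap (volume.withDensity (tailFn κ ν)) 1 := by
    rw [lap, lintegral_withDensity_eq_lintegral_mul _ (measurable_tailFn κ ν)
      (measurable_ofReal_exp_neg_mul 1), ← lintegral_const_mul _
      ((measurable_tailFn κ ν).mul (measurable_ofReal_exp_neg_mul 1)),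
      ← lintegral_indicator measurableSet_Iio]
    refine lintegral_mono fun y => ?_
    by_cases hy : y < t
    · rw [indicator_of_mem (mem_Iio.2 hy)]
      simp only [Pi.mul_apply]
      rw [mul_left_comm, ← ENNReal.ofReal_mul (Real.exp_nonneg _), ← Real.exp_add]
      refine le_mul_of_one_le_right zero_le ?_
      rw [ENNReal.one_le_ofReal, Real.one_le_exp_iff]
      linarith
    · rw [indicator_of_notMem (by simpa using hy)]
      exact zero_le
  exact ne_top_of_le_ne_top (ENNReal.mul_ne_top ENNReal.ofReal_ne_top h1) h2

theorem convFun_restrict_Ioi_tailFn (κ : ℝ≥0∞) (ν : Measure ℝ) (t : ℝ) :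
    convFun (volume.restrict (Ioi 0)) (tailFn κ ν) t = ∫⁻ y in Iio t, tailFn κ ν y := by
  unfold convFun
  rw [← lintegral_indicator measurableSet_Ioi, ← lintegral_indicator measurableSet_Iio,
    ← lintegral_sub_left_eq_self (fun y => (Iio t).indicator (fun y => tailFn κ ν y) y) t]
  refine lintegral_congr fun x => ?_
  simp [indicator]

theorem continuous_lintegral_Iio {T : ℝ → ℝ≥0∞} (hT : Measurable T)
    (hfin : ∀ t, ∫⁻ y in Iio t, T y ≠ ∞) : Continuous fun t => ∫⁻ y in Iio t, T y := by
  refine continuous_iff_continuousAt.2 fun t => ?_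
  simp only [← lintegral_indicator measurableSet_Iio]
  refine tendsto_lintegral_filter_of_dominated_convergence ((Iio (t + 1)).indicator T)
    (Filter.Eventually.of_forall fun s => hT.indicator measurableSet_Iio) ?_ ?_ ?_
  · filter_upwards [gt_mem_nhds (lt_add_one t)] with s hs
    exact Filter.Eventually.of_forall fun y =>
      indicator_le_indicator_of_subset (Iio_subset_Iio hs.le) (fun _ => zero_le) y
  · rw [lintegral_indicator measurableSet_Iio]; exact hfin _
  · have : ∀ᵐ y : ℝ, y ≠ t := by simp [ae_iff]
    filter_upwards [this] with y hy
    refine tendsto_const_nhds.congr' ?_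
    rcases lt_or_gt_of_ne hy with h | h
    · filter_upwards [lt_mem_nhds h] with s hs
      simp [indicator, h, hs]
    · filter_upwards [gt_mem_nhds h] with s hs
      simp [indicator, not_lt.2 h.le, not_lt.2 hs.le]

namespace IsPotential

variable {b κ : ℝ≥0∞} {ν U : Measure ℝ}

theorem lap_ne_top (h : IsPotential b κ ν U) {θ : ℝ} (hθ : 0 < θ) : lap U θ ≠ ∞ := by
  intro h'
  have h1 := h.lap_mul θ hθ
  rw [h', ENNReal.top_mul (by simp [h.killing_ne_zero])] at h1
  simp at h1

/-- The integrated renewal equation: by `lap_tailFn` and `lap_mul` both sides have Laplace transform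
`1/θ`. -/
theorem smul_add_withDensity [SFinite U] (h : IsPotential b κ ν U) :
    b • U + volume.withDensity (convFun U (tailFn κ ν)) = volume.restrict (Ioi 0) := by
  have := sigmaFinite_of_Ioi h.levy_Iic h.levy_Ioi
  have key : ∀ θ > 0, lap (b • U + volume.withDensity (convFun U (tailFn κ ν))) θ =
      lap (volume.restrict (Ioi 0)) θ := by
    intro θ hθ
    have h0 : ENNReal.ofReal θ ≠ 0 := by simpa using hθ
    refine (ENNReal.mul_right_inj h0 ENNReal.ofReal_ne_top).1 ?_
    rw [lap_restrict_Ioi hθ, lap_add, lap_smul, ← conv_withDensity _ (measurable_tailFn κ ν),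
      lap_conv, ← h.lap_mul θ hθ, add_assoc (b * _), ← lap_tailFn h.levy_Iic hθ]
    ring
  refine lap_ext ?_ (by rw [Measure.restrict_apply measurableSet_Iio, Iio_inter_Ioi]; simp) ?_ key
  · rw [Measure.add_apply, Measure.smul_apply, h.potential_Iio,
      ← conv_withDensity _ (measurable_tailFn κ ν), conv_Iio_zero h.potential_Iio]
    · simp
    · rw [withDensity_apply _ measurableSet_Iio, setLIntegral_eq_zero measurableSet_Iio]
      intro x hx
      simp [tailFn, (mem_Iio.1 hx).le]
  · intro θ hθ h'
    rw [key θ hθ] at h'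
    have := lap_restrict_Ioi hθ
    rw [h', ENNReal.mul_top (by simpa using hθ)] at this
    simp at this

/-- The bound holds almost everywhere by `smul_add_withDensity`; the exceptional set is open by
lower semicontinuity, and a null open set is empty. -/
theorem convFun_le_one [SFinite U] (h : IsPotential b κ ν U) (t : ℝ) :
    convFun U (tailFn κ ν) t ≤ 1 := by
  have hm := measurable_convFun U (measurable_tailFn κ ν)
  have h1 : ∀ᵐ t, convFun U (tailFn κ ν) t ≤ 1 := by
    refine ae_le_of_forall_setLIntegral_le_of_sigmaFinite hm fun s hs _ => ?_
    rw [← withDensity_apply _ hs]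
    calc _ ≤ (b • U + volume.withDensity (convFun U (tailFn κ ν))) s := by
            rw [Measure.add_apply]; exact le_add_self
      _ ≤ volume s := by rw [h.smul_add_withDensity]; exact Measure.restrict_apply_le _ _
      _ = _ := by simp
  by_contra hlt
  have h2 := lowerSemicontinuous_convFun U (measurable_tailFn κ ν)
    (lowerSemicontinuous_tailFn κ ν) t 1 (not_le.1 hlt)
  have h3 : volume {t | ¬ convFun U (tailFn κ ν) t ≤ 1} = 0 := h1
  have h4 := Measure.measure_pos_of_mem_nhds volume h2
  refine h4.ne' ?_
  simpa [not_le] using h3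

theorem convFun_eq_zero (h : IsPotential b κ ν U) {t : ℝ} (ht : t ≤ 0) :
    convFun U (tailFn κ ν) t = 0 := convFun_tailFn_of_nonpos h.potential_Iio κ ν ht

/-- With positive drift the renewal equation serves as the definition of the density, `u = b⁻¹ (1 -
E)` on the positive half-line, and uniqueness of Laplace transforms identifies it with `U`. -/
theorem exists_density_of_drift [SFinite U] (h : IsPotential b κ ν U) (hb : b ≠ 0) :
    ∃ u : ℝ → ℝ≥0∞, Measurable u ∧ (∀ t ≤ 0, u t = 0) ∧ U = volume.withDensity u ∧
      (∀ t > 0, b * u t + convFun U (tailFn κ ν) t = 1) ∧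
      (∀ t, u t ≤ b⁻¹) ∧ ContinuousOn u (Ioi 0) := by
  set E := convFun U (tailFn κ ν) with hE
  have hm : Measurable E := measurable_convFun U (measurable_tailFn κ ν)
  have hE1 : ∀ t, E t ≤ 1 := h.convFun_le_one
  set u : ℝ → ℝ≥0∞ := fun t => if 0 < t then b⁻¹ * (1 - E t) else 0 with hu
  have hum : Measurable u :=
    Measurable.ite measurableSet_Ioi (by fun_prop) measurable_const
  have hbu : ∀ t > 0, b * u t + E t = 1 := by
    intro t ht
    simp only [hu, if_pos ht]
    rw [← mul_assoc, ENNReal.mul_inv_cancel hb h.drift_ne_top, one_mul, tsub_add_cancel_of_le (hE1 t)]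
  have hle : ∀ t, u t ≤ b⁻¹ := by
    intro t
    simp only [hu]
    split_ifs
    · exact mul_le_of_le_one_right zero_le tsub_le_self
    · exact zero_le
  have hu0 : ∀ t ≤ 0, u t = 0 := fun t ht => by simp [hu, not_lt.2 ht]
  have hone : (fun t => b * u t + E t) = (Ioi (0 : ℝ)).indicator 1 := by
    ext t
    by_cases ht : 0 < t
    · rw [hbu t ht, indicator_of_mem (mem_Ioi.2 ht)]; rfl
    · rw [indicator_of_notMem (by simpa using ht), hu0 t (not_lt.1 ht), hE,
        h.convFun_eq_zero (not_lt.1 ht)]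
      simp
  have hsum : b • volume.withDensity u + volume.withDensity E = volume.restrict (Ioi 0) := by
    rw [← withDensity_smul _ hum, ← withDensity_add_right _ hm, ← withDensity_indicator_one measurableSet_Ioi,
      ← hone]
    rfl
  have hUu : U = volume.withDensity u := by
    refine lap_ext h.potential_Iio ?_ (fun θ hθ => h.lap_ne_top hθ) fun θ hθ => ?_
    · rw [withDensity_apply _ measurableSet_Iio, setLIntegral_eq_zero measurableSet_Iio]
      intro x hx
      exact hu0 x (mem_Iio.1 hx).le
    · have h1 := congrArg (fun m => lap m θ) (h.smul_add_withDensity.trans hsum.symm)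
      simp only [lap_add, lap_smul] at h1
      have h2 : lap (volume.withDensity E) θ ≠ ∞ := by
        intro h'
        have h3 := lap_restrict_Ioi hθ
        rw [← hsum, lap_add, h', add_top, ENNReal.mul_top (by simpa using hθ)] at h3
        simp at h3
      rw [ENNReal.add_left_inj h2] at h1
      exact (ENNReal.mul_right_inj hb h.drift_ne_top).1 h1
  refine ⟨u, hum, hu0, hUu, hbu, hle, ?_⟩
  -- The complementary density `b⁻¹ - u` makes the two convolutions with the tail add up to `b⁻¹`
  -- times its primitive. Both are lower semicontinuous and the sum is continuous, so `E` is
  -- continuous.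
  set w : ℝ → ℝ≥0∞ := (Ioi (0 : ℝ)).indicator fun t => b⁻¹ - u t
  have hwm : Measurable w := (by fun_prop : Measurable fun t => b⁻¹ - u t).indicator measurableSet_Ioi
  have huw : U + volume.withDensity w = b⁻¹ • volume.restrict (Ioi 0) := by
    rw [hUu, ← withDensity_add_right _ hwm, ← withDensity_const,
      ← withDensity_indicator measurableSet_Ioi]
    congr 1
    ext t
    by_cases ht : 0 < t
    · simp only [Pi.add_apply, w, indicator_of_mem (mem_Ioi.2 ht)]
      exact add_tsub_cancel_of_le (hle t)
    · simp only [Pi.add_apply, w, indicator_of_notMem (show t ∉ Ioi 0 from ht), hu0 t (not_lt.1 ht),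
        add_zero]
  have hTm := measurable_tailFn κ ν
  have hTfin := lintegral_Iio_tailFn_ne_top h.levy_Iic h.levy_Ioi h.jump_ne_top h.killing_ne_top
  have hR : ∀ s, E s + convFun (volume.withDensity w) (tailFn κ ν) s =
      b⁻¹ * ∫⁻ y in Iio s, tailFn κ ν y := by
    intro s
    rw [hE, ← convFun_add_measure, huw, ← convFun_restrict_Ioi_tailFn]
    simp [convFun]
  have hEc : Continuous E := continuous_iff_continuousAt.2 fun t =>
    tendsto_of_lowerSemicontinuousAt_add
      (lowerSemicontinuous_convFun U hTm (lowerSemicontinuous_tailFn κ ν) t)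
      (lowerSemicontinuous_convFun _ hTm (lowerSemicontinuous_tailFn κ ν) t)
      ((ENNReal.continuous_const_mul (by simpa using hb)).comp
        (continuous_lintegral_Iio hTm hTfin)).continuousAt
      (ENNReal.mul_ne_top (by simpa using hb) (hTfin t)) hR
  have : ContinuousOn (fun t => b⁻¹ * (1 - E t)) (Ioi 0) := by
    refine Continuous.continuousOn ?_
    refine (ENNReal.continuous_const_mul (by simpa using hb)).comp ?_
    exact (ENNReal.continuous_sub_left ENNReal.one_ne_top).comp hEc
  refine this.congr fun t ht => ?_
  simp only [hu, if_pos (mem_Ioi.1 ht)]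

end IsPotential

theorem jumpExponent_add_measure (μ ν : Measure ℝ) (θ : ℝ) :
    jumpExponent (μ + ν) θ = jumpExponent μ θ + jumpExponent ν θ := by
  simp [jumpExponent]

theorem jumpExponent_mono {μ ν : Measure ℝ} (h : μ ≤ ν) (θ : ℝ) :
    jumpExponent μ θ ≤ jumpExponent ν θ := lintegral_mono' h le_rfl

namespace IsPotential

variable {κ : ℝ≥0∞} {ν U : Measure ℝ}

/-- Decomposition of the potential measure at the first jump that exceeds `ε`. -/
theorem exists_decomposition [IsFiniteMeasure U] (h : IsPotential 0 κ ν U) {ε : ℝ} (hε : 0 < ε) :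
    ∃ V : Measure ℝ, IsFiniteMeasure V ∧ V (Iio 0) = 0 ∧ V univ ≤ (κ + ν (Ioi ε))⁻¹ ∧
      (∀ θ > 0, (κ + ν (Ioi ε) + jumpExponent ν θ)⁻¹ ≤ lap V θ) ∧
      U = V + V ∗ (ν.restrict (Ioi ε) ∗ U) := by
  set ρ := ν.restrict (Ioi ε) with hρ
  have hρf : IsFiniteMeasure ρ := isFiniteMeasure_restrict.2 (h.levy_Ioi ε hε)
  have hρu : ρ univ = ν (Ioi ε) := by simp [hρ]
  have hρ0 : ρ (Iio 0) = 0 :=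
    measure_mono_null Iio_subset_Iic_self (le_antisymm ((Measure.restrict_apply_le _ _).trans h.levy_Iic.le) zero_le)
  set ν₀ := ν.restrict (Iic ε) with hν₀
  have hν : ν = ν₀ + ρ := by
    rw [hν₀, hρ, ← compl_Iic, Measure.restrict_add_restrict_compl measurableSet_Iic]
  set q := κ + ν (Ioi ε)
  have hq0 : q ≠ 0 := by simp [q, h.killing_ne_zero]
  have hq : q ≠ ∞ := by simp [q, h.killing_ne_top, h.levy_Ioi ε hε]
  obtain ⟨V, hV0, hVu, hV⟩ := exists_resolvent (ν := ν₀)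
    (le_antisymm ((Measure.restrict_apply_le _ _).trans h.levy_Iic.le) zero_le)
    (fun δ hδ => ne_top_of_le_ne_top (h.levy_Ioi δ hδ) (Measure.restrict_apply_le _ _)) hq0 hq
  have hVf : IsFiniteMeasure V := ⟨hVu.trans_lt (by simp [pos_iff_ne_zero, hq0])⟩
  have hJ₀ : ∀ θ, jumpExponent ν₀ θ ≤ jumpExponent ν θ := fun θ =>
    jumpExponent_mono Measure.restrict_le_self θ
  refine ⟨V, hVf, hV0, hVu, fun θ hθ => ?_, ?_⟩
  · rw [hV θ hθ]
    exact ENNReal.inv_le_inv.2 (by gcongr; exact hJ₀ θ)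
  · refine lap_ext h.potential_Iio ?_ (fun θ hθ => h.lap_ne_top hθ) fun θ hθ => ?_
    · rw [Measure.add_apply, hV0, conv_Iio_zero hV0 (conv_Iio_zero hρ0 h.potential_Iio), add_zero]
    · rw [lap_add, lap_conv, lap_conv]
      have hA := h.lap_mul θ hθ
      rw [zero_mul, zero_add] at hA
      have hJ : jumpExponent ν θ = jumpExponent ν₀ θ + jumpExponent ρ θ := by
        conv_lhs => rw [hν]
        exact jumpExponent_add_measure _ _ _
      have hJρ := jumpExponent_add_lap hρ0 hθ.le
      -- The denominator `q + jumpExponent ν₀ θ` is rewritten as `κ + jumpExponent ν θ + lap ρ θ`;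
      -- multiplying by `lap U θ` then yields the decomposition.
      have hv : lap V θ * (κ + (jumpExponent ρ θ + lap ρ θ) + jumpExponent ν₀ θ) = 1 := by
        rw [hV θ hθ, hJρ, hρu]
        refine ENNReal.inv_mul_cancel ?_ ?_
        · simp [q, h.killing_ne_zero]
        · exact ENNReal.add_ne_top.2 ⟨hq, ne_top_of_le_ne_top (h.jump_ne_top θ hθ) (hJ₀ θ)⟩
      calc lap U θ = lap U θ * (lap V θ * (κ + (jumpExponent ρ θ + lap ρ θ) +
              jumpExponent ν₀ θ)) := by rw [hv, mul_one]
        _ = lap V θ * (lap U θ * (κ + (jumpExponent ν₀ θ + jumpExponent ρ θ))) +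
              lap V θ * (lap ρ θ * lap U θ) := by ring
        _ = _ := by rw [← hJ, hA, mul_one]

theorem _root_.tendsto_const_add_levy_Ioi (κ : ℝ≥0∞) {ν : Measure ℝ} (hinf : ν (Ioi 0) = ∞) :
    Filter.Tendsto (fun n : ℕ => κ + ν (Ioi (1 / ((n : ℝ) + 1)))) Filter.atTop (nhds ∞) := by
  have h1 := tendsto_measure_iUnion_atTop (μ := ν) monotone_Ioi_one_div
  rw [iUnion_Ioi_one_div, hinf] at h1
  simpa using h1.const_add κ

/-- After the first jump larger than `ε` the law is smoothed by the absolutely continuous jump. A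
null set is therefore charged only by `V`, whose mass tends to `0` with `ε` because the Lévy measure
is infinite. -/
theorem absolutelyContinuous [IsFiniteMeasure U] (h : IsPotential 0 κ ν U) (hinf : ν (Ioi 0) = ∞)
    (hac : ∀ ε > 0, ν.restrict (Ioi ε) ≪ volume) : U ≪ volume := by
  intro A hA
  have h1 : ∀ n : ℕ, U A ≤ (κ + ν (Ioi (1 / ((n : ℝ) + 1))))⁻¹ := by
    intro n
    have hε : (0 : ℝ) < 1 / ((n : ℝ) + 1) := by positivity
    obtain ⟨V, _, -, hVu, -, hU⟩ := h.exists_decomposition hε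
    have hfin : IsFiniteMeasure (ν.restrict (Ioi (1 / ((n : ℝ) + 1)))) :=
      isFiniteMeasure_restrict.2 (h.levy_Ioi _ hε)
    have h2 : V ∗ (ν.restrict (Ioi (1 / ((n : ℝ) + 1))) ∗ U) ≪ volume := by
      refine Measure.conv_absolutelyContinuous ?_
      rw [Measure.conv_comm]
      exact Measure.conv_absolutelyContinuous (hac _ hε)
    calc U A = V A + (V ∗ (ν.restrict (Ioi (1 / ((n : ℝ) + 1))) ∗ U)) A := by
          conv_lhs => rw [hU]
          rfl
      _ = V A := by rw [h2 hA, add_zero]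
      _ ≤ _ := (measure_mono (subset_univ A)).trans hVu
  have h3 := (tendsto_const_add_levy_Ioi κ hinf).inv
  rw [ENNReal.inv_top] at h3
  exact le_antisymm (ge_of_tendsto' h3 h1) zero_le

theorem convFun_eq_one_ae [IsFiniteMeasure U] (h : IsPotential 0 κ ν U) :
    convFun U (tailFn κ ν) =ᵐ[volume] (Ioi 0).indicator 1 := by
  have h1 := h.smul_add_withDensity
  rw [zero_smul, zero_add, ← withDensity_indicator_one measurableSet_Ioi] at h1
  exact (withDensity_eq_iff_of_sigmaFinite
    (measurable_convFun U (measurable_tailFn κ ν)).aemeasurable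
    (measurable_one.indicator measurableSet_Ioi).aemeasurable).1 h1

/-- Inserting the decomposition gives `E = V * (T + ρ * E)`, where `T` is the tail. As `E = 1`
almost everywhere on the half-line and `ρ` is absolutely continuous, `ρ * E` at `y` is `ρ(-∞, y)`;
for `y > 0` this and `T y` together are at least `κ + ν(ε,∞)`. -/
theorem mul_le_convFun [IsFiniteMeasure U] (h : IsPotential 0 κ ν U)
    (hac : ∀ ε > 0, ν.restrict (Ioi ε) ≪ volume) {ε : ℝ} (hε : 0 < ε) {V : Measure ℝ}
    [IsFiniteMeasure V] (hU : U = V + V ∗ (ν.restrict (Ioi ε) ∗ U)) (t : ℝ) :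
    (κ + ν (Ioi ε)) * V (Iio t) ≤ convFun U (tailFn κ ν) t := by
  set ρ := ν.restrict (Ioi ε) with hρ
  have hρf : IsFiniteMeasure ρ := isFiniteMeasure_restrict.2 (h.levy_Ioi ε hε)
  have hT := measurable_tailFn κ ν
  set E := convFun U (tailFn κ ν) with hE
  have h1 : ∀ y, convFun ρ E y = ρ (Iio y) := by
    intro y
    have hq : Measure.QuasiMeasurePreserving (fun x : ℝ => y - x) volume volume :=
      quasiMeasurePreserving_sub_left_of_right_invariant volume y
    have h2 := (hac ε hε).ae_le (hq.ae h.convFun_eq_one_ae)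
    rw [← lintegral_indicator_one measurableSet_Iio]
    refine lintegral_congr_ae ?_
    filter_upwards [h2] with x hx
    rw [hE, hx]
    simp [indicator]
  have h3 : E t = convFun V (fun y => tailFn κ ν y + ρ (Iio y)) t := by
    rw [hE]
    conv_lhs => rw [hU]
    rw [convFun_add_measure, convFun_conv _ _ hT, convFun_conv _ _ hT, ← hE, funext h1]
    unfold convFun
    rw [lintegral_add_left (by fun_prop)]
  rw [h3, ← lintegral_indicator_const measurableSet_Iio]
  refine lintegral_mono fun x => ?_
  by_cases hx : x < t
  · rw [indicator_of_mem (mem_Iio.2 hx)]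
    simp only [tailFn, if_pos (sub_pos.2 hx)]
    rw [add_assoc]
    gcongr
    have h4 : ρ (Iio (t - x)) = ρ (Iic (t - x)) := by
      have h5 : ρ {t - x} = 0 := hac ε hε (by simp)
      rw [← Iio_union_right]
      exact le_antisymm (measure_mono subset_union_left)
        ((measure_union_le _ _).trans (by rw [h5, add_zero]))
    rw [h4, add_comm, hρ, Measure.restrict_apply measurableSet_Iic]
    refine le_trans (measure_mono fun y hy => ?_) (measure_union_le _ _)
    rcases le_or_gt y (t - x) with h | h
    · exact Or.inl ⟨h, hy⟩
    · exact Or.inr h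
  · rw [indicator_of_notMem (by simpa using hx)]
    exact zero_le

/-- As `ε → 0` the normalised measures `q V` concentrate at `0`, since their Laplace transform at
`1` is at least `q / (q + J) → 1`. Hence `q V(-∞, t) → 1`, and `mul_le_convFun` bounds `E t` below
at this very point. -/
theorem convFun_eq_one [IsFiniteMeasure U] (h : IsPotential 0 κ ν U) (hinf : ν (Ioi 0) = ∞)
    (hac : ∀ ε > 0, ν.restrict (Ioi ε) ≪ volume) {t : ℝ} (ht : 0 < t) :
    convFun U (tailFn κ ν) t = 1 := by
  refine le_antisymm (h.convFun_le_one t) ?_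
  set e := convFun U (tailFn κ ν) t with he
  set q : ℕ → ℝ≥0∞ := fun n => κ + ν (Ioi (1 / ((n : ℝ) + 1)))
  set J := jumpExponent ν 1
  have hJ : J ≠ ∞ := h.jump_ne_top 1 one_pos
  set r := ENNReal.ofReal (Real.exp (-t))
  have hr : r < 1 := by
    rw [← ENNReal.ofReal_one]
    exact (ENNReal.ofReal_lt_ofReal_iff one_pos).2 (by simpa using ht)
  have h1 : ∀ n, (1 + J / q n)⁻¹ ≤ (1 - r) * e + r := by
    intro n
    have hε : (0 : ℝ) < 1 / ((n : ℝ) + 1) := by positivity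
    have hq0 : q n ≠ 0 := by simp [q, h.killing_ne_zero]
    have hq : q n ≠ ∞ := ENNReal.add_ne_top.2 ⟨h.killing_ne_top, h.levy_Ioi _ hε⟩
    obtain ⟨V, hVf, hV0, hVu, hVl, hU⟩ := h.exists_decomposition hε
    have h0 : ∀ᵐ x ∂V, 0 ≤ x := by rw [ae_iff]; simpa [Iio_def] using hV0
    -- A Markov-type bound: `e^{-x}` is at most `1` on `[0, t)` and at most `r = e^{-t}` beyond.
    have h2 : lap V 1 ≤ (1 - r) * V (Iio t) + r * V univ := by
      rw [← lintegral_indicator_const measurableSet_Iio,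
        show r * V univ = ∫⁻ _, r ∂V by simp, ← lintegral_add_right _ measurable_const]
      refine lintegral_mono_ae ?_
      filter_upwards [h0] with x hx
      by_cases hxt : x < t
      · rw [indicator_of_mem (mem_Iio.2 hxt), tsub_add_cancel_of_le hr.le, ← ENNReal.ofReal_one]
        exact ENNReal.ofReal_le_ofReal (by simpa using hx)
      · rw [indicator_of_notMem (by simpa using hxt), zero_add]
        exact ENNReal.ofReal_le_ofReal (by simpa using hxt)
    calc (1 + J / q n)⁻¹ = q n * (q n + J)⁻¹ := by
          rw [show q n + J = q n * (1 + J / q n) by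
            rw [mul_add, mul_one, ENNReal.mul_div_cancel hq0 hq],
            ENNReal.mul_inv (Or.inl hq0) (Or.inl hq), ← mul_assoc, ENNReal.mul_inv_cancel hq0 hq,
            one_mul]
      _ ≤ q n * ((1 - r) * V (Iio t) + r * V univ) := by gcongr; exact (hVl 1 one_pos).trans h2
      _ = (1 - r) * (q n * V (Iio t)) + r * (q n * V univ) := by ring
      _ ≤ (1 - r) * e + r * 1 := by
          gcongr
          · exact h.mul_le_convFun hac hε hU t
          · calc q n * V univ ≤ q n * (q n)⁻¹ := by gcongr
              _ = 1 := ENNReal.mul_inv_cancel hq0 hq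
      _ = _ := by rw [mul_one]
  have h2 : Filter.Tendsto (fun n => (1 + J / q n)⁻¹) Filter.atTop (nhds 1) := by
    have h3 : Filter.Tendsto (fun n => J / q n) Filter.atTop (nhds (J / ∞)) :=
      ENNReal.Tendsto.const_div (tendsto_const_add_levy_Ioi κ hinf) (Or.inr hJ)
    simpa using (h3.const_add 1).inv
  have h3 : 1 ≤ (1 - r) * e + r := le_of_tendsto' h2 h1
  have h4 : 1 - r ≤ (1 - r) * e := tsub_le_iff_right.2 h3
  have h5 : (1 - r) * 1 ≤ (1 - r) * e := by rwa [mul_one]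
  exact (ENNReal.mul_le_mul_iff_right (tsub_pos_of_lt hr).ne'
    (ENNReal.sub_ne_top ENNReal.one_ne_top)).1 h5

/-- The potential measure has a density that solves the renewal equation at every point. -/
theorem exists_density {b : ℝ≥0∞} [IsFiniteMeasure U] (h : IsPotential b κ ν U)
    (hinf : ν (Ioi 0) = ∞) (hac : ∀ ε > 0, ν.restrict (Ioi ε) ≪ volume) :
    ∃ u : ℝ → ℝ≥0∞, Measurable u ∧ (∀ t ≤ 0, u t = 0) ∧ U = volume.withDensity u ∧
      (∀ t > 0, b * u t + convFun U (tailFn κ ν) t = 1) ∧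
      (b ≠ 0 → (∀ t, u t ≤ b⁻¹) ∧ ContinuousOn u (Ioi 0)) := by
  by_cases hb : b = 0
  · subst hb
    have hUac := h.absolutelyContinuous hinf hac
    -- Without drift the equation sees the density only through `U`, so any version of it will do.
    have hm : Measurable ((Ioi 0).indicator (U.rnDeriv volume)) :=
      (Measure.measurable_rnDeriv U volume).indicator measurableSet_Ioi
    refine ⟨(Ioi 0).indicator (U.rnDeriv volume), hm,
      fun t ht => indicator_of_notMem (by simpa using ht) _, ?_, fun t ht => ?_, by simp⟩
    · rw [withDensity_indicator measurableSet_Ioi, ← restrict_withDensity measurableSet_Ioi,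
        Measure.withDensity_rnDeriv_eq _ _ hUac, eq_comm, Measure.restrict_eq_self_of_ae_mem]
      rw [ae_iff]
      have h1 : U {0} = 0 := hUac (by simp)
      have h2 := h.potential_Iio
      refine measure_mono_null (t := Iio 0 ∪ {0}) (fun x hx => ?_) (measure_union_null h2 h1)
      rw [Iio_union_right]
      simpa using hx
    · rw [zero_mul, zero_add, h.convFun_eq_one hinf hac ht]
  · obtain ⟨u, h1, h2, h3, h4, h5⟩ := h.exists_density_of_drift hb
    exact ⟨u, h1, h2, h3, h4, fun _ => h5⟩

end IsPotential

/-! ### Caputo-Djrbashian derivatives through densities. -/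

/-- `F` is an absolutely continuous function on `[0, ∞)` with a density for which the
Caputo-Djrbashian derivative with respect to `B` makes sense and equals `D` everywhere. -/
def HasCaputo (B : BernsteinTriplet) (F D : ℝ → ℝ) : Prop :=
  ∃ w : ℝ → ℝ, (∀ T, 0 ≤ T → IntervalIntegrable w volume 0 T) ∧
    (∀ t, 0 ≤ t → F t = F 0 + ∫ s in (0 : ℝ)..t, w s) ∧
    (B.b ≠ 0 → ContinuousOn w (Ioi 0)) ∧
    ∀ t, 0 < t → IntervalIntegrable (fun s => w (t - s) * B.tail s) volume 0 t ∧
      B.b * w t + ∫ s in (0 : ℝ)..t, w (t - s) * B.tail s = D t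

namespace HasCaputo

variable {B : BernsteinTriplet} {F F' D D' : ℝ → ℝ}

theorem congr (h : HasCaputo B F D) (hF : ∀ t, 0 ≤ t → F' t = F t)
    (hD : ∀ t, 0 < t → D' t = D t) : HasCaputo B F' D' := by
  obtain ⟨w, h1, h2, h3, h4⟩ := h
  refine ⟨w, h1, fun t ht => ?_, h3, fun t ht => ?_⟩
  · rw [hF t ht, hF 0 le_rfl, h2 t ht]
  · rw [hD t ht]; exact h4 t ht

theorem const (B : BernsteinTriplet) (C : ℝ) : HasCaputo B (fun _ => C) (fun _ => 0) :=
  ⟨fun _ => 0, fun _ _ => by simp, fun _ _ => by simp, fun _ => continuousOn_const,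
    fun _ _ => by simp⟩

theorem add (h : HasCaputo B F D) (h' : HasCaputo B F' D') :
    HasCaputo B (fun t => F t + F' t) (fun t => D t + D' t) := by
  obtain ⟨w, h1, h2, h3, h4⟩ := h
  obtain ⟨w', h1', h2', h3', h4'⟩ := h'
  refine ⟨fun t => w t + w' t, fun T hT => (h1 T hT).add (h1' T hT), fun t ht => ?_,
    fun hb => (h3 hb).add (h3' hb), fun t ht => ?_⟩
  · beta_reduce
    rw [intervalIntegral.integral_add (h1 t ht) (h1' t ht), h2 t ht, h2' t ht]; ring
  · simp only [add_mul]
    refine ⟨(h4 t ht).1.add (h4' t ht).1, ?_⟩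
    rw [intervalIntegral.integral_add (h4 t ht).1 (h4' t ht).1, ← (h4 t ht).2, ← (h4' t ht).2]
    ring

theorem const_mul (c : ℝ) (h : HasCaputo B F D) :
    HasCaputo B (fun t => c * F t) (fun t => c * D t) := by
  obtain ⟨w, h1, h2, h3, h4⟩ := h
  refine ⟨fun t => c * w t, fun T hT => (h1 T hT).const_mul c, fun t ht => ?_,
    fun hb => continuousOn_const.mul (h3 hb), fun t ht => ?_⟩
  · beta_reduce
    rw [intervalIntegral.integral_const_mul, h2 t ht]; ring
  · simp only [mul_assoc]
    refine ⟨(h4 t ht).1.const_mul c, ?_⟩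
    rw [intervalIntegral.integral_const_mul, ← (h4 t ht).2]
    ring

theorem absolutelyContinuousOnInterval (h : HasCaputo B F D) {T : ℝ} (hT : 0 ≤ T) :
    AbsolutelyContinuousOnInterval F 0 T := by
  obtain ⟨w, h1, h2, -, -⟩ := h
  have h3 := (h1 T hT).absolutelyContinuousOnInterval_intervalIntegral (c := 0) left_mem_uIcc
  rw [absolutelyContinuousOnInterval_iff] at h3 ⊢
  intro ε hε
  obtain ⟨δ, hδ, H⟩ := h3 ε hε
  refine ⟨δ, hδ, fun E hE hEδ => ?_⟩
  refine lt_of_le_of_lt (le_of_eq (Finset.sum_congr rfl fun i hi => ?_)) (H E hE hEδ)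
  have h4 := hE.1 i hi
  rw [uIcc_of_le hT] at h4
  rw [h2 _ h4.1.1, h2 _ h4.2.1, dist_add_left]

/-- Lebesgue differentiation gives the derivative almost everywhere. When there is drift, the
pointwise term `b u'(t)` needs it everywhere, which is why `HasCaputo` asks for a continuous density
in that case. -/
theorem hasDerivAt_ae (h : HasCaputo B F D) : ∃ w : ℝ → ℝ,
    (∀ᵐ x, 0 < x → HasDerivAt F (w x) x) ∧ (B.b ≠ 0 → ∀ x, 0 < x → HasDerivAt F (w x) x) ∧
    ∀ t, 0 < t → IntervalIntegrable (fun s => w (t - s) * B.tail s) volume 0 t ∧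
      B.b * w t + ∫ s in (0 : ℝ)..t, w (t - s) * B.tail s = D t := by
  obtain ⟨w, h1, h2, h3, h4⟩ := h
  have hF : ∀ x, 0 < x → HasDerivAt (fun t => ∫ s in (0 : ℝ)..t, w s) (w x) x →
      HasDerivAt F (w x) x := by
    intro x hx hd
    refine (hd.const_add (F 0)).congr_of_eventuallyEq ?_
    filter_upwards [lt_mem_nhds hx] with y hy using h2 y hy.le
  refine ⟨w, ?_, fun hb x hx => hF x hx ?_, h4⟩
  · have h5 : ∀ n : ℕ, ∀ᵐ x, x ∈ uIcc (0 : ℝ) n → ∀ c ∈ uIcc (0 : ℝ) n,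
        HasDerivAt (fun x => ∫ s in c..x, w s) (w x) x := fun n =>
      (h1 n n.cast_nonneg).ae_hasDerivAt_integral
    filter_upwards [ae_all_iff.2 h5] with x hx hx0
    obtain ⟨n, hn⟩ := exists_nat_ge x
    refine hF x hx0 (hx n ?_ 0 left_mem_uIcc)
    rw [uIcc_of_le n.cast_nonneg]
    exact ⟨hx0.le, hn⟩
  · refine intervalIntegral.integral_hasDerivAt_right (h1 x hx.le) ?_
      ((h3 hb).continuousAt (Ioi_mem_nhds hx))
    exact (h3 hb).stronglyMeasurableAtFilter isOpen_Ioi x hx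

/-- The integrand with the derivative of `F` differs from the one with the density only on a null
set of `s`, because reflection `s ↦ t - s` preserves null sets. -/
theorem definedAt_and_caputo (h : HasCaputo B F D) {t : ℝ} (ht : 0 < t) :
    B.CaputoDefinedAt F t ∧ B.caputo F t = D t := by
  obtain ⟨w, h1, h2, h3⟩ := h.hasDerivAt_ae
  have h4 : ∀ᵐ s, s ∈ uIoc 0 t → w (t - s) * B.tail s = deriv (fun r => F (r - s)) t * B.tail s := by
    have h5 : ∀ᵐ s : ℝ, 0 < t - s → HasDerivAt F (w (t - s)) (t - s) :=
      (quasiMeasurePreserving_sub_left_of_right_invariant volume t).ae h1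
    have h6 : ∀ᵐ s : ℝ, s ≠ t := by simp [ae_iff]
    filter_upwards [h5, h6] with s hs hst hmem
    rw [uIoc_of_le ht.le] at hmem
    have : 0 < t - s := sub_pos.2 (lt_of_le_of_ne hmem.2 hst)
    rw [deriv_comp_sub_const, (hs this).deriv]
  refine ⟨⟨fun hb => (h2 hb t ht).differentiableAt, ?_⟩, ?_⟩
  · exact (h3 t ht).1.congr_ae ((ae_restrict_iff' measurableSet_uIoc).2 h4)
  · rw [← (h3 t ht).2, BernsteinTriplet.caputo, intervalIntegral.integral_congr_ae h4]
    congr 1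
    by_cases hb : B.b = 0
    · simp [hb]
    · rw [(h2 hb t ht).deriv]

end HasCaputo

/-! ### Convolution powers of the potential density. -/

theorem convFun_withDensity_comm {f g : ℝ → ℝ≥0∞} (hf : Measurable f) (hg : Measurable g) :
    convFun (volume.withDensity f) g = convFun (volume.withDensity g) f := by
  ext t
  unfold convFun
  rw [lintegral_withDensity_eq_lintegral_mul _ hf (by fun_prop),
    lintegral_withDensity_eq_lintegral_mul _ hg (by fun_prop),
    ← lintegral_sub_left_eq_self (fun y => (f * fun x => g (t - x)) y) t]
  refine lintegral_congr fun x => ?_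
  simp [mul_comm]

/-- The convolution powers `u, u * u, u * u * u, …` of a function. -/
def densityPow (u : ℝ → ℝ≥0∞) : ℕ → ℝ → ℝ≥0∞
  | 0 => u
  | j + 1 => convFun (volume.withDensity u) (densityPow u j)

section densityPow

variable {u : ℝ → ℝ≥0∞}

theorem measurable_densityPow (hu : Measurable u) (j : ℕ) : Measurable (densityPow u j) := by
  induction j with
  | zero => exact hu
  | succ j ih => exact measurable_convFun _ ih

theorem withDensity_densityPow_succ (hu : Measurable u) (j : ℕ) :
    volume.withDensity (densityPow u (j + 1)) =
      volume.withDensity u ∗ volume.withDensity (densityPow u j) :=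
  (conv_withDensity _ (measurable_densityPow hu j)).symm

theorem isFiniteMeasure_densityPow (hu : Measurable u) [IsFiniteMeasure (volume.withDensity u)]
    (j : ℕ) : IsFiniteMeasure (volume.withDensity (densityPow u j)) := by
  induction j with
  | zero => assumption
  | succ j ih => rw [withDensity_densityPow_succ hu]; infer_instance

theorem lap_densityPow (hu : Measurable u) [IsFiniteMeasure (volume.withDensity u)] (j : ℕ)
    (θ : ℝ) : lap (volume.withDensity (densityPow u j)) θ = lap (volume.withDensity u) θ ^ (j + 1) := by
  induction j with
  | zero => simp [densityPow]
  | succ j ih =>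
    have := isFiniteMeasure_densityPow hu j
    rw [withDensity_densityPow_succ hu, lap_conv, ih, pow_succ' _ (j + 1)]

theorem densityPow_of_nonpos (hu0 : ∀ t ≤ 0, u t = 0) (hu : Measurable u) (j : ℕ) {t : ℝ}
    (ht : t ≤ 0) : densityPow u j t = 0 := by
  induction j generalizing t with
  | zero => exact hu0 t ht
  | succ j ih =>
    simp only [densityPow, convFun]
    rw [lintegral_withDensity_eq_lintegral_mul _ hu
      (by have := measurable_densityPow hu j; fun_prop)]
    refine (lintegral_congr fun x => ?_).trans lintegral_zero
    rcases le_or_gt x 0 with h | h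
    · simp [hu0 x h]
    · simp [ih (show t - x ≤ 0 by linarith)]

/-- The powers may jump only at `0`. In the convolution this discontinuity sits at the single point
`x = t`, a null set, so dominated convergence gives continuity. -/
theorem densityPow_bounded_continuousOn (hu0 : ∀ t ≤ 0, u t = 0) (hu : Measurable u)
    [IsFiniteMeasure (volume.withDensity u)] {C : ℝ≥0∞} (hC : C ≠ ∞) (hle : ∀ t, u t ≤ C)
    (hc : ContinuousOn u (Ioi 0)) (j : ℕ) :
    (∃ K, K ≠ ∞ ∧ ∀ t, densityPow u j t ≤ K) ∧ ContinuousOn (densityPow u j) (Ioi 0) := by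
  induction j with
  | zero => exact ⟨⟨C, hC, hle⟩, hc⟩
  | succ j ih =>
    obtain ⟨⟨K, hK, hj⟩, hcj⟩ := ih
    have hm := measurable_densityPow hu j
    refine ⟨⟨K * volume.withDensity u univ, ENNReal.mul_ne_top hK (measure_ne_top _ _), fun t => ?_⟩,
      Continuous.continuousOn (continuous_iff_continuousAt.2 fun t => ?_)⟩
    · simp only [densityPow, convFun]
      exact (lintegral_mono fun x => hj _).trans (by simp)
    · simp only [densityPow]
      refine tendsto_lintegral_filter_of_dominated_convergence (fun _ => K)
        (Filter.Eventually.of_forall fun s => by fun_prop)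
        (Filter.Eventually.of_forall fun s => Filter.Eventually.of_forall fun x => hj _)
        (by rw [lintegral_const]; exact ENNReal.mul_ne_top hK (measure_ne_top _ _)) ?_
      have hne : ∀ᵐ x ∂(volume.withDensity u), x ≠ t :=
        (withDensity_absolutelyContinuous volume u).ae_le (show ∀ᵐ x : ℝ, x ≠ t by simp [ae_iff])
      filter_upwards [hne] with x hx
      have hat : ContinuousAt (densityPow u j) (t - x) := by
        rcases lt_or_gt_of_ne hx with h | h
        · exact hcj.continuousAt (Ioi_mem_nhds (sub_pos.2 h))
        · refine (continuousAt_const (y := (0 : ℝ≥0∞))).congr ?_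
          filter_upwards [gt_mem_nhds (sub_neg.2 h)] with y hy
          exact (densityPow_of_nonpos hu0 hu j hy.le).symm
      exact hat.tendsto.comp ((continuous_sub_right x).tendsto t)

/-- Convolving the equation `b u + u * T = 1` on the positive half-line with the next lower power
turns the right-hand side into a distribution function. -/
theorem densityPow_renewal (hu0 : ∀ t ≤ 0, u t = 0) (hu : Measurable u)
    [IsFiniteMeasure (volume.withDensity u)] {b : ℝ≥0∞} {T : ℝ → ℝ≥0∞} (hT : Measurable T)
    (hT0 : ∀ t ≤ 0, T t = 0)
    (h : ∀ t > 0, b * u t + convFun (volume.withDensity u) T t = 1) (j : ℕ) (t : ℝ) :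
    b * densityPow u (j + 1) t + convFun (volume.withDensity (densityPow u (j + 1))) T t =
      volume.withDensity (densityPow u j) (Iio t) := by
  have hm := measurable_densityPow hu j
  have := isFiniteMeasure_densityPow hu j
  have h0 : ∀ t ≤ 0, convFun (volume.withDensity u) T t = 0 := by
    intro t ht
    unfold convFun
    rw [lintegral_withDensity_eq_lintegral_mul _ hu (by fun_prop)]
    refine (lintegral_congr fun x => ?_).trans lintegral_zero
    rcases le_or_gt x 0 with h | h
    · simp [hu0 x h]
    · simp [hT0 _ (show t - x ≤ 0 by linarith)]
  rw [withDensity_densityPow_succ hu, Measure.conv_comm, convFun_conv _ _ hT, densityPow,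
    convFun_withDensity_comm hu hm]
  have hcm : Measurable (convFun (volume.withDensity u) T) := measurable_convFun _ hT
  unfold convFun at hcm h0 h ⊢
  rw [← lintegral_const_mul _ (by fun_prop), ← lintegral_add_left (by fun_prop),
    ← lintegral_indicator_one measurableSet_Iio]
  refine lintegral_congr fun x => ?_
  by_cases hx : x < t
  · rw [indicator_of_mem (mem_Iio.2 hx), h _ (sub_pos.2 hx)]; rfl
  · rw [indicator_of_notMem (by simpa using hx), h0 _ (by linarith), hu0 _ (by linarith)]; simp

end densityPow

/-! ### The Lévy measure and the tail of a Bernstein function. -/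

namespace BernsteinTriplet

variable (B : BernsteinTriplet)

theorem levy_ae_pos : ∀ᵐ s ∂B.levy, 0 < s := by
  rw [ae_iff]; simpa [Iic_def] using B.levy_Iic

theorem levy_Ioi_ne_top {ε : ℝ} (hε : 0 < ε) : B.levy (Ioi ε) ≠ ∞ := by
  have h1 : ENNReal.ofReal (min ε 1) * B.levy (Ioi ε) ≤
      ∫⁻ s, ENNReal.ofReal (min s 1) ∂B.levy := by
    rw [← lintegral_indicator_const measurableSet_Ioi]
    refine lintegral_mono fun s => ?_
    by_cases hs : ε < s
    · rw [indicator_of_mem (mem_Ioi.2 hs)]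
      exact ENNReal.ofReal_le_ofReal (min_le_min_right _ hs.le)
    · rw [indicator_of_notMem (by simpa using hs)]
      exact zero_le
  intro h
  rw [h, ENNReal.mul_top (by simpa using hε)] at h1
  exact absurd B.lintegral_min_lt_top (not_lt.2 h1)

theorem jumpExponent_levy_ne_top {θ : ℝ} (hθ : 0 < θ) : jumpExponent B.levy θ ≠ ∞ := by
  have h1 : jumpExponent B.levy θ ≤
      ∫⁻ s, ENNReal.ofReal (max θ 1) * ENNReal.ofReal (min s 1) ∂B.levy := by
    refine lintegral_mono_ae ?_
    filter_upwards [B.levy_ae_pos] with s hs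
    rw [← ENNReal.ofReal_mul (by positivity)]
    apply ENNReal.ofReal_le_ofReal
    have h2 := Real.add_one_le_exp (-(θ * s))
    have h3 := Real.exp_pos (-(θ * s))
    rcases le_total s 1 with h | h
    · rw [min_eq_left h]
      nlinarith [le_max_left θ 1]
    · rw [min_eq_right h]
      nlinarith [le_max_right θ 1]
  rw [lintegral_const_mul _ (by fun_prop)] at h1
  exact ne_top_of_le_ne_top (ENNReal.mul_ne_top ENNReal.ofReal_ne_top B.lintegral_min_lt_top.ne) h1

theorem toFun_eq {θ : ℝ} (hθ : 0 < θ) :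
    B.toFun θ = B.a + B.b * θ + (jumpExponent B.levy θ).toReal := by
  rw [toFun, jumpExponent, integral_eq_lintegral_of_nonneg_ae _ (by fun_prop)]
  filter_upwards [B.levy_ae_pos] with s hs
  simp only [Pi.zero_apply, sub_nonneg, Real.exp_le_one_iff]
  nlinarith [mul_pos hθ hs]

theorem toFun_nonneg {θ : ℝ} (hθ : 0 < θ) : 0 ≤ B.toFun θ := by
  rw [B.toFun_eq hθ]
  have := B.a_nonneg
  have := mul_nonneg B.b_nonneg hθ.le
  positivity

theorem ofReal_toFun {θ : ℝ} (hθ : 0 < θ) : ENNReal.ofReal (B.toFun θ) =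
    ENNReal.ofReal B.b * ENNReal.ofReal θ + ENNReal.ofReal B.a + jumpExponent B.levy θ := by
  have h1 := B.a_nonneg
  have h2 := mul_nonneg B.b_nonneg hθ.le
  rw [B.toFun_eq hθ, ENNReal.ofReal_add (by positivity) (by positivity),
    ENNReal.ofReal_toReal (B.jumpExponent_levy_ne_top hθ), ENNReal.ofReal_add h1 h2,
    ENNReal.ofReal_mul B.b_nonneg, add_comm (ENNReal.ofReal B.a)]

theorem antitoneOn_tail : AntitoneOn B.tail (Ioi 0) := by
  intro x hx y _ hxy
  unfold tail
  gcongr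
  exact B.levy_Ioi_ne_top hx

theorem measurable_tail_indicator : Measurable fun s => (Ioi 0).indicator B.tail s := by
  have h : (Ioi 0).indicator B.tail =
      (Ioi 0).indicator fun s => B.a + (tailFn 0 B.levy s).toReal := by
    ext s
    by_cases hs : 0 < s
    · simp [tail, tailFn, hs, Measure.real]
    · simp [indicator_of_notMem (show s ∉ Ioi 0 from hs)]
  rw [h]
  have := measurable_tailFn 0 B.levy
  exact Measurable.indicator (by fun_prop) measurableSet_Ioi

theorem tail_nonneg (s : ℝ) : 0 ≤ B.tail s := add_nonneg B.a_nonneg measureReal_nonneg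

theorem ofReal_tail {s : ℝ} (hs : 0 < s) :
    ENNReal.ofReal (B.tail s) = ENNReal.ofReal B.a + B.levy (Ioi s) := by
  rw [tail, ENNReal.ofReal_add B.a_nonneg measureReal_nonneg, ofReal_measureReal
    (B.levy_Ioi_ne_top hs)]

/-- The fundamental theorem of calculus for the absolutely continuous tail shows that `-tail'` is a
density of the Lévy measure, by comparison on half-open intervals. -/
theorem levy_restrict_Ioc_absolutelyContinuous {c d : ℝ} (hc : 0 < c)
    (h : AbsolutelyContinuousOnInterval B.tail c d) (hcd : c ≤ d) :
    B.levy.restrict (Ioc c d) ≪ volume := by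
  set g : ℝ → ℝ≥0∞ := fun x => ENNReal.ofReal (-deriv B.tail x) with hg
  have hi := h.intervalIntegrable_deriv
  have hfin : B.levy (Ioc c d) ≠ ∞ :=
    ne_top_of_le_ne_top (B.levy_Ioi_ne_top hc) (measure_mono fun x hx => hx.1)
  have key : B.levy.restrict (Ioc c d) = (volume.restrict (Ioc c d)).withDensity g := by
    have : IsFiniteMeasure (B.levy.restrict (Ioc c d)) := isFiniteMeasure_restrict.2 hfin
    refine Measure.ext_of_Ioc _ _ fun x y hxy => ?_
    rw [Measure.restrict_apply measurableSet_Ioc, withDensity_apply _ measurableSet_Ioc,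
      Measure.restrict_restrict measurableSet_Ioc, Ioc_inter_Ioc]
    set x' := max x c
    set y' := min y d
    rcases le_or_gt y' x' with hle | hlt
    · simp [Ioc_eq_empty_of_le hle]
    have hx' : 0 < x' := hc.trans_le (le_max_right _ _)
    have hsub : uIcc x' y' ⊆ uIcc c d := by
      rw [uIcc_of_le hlt.le, uIcc_of_le hcd]
      exact Icc_subset_Icc (le_max_right _ _) (min_le_right _ _)
    have h1 := (h.mono hsub).integral_deriv_eq_sub
    have h2 := (h.mono hsub).intervalIntegrable_deriv
    have hreal : B.levy.real (Ioc x' y') = B.tail x' - B.tail y' := by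
      have hd : Ioi x' \ Ioi y' = Ioc x' y' := by ext z; simp
      rw [← hd, measureReal_sdiff (Ioi_subset_Ioi hlt.le) measurableSet_Ioi
        (B.levy_Ioi_ne_top hx')]
      simp [tail]
    rw [← ofReal_measureReal (ne_top_of_le_ne_top (B.levy_Ioi_ne_top hx')
      (measure_mono fun z hz => hz.1)), hreal, hg, ← ofReal_integral_eq_lintegral_ofReal]
    · rw [integral_neg, ← intervalIntegral.integral_of_le hlt.le, h1, neg_sub]
    · exact ((intervalIntegrable_iff_integrableOn_Ioc_of_le hlt.le).1 h2).neg
    · refine (ae_restrict_iff' measurableSet_Ioc).2 (Filter.Eventually.of_forall fun z hz => ?_)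
      have hz0 : z ∈ Ioi (0 : ℝ) := hx'.trans hz.1
      have := B.antitoneOn_tail.derivWithin_nonpos (x := z)
      rw [derivWithin_of_isOpen isOpen_Ioi hz0] at this
      simpa using this
  rw [key]
  exact (withDensity_absolutelyContinuous _ _).trans Measure.restrict_le_self.absolutelyContinuous

theorem levy_restrict_Ioi_absolutelyContinuous {B : BernsteinTriplet} (hB : B.ConditionI) {ε : ℝ}
    (hε : 0 < ε) : B.levy.restrict (Ioi ε) ≪ volume := by
  refine Measure.AbsolutelyContinuous.mk fun A hAm hA => ?_
  have hU : Ioi ε = ⋃ n : ℕ, Ioc ε (ε + n) := by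
    ext x
    simp only [mem_Ioi, mem_iUnion, mem_Ioc]
    refine ⟨fun hx => ?_, fun ⟨n, hn⟩ => hn.1⟩
    obtain ⟨n, hn⟩ := exists_nat_ge (x - ε)
    exact ⟨n, hx, by linarith⟩
  rw [hU]
  refine le_antisymm ((Measure.restrict_iUnion_le A).trans_eq ?_) zero_le
  rw [Measure.sum_apply _ hAm]
  exact ENNReal.tsum_eq_zero.2 fun n => B.levy_restrict_Ioc_absolutelyContinuous hε
    (hB.2 ε (ε + n) hε (by simp)) (by simp) hA

/-- The parameter `c` plays the role of additional killing, so the killing rate becomes `a + c`,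
which is positive even if `a = 0`. -/
theorem isPotential {c : ℝ} (hc : 0 < c) {U : Measure ℝ} (hU0 : U (Iio 0) = 0)
    (hU : ∀ θ > 0, lap U θ = ENNReal.ofReal (1 / (c + B.toFun θ))) :
    IsPotential (ENNReal.ofReal B.b) (ENNReal.ofReal B.a + ENNReal.ofReal c) B.levy U where
  drift_ne_top := ENNReal.ofReal_ne_top
  killing_ne_zero := by simp [hc]
  killing_ne_top := by simp
  levy_Iic := B.levy_Iic
  levy_Ioi _ hε := B.levy_Ioi_ne_top hε
  jump_ne_top _ hθ := B.jumpExponent_levy_ne_top hθ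
  potential_Iio := hU0
  lap_mul θ hθ := by
    have h0 := B.toFun_nonneg hθ
    rw [hU θ hθ, show ENNReal.ofReal B.b * ENNReal.ofReal θ +
        (ENNReal.ofReal B.a + ENNReal.ofReal c) + jumpExponent B.levy θ =
        ENNReal.ofReal c + ENNReal.ofReal (B.toFun θ) by rw [B.ofReal_toFun hθ]; ring,
      ← ENNReal.ofReal_add hc.le h0, ← ENNReal.ofReal_mul (by positivity),
      one_div_mul_cancel (by positivity), ENNReal.ofReal_one]

end BernsteinTriplet

/-! ### Caputo-Djrbashian derivatives of potential distribution functions. -/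

/-- The convolution with the tail of killing rate `a + c` splits: the part with rate `a` is the
integral in the Caputo-Djrbashian derivative, and the constant `c` contributes `c` times the
distribution function. Finiteness of `R` yields absolute convergence. -/
theorem hasCaputo_of_renewal (B : BernsteinTriplet) {c : ℝ} (hc : 0 < c) {w : ℝ → ℝ≥0∞}
    (hw : Measurable w) (hw0 : ∀ t ≤ 0, w t = 0) [IsFiniteMeasure (volume.withDensity w)]
    (hwb : B.b ≠ 0 → (∃ K, K ≠ ∞ ∧ ∀ t, w t ≤ K) ∧ ContinuousOn w (Ioi 0))
    {R : ℝ → ℝ≥0∞} (hR : ∀ t, R t ≠ ∞)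
    (h : ∀ t > 0, ENNReal.ofReal B.b * w t + convFun (volume.withDensity w)
      (tailFn (ENNReal.ofReal B.a + ENNReal.ofReal c) B.levy) t = R t) :
    HasCaputo B (fun t => (volume.withDensity w).real (Iic t))
      (fun t => (R t).toReal - c * (volume.withDensity w).real (Iic t)) := by
  have hint : ∫⁻ x, w x ≠ ∞ := by
    have := measure_ne_top (volume.withDensity w) univ
    rwa [withDensity_apply _ MeasurableSet.univ, Measure.restrict_univ] at this
  have hI : Integrable fun x => (w x).toReal :=
    integrable_toReal_of_lintegral_ne_top hw.aemeasurable hint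
  have hae : ∀ᵐ x, w x ≠ ∞ := (ae_lt_top hw hint).mono fun x hx => hx.ne
  have hIic : ∀ t, (volume.withDensity w) (Iic t) = (volume.withDensity w) (Iio t) := by
    intro t
    rw [← Iio_union_right]
    refine le_antisymm ((measure_union_le _ _).trans ?_) (measure_mono subset_union_left)
    rw [withDensity_absolutelyContinuous volume w (by simp : volume {t} = 0), add_zero]
  have hreal : ∀ t, 0 ≤ t → (volume.withDensity w).real (Iic t) = ∫ s in (0 : ℝ)..t, (w s).toReal := by
    intro t ht
    rw [intervalIntegral.integral_of_le ht, integral_toReal hw.aemeasurable.restrict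
      (ae_restrict_of_ae (hae.mono fun x hx => lt_top_iff_ne_top.2 hx)), Measure.real, withDensity_apply _ measurableSet_Iic,
      ← Iic_union_Ioc_eq_Iic ht, lintegral_union measurableSet_Ioc (Iic_disjoint_Ioc le_rfl),
      setLIntegral_eq_zero measurableSet_Iic (fun x hx => hw0 x hx), zero_add]
  refine ⟨fun t => (w t).toReal, fun T hT => hI.intervalIntegrable, fun t ht => ?_, fun hb => ?_,
    fun t ht => ?_⟩
  · beta_reduce
    rw [hreal t ht, hreal 0 le_rfl]; simp
  · obtain ⟨⟨K, hK, hle⟩, hcont⟩ := hwb hb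
    exact ENNReal.continuousOn_toReal.comp hcont fun x _ => ne_top_of_le_ne_top hK (hle x)
  have hsplit : convFun (volume.withDensity w)
      (tailFn (ENNReal.ofReal B.a + ENNReal.ofReal c) B.levy) t =
      (∫⁻ s in Ioc 0 t, w (t - s) * ENNReal.ofReal (B.tail s)) +
        ENNReal.ofReal c * (volume.withDensity w) (Iio t) := by
    have hT := measurable_tailFn (ENNReal.ofReal B.a) B.levy
    have e1 : ∀ y, tailFn (ENNReal.ofReal B.a + ENNReal.ofReal c) B.levy y =
        tailFn (ENNReal.ofReal B.a) B.levy y + (Ioi 0).indicator (fun _ => ENNReal.ofReal c) y := by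
      intro y
      by_cases hy : 0 < y
      · simp only [tailFn, if_pos hy, indicator_of_mem (mem_Ioi.2 hy)]; ring
      · simp [tailFn, if_neg hy, indicator_of_notMem (show y ∉ Ioi 0 from hy)]
    unfold convFun
    simp only [e1]
    rw [lintegral_add_left (by fun_prop)]
    congr 1
    · rw [lintegral_withDensity_eq_lintegral_mul _ hw (by fun_prop),
        ← lintegral_indicator measurableSet_Ioc,
        ← lintegral_sub_left_eq_self (fun y => (w * fun x => tailFn _ B.levy (t - x)) y) t]
      refine lintegral_congr fun s => ?_
      simp only [Pi.mul_apply, sub_sub_cancel]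
      by_cases hs : s ∈ Ioc 0 t
      · rw [indicator_of_mem hs, B.ofReal_tail hs.1, tailFn, if_pos hs.1]
      · rw [indicator_of_notMem hs]
        rcases le_or_gt s 0 with h' | h'
        · simp [tailFn, not_lt.2 h']
        · rw [hw0 _ (by by_contra h''; exact hs ⟨h', by linarith⟩), zero_mul]
    · rw [← lintegral_indicator_const measurableSet_Iio]
      refine lintegral_congr fun x => ?_
      simp [indicator]
  have hsum := h t ht
  rw [hsplit] at hsum
  have hfin : ∫⁻ s in Ioc 0 t, w (t - s) * ENNReal.ofReal (B.tail s) ≠ ∞ := by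
    intro h'
    rw [h'] at hsum
    exact hR t (by rw [← hsum]; simp)
  have hbw : ENNReal.ofReal B.b * w t ≠ ∞ := by
    intro h'
    rw [h'] at hsum
    exact hR t (by rw [← hsum]; simp)
  have hmeas : AEMeasurable (fun s => w (t - s) * ENNReal.ofReal (B.tail s))
      (volume.restrict (Ioc 0 t)) := by
    have h1 : Measurable fun s => w (t - s) * ENNReal.ofReal ((Ioi 0).indicator B.tail s) := by
      have := B.measurable_tail_indicator
      fun_prop
    refine ⟨_, h1, (ae_restrict_iff' measurableSet_Ioc).2 (Filter.Eventually.of_forall fun s hs => ?_)⟩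
    simp only
    rw [indicator_of_mem (mem_Ioi.2 hs.1)]
  have htoR : ∀ s, (w (t - s) * ENNReal.ofReal (B.tail s)).toReal = (w (t - s)).toReal * B.tail s := by
    intro s
    rw [ENNReal.toReal_mul, ENNReal.toReal_ofReal (B.tail_nonneg s)]
  refine ⟨?_, ?_⟩
  · rw [intervalIntegrable_iff_integrableOn_Ioc_of_le ht.le]
    have := integrable_toReal_of_lintegral_ne_top hmeas hfin
    simp only [htoR] at this
    exact this
  · rw [intervalIntegral.integral_of_le ht.le]
    simp only [← htoR]
    rw [integral_toReal hmeas (ae_lt_top' hmeas hfin), eq_sub_iff_add_eq, Measure.real, hIic, ← hsum,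
      ENNReal.toReal_add hbw (by finiteness), ENNReal.toReal_add hfin (by finiteness),
      ENNReal.toReal_mul, ENNReal.toReal_mul, ENNReal.toReal_ofReal B.b_nonneg,
      ENNReal.toReal_ofReal hc.le, add_assoc]

/-- The Caputo-Djrbashian derivatives of the distribution functions of the measures with Laplace
transforms `(c + B(θ))^{-(j+1)}`. -/
theorem hasCaputo_potentials {B : BernsteinTriplet} (hB : B.ConditionI) {c : ℝ} (hc : 0 < c)
    (U : ℕ → Measure ℝ) [IsFiniteMeasure (U 0)] (hU0 : ∀ j, U j (Iio 0) = 0)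
    (hU : ∀ j, ∀ θ > 0, lap (U j) θ = ENNReal.ofReal (1 / (c + B.toFun θ)) ^ (j + 1)) :
    U 0 (Iic 0) = 0 ∧
    HasCaputo B (fun t => (U 0).real (Iic t)) (fun t => 1 - c * (U 0).real (Iic t)) ∧
    ∀ j, HasCaputo B (fun t => (U (j + 1)).real (Iic t))
      (fun t => (U j).real (Iic t) - c * (U (j + 1)).real (Iic t)) := by
  have hpot := B.isPotential hc (hU0 0) (by simpa using hU 0)
  obtain ⟨u, hu, hu0, hUu, hren, hcont⟩ := hpot.exists_density hB.1
    fun ε hε => BernsteinTriplet.levy_restrict_Ioi_absolutelyContinuous hB hε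
  have hfin : IsFiniteMeasure (volume.withDensity u) := hUu ▸ inferInstance
  -- Uniqueness of Laplace transforms identifies every `U j` with a convolution power of the one
  -- density.
  have hpow : ∀ j, U j = volume.withDensity (densityPow u j) := by
    intro j
    refine lap_ext (hU0 j) ?_ (fun θ hθ => by rw [hU j θ hθ]; finiteness) fun θ hθ => ?_
    · rw [withDensity_apply _ measurableSet_Iio, setLIntegral_eq_zero measurableSet_Iio]
      intro x hx
      exact densityPow_of_nonpos hu0 hu j (mem_Iio.1 hx).le
    · rw [lap_densityPow hu, ← hUu, hU j θ hθ, hU 0 θ hθ, zero_add, pow_one]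
  have hbd : ∀ j, B.b ≠ 0 → (∃ K, K ≠ ∞ ∧ ∀ t, densityPow u j t ≤ K) ∧
      ContinuousOn (densityPow u j) (Ioi 0) := by
    intro j hb
    have hb' : ENNReal.ofReal B.b ≠ 0 := by
      simpa using lt_of_le_of_ne B.b_nonneg hb.symm
    obtain ⟨h1, h2⟩ := hcont hb'
    exact densityPow_bounded_continuousOn hu0 hu (by simpa using hb') h1 h2 j
  have hm := measurable_densityPow hu
  have hf := isFiniteMeasure_densityPow hu
  refine ⟨?_, ?_, fun j => ?_⟩
  · have h1 : U 0 {0} = 0 := by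
      rw [hUu]; exact withDensity_absolutelyContinuous volume u (by simp)
    rw [← Iio_union_right]
    exact measure_union_null (hU0 0) h1
  · have := hasCaputo_of_renewal B hc (hm 0) (fun t ht => densityPow_of_nonpos hu0 hu 0 ht) (hbd 0)
      (R := fun _ => 1) (fun _ => ENNReal.one_ne_top) (fun t ht => by
        have := hren t ht
        rw [hUu] at this
        exact this)
    rw [← hpow] at this
    simpa using this
  · have hfj := hf j
    have hfj' := hf (j + 1)
    have := hasCaputo_of_renewal B hc (hm (j + 1))
      (fun t ht => densityPow_of_nonpos hu0 hu (j + 1) ht) (hbd (j + 1))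
      (R := fun t => volume.withDensity (densityPow u j) (Iio t)) (fun _ => measure_ne_top _ _)
      (fun t _ => densityPow_renewal hu0 hu (measurable_tailFn _ _)
        (fun t ht => by simp [tailFn, not_lt.2 ht]) (fun t ht => by
          have := hren t ht
          rwa [hUu] at this) j t)
    rw [← hpow, ← hpow] at this
    refine this.congr (fun _ _ => rfl) fun t _ => ?_
    rw [Measure.real, Measure.real, ← Iio_union_right]
    congr 2
    have h1 : U j {t} = 0 := by
      rw [hpow]; exact withDensity_absolutelyContinuous volume _ (by simp)
    exact le_antisymm ((measure_union_le _ _).trans (by rw [h1, add_zero]))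
      (measure_mono subset_union_left)

theorem BernsteinTriplet.ConditionI.toFun_pos {B : BernsteinTriplet} (hB : B.ConditionI) {θ : ℝ}
    (hθ : 0 < θ) : 0 < B.toFun θ := by
  rw [B.toFun_eq hθ]
  have h1 : 0 < (jumpExponent B.levy θ).toReal := by
    refine ENNReal.toReal_pos (fun h => ?_) (B.jumpExponent_levy_ne_top hθ)
    rw [jumpExponent, lintegral_eq_zero_iff (by fun_prop)] at h
    have h2 : ∀ᵐ s ∂B.levy, False := by
      filter_upwards [h, B.levy_ae_pos] with s hs hs0
      have : Real.exp (-(θ * s)) < 1 := by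
        rw [Real.exp_lt_one_iff]; nlinarith [mul_pos hθ hs0]
      simp only [Pi.zero_apply, ENNReal.ofReal_eq_zero] at hs
      linarith
    have h3 := hB.1
    rw [ae_eq_bot.1 (Filter.eventually_false_iff_eq_bot.1 h2)] at h3
    simp at h3
  have := B.a_nonneg
  have := mul_nonneg B.b_nonneg hθ.le
  positivity

/-! ### The inverse of a subordinator. -/

theorem expNeg_nonneg (θ : ℝ) (x : ℝ≥0∞) : 0 ≤ expNeg θ x := by
  unfold expNeg; split_ifs <;> positivity

theorem expNeg_le_one {θ : ℝ} (hθ : 0 ≤ θ) (x : ℝ≥0∞) : expNeg θ x ≤ 1 := by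
  unfold expNeg
  split_ifs
  · exact zero_le_one
  · rw [Real.exp_le_one_iff]
    have := mul_nonneg hθ (ENNReal.toReal_nonneg (a := x))
    linarith

theorem measurable_expNeg (θ : ℝ) : Measurable (expNeg θ) :=
  Measurable.ite (measurableSet_singleton ∞) measurable_const (by fun_prop)

section Path

variable {h : ℝ≥0 → ℝ≥0∞} {t : ℝ≥0}

theorem le_of_lt_sInf_lt {s : ℝ≥0} (hs : s < sInf {s : ℝ≥0 | (t : ℝ≥0∞) < h s}) : h s ≤ t :=
  not_lt.1 fun h' => notMem_of_lt_csInf hs (OrderBot.bddBelow _) h'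

theorem lt_of_sInf_lt (hm : Monotone h) (hne : ∃ s, (t : ℝ≥0∞) < h s) {s : ℝ≥0}
    (hs : sInf {s : ℝ≥0 | (t : ℝ≥0∞) < h s} < s) : (t : ℝ≥0∞) < h s := by
  obtain ⟨r, hr, hrs⟩ := exists_lt_of_csInf_lt hne hs
  exact lt_of_lt_of_le hr (hm hrs.le)

/-- By monotonicity the infimum may be taken over a countable dense set of times, which makes it
measurable in the path. -/
theorem sInf_lt_eq_toNNReal_iInf (hm : Monotone h) (hne : ∃ s, (t : ℝ≥0∞) < h s) :
    sInf {s : ℝ≥0 | (t : ℝ≥0∞) < h s} = (⨅ n : ℕ, if (t : ℝ≥0∞) < h (TopologicalSpace.denseSeq ℝ≥0 n)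
      then (TopologicalSpace.denseSeq ℝ≥0 n : ℝ≥0∞) else ∞).toNNReal := by
  set d := TopologicalSpace.denseSeq ℝ≥0
  set y := sInf {s : ℝ≥0 | (t : ℝ≥0∞) < h s} with hy
  have h1 : (y : ℝ≥0∞) = ⨅ n : ℕ, if (t : ℝ≥0∞) < h (d n) then (d n : ℝ≥0∞) else ∞ := by
    refine le_antisymm (le_iInf fun n => ?_) ?_
    · split_ifs with hn
      · exact ENNReal.coe_le_coe.2 (csInf_le (OrderBot.bddBelow _) hn)
      · exact le_top
    · refine le_of_forall_gt_imp_ge_of_dense fun a ha => ?_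
      obtain ⟨b, hyb, hba⟩ := ENNReal.lt_iff_exists_nnreal_btwn.1 ha
      have hyb' : y < b := ENNReal.coe_lt_coe.1 hyb
      obtain ⟨n, hz⟩ := (TopologicalSpace.denseRange_denseSeq ℝ≥0).exists_mem_open isOpen_Ioo
        (nonempty_Ioo.2 hyb')
      refine (iInf_le _ n).trans ?_
      rw [if_pos (lt_of_sInf_lt hm hne hz.1)]
      exact ((ENNReal.coe_lt_coe.2 hz.2).trans hba).le
  rw [← h1, ENNReal.toNNReal_coe]

end Path

namespace IsSubordinator

variable {Ω : Type*} [MeasurableSpace Ω] {P : Measure Ω} [IsProbabilityMeasure P]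
  {B : BernsteinTriplet} {H : ℝ≥0 → Ω → ℝ≥0∞}

theorem lintegral_expNeg (hH : IsSubordinator P B H) (t : ℝ≥0) {θ : ℝ} (hθ : 0 < θ) :
    ∫⁻ ω, ENNReal.ofReal (expNeg θ (H t ω)) ∂P = ENNReal.ofReal (Real.exp (-(t * B.toFun θ))) := by
  rw [← hH.laplace t θ hθ, ofReal_integral_eq_lintegral_ofReal]
  · refine Integrable.of_bound (C := 1)
      ((measurable_expNeg θ).comp (hH.measurable t)).aestronglyMeasurable
      (Filter.Eventually.of_forall fun ω => ?_)
    rw [Real.norm_of_nonneg (expNeg_nonneg _ _)]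
    exact expNeg_le_one hθ.le _
  · exact Filter.Eventually.of_forall fun ω => expNeg_nonneg _ _

/-- Markov's inequality gives `P(H_n ≤ t) ≤ e^t e^{-n B(1)}`. Without this the inverse could be the
infimum of the empty set, which is `0` in `ℝ≥0`. -/
theorem exists_gt (hH : IsSubordinator P B H) (hB : B.ConditionI) (t : ℝ≥0) :
    ∀ᵐ ω ∂P, ∃ s, (t : ℝ≥0∞) < H s ω := by
  rw [ae_iff]
  have h1 : ∀ n : ℕ, P {ω | ¬ ∃ s, (t : ℝ≥0∞) < H s ω} ≤
      ENNReal.ofReal (Real.exp t) * ENNReal.ofReal (Real.exp (-(n * B.toFun 1))) := by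
    intro n
    calc P {ω | ¬ ∃ s, (t : ℝ≥0∞) < H s ω} ≤ P {ω | H n ω ≤ t} :=
          measure_mono fun ω hω => not_lt.1 fun h' => hω ⟨_, h'⟩
      _ = ∫⁻ ω, {ω | H n ω ≤ t}.indicator 1 ω ∂P :=
          (lintegral_indicator_one (measurableSet_le (hH.measurable n) measurable_const)).symm
      _ ≤ ∫⁻ ω, ENNReal.ofReal (Real.exp t) * ENNReal.ofReal (expNeg 1 (H n ω)) ∂P := by
          refine lintegral_mono fun ω => ?_
          by_cases hω : H n ω ≤ t
          · rw [indicator_of_mem (by exact hω)]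
            have hne : H n ω ≠ ∞ := ne_top_of_le_ne_top ENNReal.coe_ne_top hω
            rw [← ENNReal.ofReal_mul (Real.exp_nonneg _), expNeg, if_neg hne, ← Real.exp_add]
            simp only [Pi.one_apply, ENNReal.one_le_ofReal, Real.one_le_exp_iff]
            have := ENNReal.toReal_mono ENNReal.coe_ne_top hω
            rw [ENNReal.coe_toReal] at this
            linarith
          · rw [indicator_of_notMem (by exact hω)]; exact zero_le
      _ = _ := by
          have hm : Measurable fun ω => ENNReal.ofReal (expNeg 1 (H n ω)) :=
            ((measurable_expNeg 1).comp (hH.measurable n)).ennreal_ofReal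
          rw [lintegral_const_mul _ hm, hH.lintegral_expNeg n one_pos]
          simp
  have h2 : Filter.Tendsto (fun n : ℕ => ENNReal.ofReal (Real.exp t) *
      ENNReal.ofReal (Real.exp (-(n * B.toFun 1)))) Filter.atTop (nhds 0) := by
    rw [← mul_zero (ENNReal.ofReal (Real.exp t)), ← ENNReal.ofReal_zero]
    refine ENNReal.Tendsto.const_mul (ENNReal.tendsto_ofReal ?_) (Or.inr ENNReal.ofReal_ne_top)
    refine Real.tendsto_exp_neg_atTop_nhds_zero.comp ?_
    exact tendsto_natCast_atTop_atTop.atTop_mul_const (hB.toFun_pos one_pos)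
  exact le_antisymm (ge_of_tendsto' h2 h1) zero_le

theorem aemeasurable_inverse (hH : IsSubordinator P B H) (hB : B.ConditionI) (t : ℝ≥0) :
    AEMeasurable (inverseProcess H t) P := by
  refine ⟨fun ω => (⨅ n : ℕ, if (t : ℝ≥0∞) < H (TopologicalSpace.denseSeq ℝ≥0 n) ω
      then (TopologicalSpace.denseSeq ℝ≥0 n : ℝ≥0∞) else ∞).toNNReal, ?_, ?_⟩
  · refine ENNReal.measurable_toNNReal.comp (Measurable.iInf fun n => ?_)
    exact Measurable.ite (measurableSet_lt measurable_const (hH.measurable _)) measurable_const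
      measurable_const
  · filter_upwards [hH.mono, hH.exists_gt hB t] with ω h1 h2
    exact sInf_lt_eq_toNNReal_iInf h1 h2

/-- Almost surely `H_s ≤ t` lies between `Y_t > s` and `Y_t ≥ s`. The probabilities agree unless `s`
is an atom of the law of `Y_t`, and there are only countably many atoms. -/
theorem measure_lt_inverse (hH : IsSubordinator P B H) (hB : B.ConditionI) (t : ℝ≥0) :
    ∀ᵐ s ∂(volume.restrict (Ioi (0 : ℝ))),
      P {ω | s < (inverseProcess H t ω : ℝ)} = P {ω | H s.toNNReal ω ≤ t} := by
  have hY := hH.aemeasurable_inverse hB t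
  have hcount : {s : ℝ | 0 < P {ω | (inverseProcess H t ω : ℝ) = s}}.Countable := by
    have hY' : AEMeasurable (fun ω => (inverseProcess H t ω : ℝ)) P := hY.coe_nnreal_real
    exact Measure.countable_meas_level_set_pos₀ hY'.nullMeasurable
  have h1 : ∀ᵐ s : ℝ, s ∉ {s : ℝ | 0 < P {ω | (inverseProcess H t ω : ℝ) = s}} := by
    exact measure_eq_zero_iff_ae_notMem.1 (hcount.measure_zero volume)
  refine (ae_restrict_iff' measurableSet_Ioi).2 ?_
  filter_upwards [h1] with s hs hs0
  have hs1 : P {ω | (inverseProcess H t ω : ℝ) = s} = 0 := by simpa using hs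
  have hss : ((s.toNNReal : ℝ≥0) : ℝ) = s := Real.coe_toNNReal s (le_of_lt hs0)
  refine measure_congr ?_
  filter_upwards [hH.mono, hH.exists_gt hB t, measure_eq_zero_iff_ae_notMem.1 hs1] with ω hm hne hω
  refine propext ⟨fun h => ?_, fun h => ?_⟩
  · refine le_of_lt_sInf_lt (h := fun s => H s ω) ?_
    rw [← NNReal.coe_lt_coe, hss]; exact h
  · by_contra h'
    have h2 : (inverseProcess H t ω : ℝ) < s := lt_of_le_of_ne (not_lt.1 h') hω
    rw [← hss, NNReal.coe_lt_coe] at h2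
    exact absurd h (not_le.2 (lt_of_sInf_lt hm hne h2))

/-- The laws form a kernel because `P(H_s ≤ x)` is antitone in `s`. -/
theorem measurable_law (hH : IsSubordinator P B H) :
    Measurable fun s : ℝ => P.map (H s.toNNReal) := by
  have : ∀ s : ℝ, IsProbabilityMeasure (P.map (H s.toNNReal)) := fun s =>
    Measure.isProbabilityMeasure_map (hH.measurable _).aemeasurable
  refine Measurable.measure_of_isPiSystem_of_isProbabilityMeasure
    (borel_eq_generateFrom_Iic ℝ≥0∞ ▸ BorelSpace.measurable_eq) isPiSystem_Iic ?_
  rintro _ ⟨x, rfl⟩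
  refine Antitone.measurable fun s r hsr => ?_
  rw [Measure.map_apply (hH.measurable _) measurableSet_Iic,
    Measure.map_apply (hH.measurable _) measurableSet_Iic]
  refine measure_mono_ae ?_
  filter_upwards [hH.mono] with ω hω h
  exact (hω (Real.toNNReal_mono hsr)).trans h

end IsSubordinator

/-! ### Gamma-weighted potentials and expectations of the inverse process. -/

/-- The function `s ↦ s^j / j! · e^{-c s}`. -/
def gammaWeight (c : ℝ) (j : ℕ) (s : ℝ) : ℝ := s ^ j / j ! * Real.exp (-(c * s))

theorem continuous_gammaWeight (c : ℝ) (j : ℕ) : Continuous (gammaWeight c j) := by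
  unfold gammaWeight; fun_prop

theorem gammaWeight_nonneg (c : ℝ) (j : ℕ) {s : ℝ} (hs : 0 ≤ s) : 0 ≤ gammaWeight c j s := by
  unfold gammaWeight; positivity

theorem gammaWeight_le {c : ℝ} (hc : 0 < c) (j : ℕ) {s : ℝ} (hs : 0 ≤ s) :
    gammaWeight c j s ≤ 1 / c ^ j := by
  have h1 := Real.pow_div_factorial_le_exp (c * s) (by positivity) j
  unfold gammaWeight
  rw [Real.exp_neg, ← div_eq_mul_inv, div_le_iff₀ (Real.exp_pos _), one_div, inv_mul_eq_div,
    le_div_iff₀ (by positivity)]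
  calc s ^ j / j ! * c ^ j = (c * s) ^ j / j ! := by rw [mul_pow]; ring
    _ ≤ _ := h1

theorem lintegral_gammaWeight {r : ℝ} (hr : 0 < r) (j : ℕ) :
    ∫⁻ s in Ioi 0, ENNReal.ofReal (gammaWeight r j s) = ENNReal.ofReal (1 / r) ^ (j + 1) := by
  have h1 := lintegral_gammaPDF_eq_one (a := (j : ℝ) + 1) (by positivity) hr
  have h2 : ∀ s, gammaPDF ((j : ℝ) + 1) r s = ENNReal.ofReal (r ^ (j + 1)) *
      (Ici 0).indicator (fun s => ENNReal.ofReal (gammaWeight r j s)) s := by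
    intro s
    by_cases hs : 0 ≤ s
    · rw [gammaPDF_of_nonneg hs, indicator_of_mem (mem_Ici.2 hs), ← ENNReal.ofReal_mul (by positivity)]
      congr 1
      rw [Real.Gamma_nat_eq_factorial, add_sub_cancel_right, Real.rpow_natCast,
        ← Nat.cast_add_one, Real.rpow_natCast, gammaWeight]
      ring
    · rw [gammaPDF_of_neg (not_le.1 hs), indicator_of_notMem (by simpa using hs), mul_zero]
  simp only [h2] at h1
  rw [lintegral_const_mul _ (((continuous_gammaWeight r j).measurable.ennreal_ofReal).indicator
    measurableSet_Ici), lintegral_indicator measurableSet_Ici,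
    setLIntegral_congr Ioi_ae_eq_Ici.symm] at h1
  have h3 : ENNReal.ofReal (r ^ (j + 1)) * ENNReal.ofReal (1 / r) ^ (j + 1) = 1 := by
    rw [← ENNReal.ofReal_pow (by positivity), ← ENNReal.ofReal_mul (by positivity), ← mul_pow,
      mul_one_div_cancel hr.ne', one_pow, ENNReal.ofReal_one]
  rw [← h3] at h1
  exact (ENNReal.mul_right_inj (by simpa using pow_pos hr (j + 1)) ENNReal.ofReal_ne_top).1 h1

/-- The measure `∫ s^j / j! · e^{-c s} P(H_s ∈ ·) ds` on `[0, ∞)`. -/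
def potentialMeasure {Ω : Type*} [MeasurableSpace Ω] (P : Measure Ω) (H : ℝ≥0 → Ω → ℝ≥0∞) (c : ℝ)
    (j : ℕ) : Measure ℝ :=
  ((((volume.restrict (Ioi 0)).withDensity fun s => ENNReal.ofReal (gammaWeight c j s)).bind
    fun s : ℝ => P.map (H s.toNNReal)).restrict {∞}ᶜ).map ENNReal.toReal

theorem potentialMeasure_Iio {Ω : Type*} [MeasurableSpace Ω] (P : Measure Ω)
    (H : ℝ≥0 → Ω → ℝ≥0∞) (c : ℝ) (j : ℕ) : potentialMeasure P H c j (Iio 0) = 0 := by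
  rw [potentialMeasure, Measure.map_apply ENNReal.measurable_toReal measurableSet_Iio]
  have : ENNReal.toReal ⁻¹' Iio 0 = ∅ := by
    ext x; simp
  rw [this, measure_empty]

namespace IsSubordinator

variable {Ω : Type*} [MeasurableSpace Ω] {P : Measure Ω} [IsProbabilityMeasure P]
  {B : BernsteinTriplet} {H : ℝ≥0 → Ω → ℝ≥0∞}

/-- The indicator removes the killed paths; otherwise `toReal` would send `∞` to `0` and create a
spurious atom there. -/
theorem lintegral_potentialMeasure (hH : IsSubordinator P B H) (c : ℝ) (j : ℕ) {F : ℝ → ℝ≥0∞}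
    (hF : Measurable F) : ∫⁻ x, F x ∂(potentialMeasure P H c j) =
      ∫⁻ s in Ioi 0, ENNReal.ofReal (gammaWeight c j s) *
        ∫⁻ ω, ({∞}ᶜ : Set ℝ≥0∞).indicator (fun x => F x.toReal) (H s.toNNReal ω) ∂P := by
  have hms : MeasurableSet ({∞}ᶜ : Set ℝ≥0∞) := (measurableSet_singleton ∞).compl
  have hg : Measurable (({∞}ᶜ : Set ℝ≥0∞).indicator fun x => F x.toReal) :=
    (hF.comp ENNReal.measurable_toReal).indicator hms
  have hw := (continuous_gammaWeight c j).measurable.ennreal_ofReal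
  have hcomp : Measurable fun s : ℝ =>
      ∫⁻ x, ({∞}ᶜ : Set ℝ≥0∞).indicator (fun x => F x.toReal) x ∂(P.map (H s.toNNReal)) :=
    (Measure.measurable_lintegral hg).comp hH.measurable_law
  rw [potentialMeasure, lintegral_map hF ENNReal.measurable_toReal, ← lintegral_indicator hms,
    Measure.lintegral_bind hH.measurable_law.aemeasurable hg.aemeasurable,
    lintegral_withDensity_eq_lintegral_mul _ hw hcomp]
  refine lintegral_congr fun s => ?_
  simp only [Pi.mul_apply]
  rw [lintegral_map hg (hH.measurable _)]

/-- Averaging `e^{-θ H_s}` changes the rate of the gamma weight from `c` to `c + B(θ)`; then a gamma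
integral remains. -/
theorem lap_potentialMeasure (hH : IsSubordinator P B H) {c : ℝ} (hc : 0 < c) (j : ℕ) {θ : ℝ}
    (hθ : 0 < θ) : lap (potentialMeasure P H c j) θ =
      ENNReal.ofReal (1 / (c + B.toFun θ)) ^ (j + 1) := by
  have h0 := B.toFun_nonneg hθ
  rw [lap, hH.lintegral_potentialMeasure c j (measurable_ofReal_exp_neg_mul θ),
    ← lintegral_gammaWeight (add_pos_of_pos_of_nonneg hc h0) j]
  refine setLIntegral_congr_fun measurableSet_Ioi fun s hs => ?_
  have h1 : ∀ x : ℝ≥0∞, ({∞}ᶜ : Set ℝ≥0∞).indicator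
      (fun x => ENNReal.ofReal (Real.exp (-(θ * x.toReal)))) x = ENNReal.ofReal (expNeg θ x) := by
    intro x
    by_cases hx : x = ∞ <;> simp [expNeg, hx]
  simp only [h1]
  rw [hH.lintegral_expNeg _ hθ, ← ENNReal.ofReal_mul (gammaWeight_nonneg c j (le_of_lt hs)),
    Real.coe_toNNReal s (le_of_lt hs), gammaWeight, gammaWeight, mul_assoc, ← Real.exp_add]
  congr 3; ring

theorem isFiniteMeasure_potentialMeasure (hH : IsSubordinator P B H) {c : ℝ} (hc : 0 < c) (j : ℕ) :
    IsFiniteMeasure (potentialMeasure P H c j) := by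
  refine ⟨?_⟩
  rw [← lintegral_one, hH.lintegral_potentialMeasure c j measurable_const]
  refine lt_of_le_of_lt (lintegral_mono fun s => mul_le_of_le_one_right zero_le ?_)
    (b := ∫⁻ s in Ioi 0, ENNReal.ofReal (gammaWeight c j s)) ?_
  · refine (lintegral_mono (g := fun _ => 1) fun ω => ?_).trans (by simp)
    exact indicator_le' (g := fun _ => 1) (fun _ _ => le_rfl) (fun _ _ => zero_le) (H s.toNNReal ω)
  · rw [lintegral_gammaWeight hc]; finiteness

/-- The layer-cake formula turns the expected primitive at `Y_t` into an integral of `P(Y_t > s)`,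
which `measure_lt_inverse` replaces by `P(H_s ≤ t)`. -/
theorem potentialMeasure_Iic (hH : IsSubordinator P B H) (hB : B.ConditionI) (c : ℝ) (j : ℕ)
    (t : ℝ≥0) : potentialMeasure P H c j (Iic t) =
      ∫⁻ ω, ENNReal.ofReal (∫ s in (0 : ℝ)..(inverseProcess H t ω), gammaWeight c j s) ∂P := by
  rw [lintegral_comp_eq_lintegral_meas_lt_mul P (f := fun ω => (inverseProcess H t ω : ℝ))
    (Filter.Eventually.of_forall fun ω => NNReal.coe_nonneg _)
    (hH.aemeasurable_inverse hB t).coe_nnreal_real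
    (fun s _ => (continuous_gammaWeight c j).intervalIntegrable _ _)
    ((ae_restrict_iff' measurableSet_Ioi).2 (Filter.Eventually.of_forall fun s hs =>
      gammaWeight_nonneg c j (le_of_lt hs))),
    ← lintegral_indicator_one measurableSet_Iic,
    hH.lintegral_potentialMeasure c j (measurable_one.indicator measurableSet_Iic)]
  refine lintegral_congr_ae ?_
  filter_upwards [hH.measure_lt_inverse hB t] with s hs
  rw [hs, mul_comm]
  congr 1
  rw [← lintegral_indicator_one (measurableSet_le (hH.measurable _) measurable_const)]
  refine lintegral_congr fun ω => ?_
  by_cases h : H s.toNNReal ω = ∞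
  · simp [h]
  · have : (H s.toNNReal ω ≤ t) ↔ (H s.toNNReal ω).toReal ≤ t := by
      rw [← ENNReal.coe_toReal, ENNReal.toReal_le_toReal h ENNReal.coe_ne_top]
    simp [indicator, h, this]

end IsSubordinator

theorem integral_gammaWeight_nonneg (c : ℝ) (j : ℕ) (y : ℝ≥0) :
    0 ≤ ∫ s in (0 : ℝ)..y, gammaWeight c j s :=
  intervalIntegral.integral_nonneg (NNReal.coe_nonneg _) fun _ hs => gammaWeight_nonneg c j hs.1

theorem hasDerivAt_gammaWeight_zero (c s : ℝ) :
    HasDerivAt (gammaWeight c 0) (-(c * gammaWeight c 0 s)) s := by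
  have h : HasDerivAt (fun s : ℝ => Real.exp (-(c * s))) (Real.exp (-(c * s)) * -(c * 1)) s :=
    (((hasDerivAt_id s).const_mul c).fun_neg).exp
  have h2 : gammaWeight c 0 = fun s : ℝ => Real.exp (-(c * s)) := by
    ext s; simp [gammaWeight]
  rw [h2]
  convert h using 1; ring

theorem hasDerivAt_gammaWeight_succ (c : ℝ) (j : ℕ) (s : ℝ) :
    HasDerivAt (gammaWeight c (j + 1)) (gammaWeight c j s - c * gammaWeight c (j + 1) s) s := by
  have h : HasDerivAt (fun s : ℝ => Real.exp (-(c * s))) (Real.exp (-(c * s)) * -(c * 1)) s :=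
    (((hasDerivAt_id s).const_mul c).fun_neg).exp
  have h1 := ((hasDerivAt_pow (j + 1) s).div_const ((j + 1)! : ℝ)).fun_mul h
  refine HasDerivAt.congr_deriv (f := gammaWeight c (j + 1)) h1 ?_
  simp only [gammaWeight]
  rw [Nat.factorial_succ, Nat.cast_mul, add_tsub_cancel_right]
  have : ((j : ℝ) + 1) ≠ 0 := by positivity
  push_cast
  field_simp
  ring

theorem gammaWeight_zero_eq (c y : ℝ) :
    gammaWeight c 0 y = 1 - c * ∫ s in (0 : ℝ)..y, gammaWeight c 0 s := by
  have h := intervalIntegral.integral_eq_sub_of_hasDerivAt (a := 0) (b := y)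
    (fun x _ => hasDerivAt_gammaWeight_zero c x)
    (by have := continuous_gammaWeight c 0; exact Continuous.intervalIntegrable (by fun_prop) _ _)
  rw [intervalIntegral.integral_neg, intervalIntegral.integral_const_mul] at h
  have h0 : gammaWeight c 0 0 = 1 := by simp [gammaWeight]
  linarith

/-- This expresses the weight at `Y_t` by primitives, whose expectations are potential masses, so
the Caputo-Djrbashian derivative of its expectation can be read off from that of the potentials. -/
theorem gammaWeight_succ_eq (c y : ℝ) (j : ℕ) :
    gammaWeight c (j + 1) y = (∫ s in (0 : ℝ)..y, gammaWeight c j s) -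
      c * ∫ s in (0 : ℝ)..y, gammaWeight c (j + 1) s := by
  have hc := continuous_gammaWeight c
  have h := intervalIntegral.integral_eq_sub_of_hasDerivAt (a := 0) (b := y)
    (fun x _ => hasDerivAt_gammaWeight_succ c j x)
    (Continuous.intervalIntegrable ((hc j).sub (continuous_const.mul (hc (j + 1)))) _ _)
  have hi : IntervalIntegrable (fun s => c * gammaWeight c (j + 1) s) volume 0 y :=
    ((hc (j + 1)).intervalIntegrable _ _).const_mul c
  rw [intervalIntegral.integral_sub ((hc j).intervalIntegrable _ _) hi,
    intervalIntegral.integral_const_mul] at h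
  have h0 : gammaWeight c (j + 1) 0 = 0 := by simp [gammaWeight]
  linarith

namespace IsSubordinator

variable {Ω : Type*} [MeasurableSpace Ω] {P : Measure Ω} [IsProbabilityMeasure P]
  {B : BernsteinTriplet} {H : ℝ≥0 → Ω → ℝ≥0∞}

theorem integrable_gammaWeight (hH : IsSubordinator P B H) (hB : B.ConditionI) {c : ℝ} (hc : 0 < c)
    (j : ℕ) (t : ℝ≥0) : Integrable (fun ω => gammaWeight c j (inverseProcess H t ω)) P := by
  refine Integrable.of_bound (C := 1 / c ^ j) ?_ (Filter.Eventually.of_forall fun ω => ?_)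
  · exact ((continuous_gammaWeight c j).measurable.comp_aemeasurable
      (hH.aemeasurable_inverse hB t).coe_nnreal_real).aestronglyMeasurable
  · rw [Real.norm_of_nonneg (gammaWeight_nonneg c j (NNReal.coe_nonneg _))]
    exact gammaWeight_le hc j (NNReal.coe_nonneg _)

theorem aestronglyMeasurable_integral_gammaWeight (hH : IsSubordinator P B H) (hB : B.ConditionI)
    (c : ℝ) (j : ℕ) (t : ℝ≥0) : AEStronglyMeasurable
      (fun ω => ∫ s in (0 : ℝ)..(inverseProcess H t ω), gammaWeight c j s) P := by
  have h : Continuous fun y : ℝ => ∫ s in (0 : ℝ)..y, gammaWeight c j s :=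
    intervalIntegral.continuous_primitive
      (fun a b => (continuous_gammaWeight c j).intervalIntegrable a b) 0
  exact (h.measurable.comp_aemeasurable
    (hH.aemeasurable_inverse hB t).coe_nnreal_real).aestronglyMeasurable

theorem potentialMeasure_real_Iic (hH : IsSubordinator P B H) (hB : B.ConditionI) (c : ℝ) (j : ℕ)
    (t : ℝ≥0) : (potentialMeasure P H c j).real (Iic t) =
      ∫ ω, (∫ s in (0 : ℝ)..(inverseProcess H t ω), gammaWeight c j s) ∂P := by
  rw [Measure.real, hH.potentialMeasure_Iic hB, integral_eq_lintegral_of_nonneg_ae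
    (Filter.Eventually.of_forall fun ω => integral_gammaWeight_nonneg c j _)
    (hH.aestronglyMeasurable_integral_gammaWeight hB c j t)]

theorem integrable_integral_gammaWeight (hH : IsSubordinator P B H) (hB : B.ConditionI) {c : ℝ}
    (hc : 0 < c) (j : ℕ) (t : ℝ≥0) :
    Integrable (fun ω => ∫ s in (0 : ℝ)..(inverseProcess H t ω), gammaWeight c j s) P := by
  refine ⟨hH.aestronglyMeasurable_integral_gammaWeight hB c j t, ?_⟩
  rw [hasFiniteIntegral_iff_ofReal
    (Filter.Eventually.of_forall fun ω => integral_gammaWeight_nonneg c j _),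
    ← hH.potentialMeasure_Iic hB]
  have := hH.isFiniteMeasure_potentialMeasure hc j
  exact measure_lt_top _ _

theorem integral_gammaWeight_zero (hH : IsSubordinator P B H) (hB : B.ConditionI) {c : ℝ}
    (hc : 0 < c) (t : ℝ≥0) : ∫ ω, gammaWeight c 0 (inverseProcess H t ω) ∂P =
      1 - c * (potentialMeasure P H c 0).real (Iic t) := by
  simp_rw [gammaWeight_zero_eq c (inverseProcess H t _)]
  rw [integral_sub (integrable_const 1) ((hH.integrable_integral_gammaWeight hB hc 0 t).const_mul c),
    integral_const_mul, hH.potentialMeasure_real_Iic hB]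
  simp

theorem integral_gammaWeight_succ (hH : IsSubordinator P B H) (hB : B.ConditionI) {c : ℝ}
    (hc : 0 < c) (j : ℕ) (t : ℝ≥0) : ∫ ω, gammaWeight c (j + 1) (inverseProcess H t ω) ∂P =
      (potentialMeasure P H c j).real (Iic t) -
        c * (potentialMeasure P H c (j + 1)).real (Iic t) := by
  simp_rw [gammaWeight_succ_eq c (inverseProcess H t _) j]
  rw [integral_sub (hH.integrable_integral_gammaWeight hB hc j t)
    ((hH.integrable_integral_gammaWeight hB hc (j + 1) t).const_mul c), integral_const_mul,
    hH.potentialMeasure_real_Iic hB, hH.potentialMeasure_real_Iic hB]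

theorem hasCaputo_potentialMeasure (hH : IsSubordinator P B H) (hB : B.ConditionI) {c : ℝ}
    (hc : 0 < c) (j : ℕ) : HasCaputo B (fun t => (potentialMeasure P H c j).real (Iic t))
      (fun t => ∫ ω, gammaWeight c j (inverseProcess H t.toNNReal ω) ∂P) := by
  have := hH.isFiniteMeasure_potentialMeasure hc
  obtain ⟨-, h0, h1⟩ := hasCaputo_potentials hB hc (potentialMeasure P H c)
    (potentialMeasure_Iio P H c) fun j θ hθ => hH.lap_potentialMeasure hc j hθ
  cases j with
  | zero =>
    refine h0.congr (fun _ _ => rfl) fun t ht => ?_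
    rw [hH.integral_gammaWeight_zero hB hc, Real.coe_toNNReal t ht.le]
  | succ j =>
    refine (h1 j).congr (fun _ _ => rfl) fun t ht => ?_
    rw [hH.integral_gammaWeight_succ hB hc, Real.coe_toNNReal t ht.le]

theorem hasCaputo_gammaWeight_zero (hH : IsSubordinator P B H) (hB : B.ConditionI) {c : ℝ}
    (hc : 0 < c) :
    HasCaputo B (fun t => ∫ ω, gammaWeight c 0 (inverseProcess H t.toNNReal ω) ∂P)
      (fun t => -(c * ∫ ω, gammaWeight c 0 (inverseProcess H t.toNNReal ω) ∂P)) := by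
  refine ((HasCaputo.const B 1).add ((hH.hasCaputo_potentialMeasure hB hc 0).const_mul (-c))).congr
    (fun t ht => ?_) fun t ht => ?_
  · rw [hH.integral_gammaWeight_zero hB hc, Real.coe_toNNReal t ht]; ring
  · ring

theorem hasCaputo_gammaWeight_succ (hH : IsSubordinator P B H) (hB : B.ConditionI) {c : ℝ}
    (hc : 0 < c) (j : ℕ) :
    HasCaputo B (fun t => ∫ ω, gammaWeight c (j + 1) (inverseProcess H t.toNNReal ω) ∂P)
      (fun t => (∫ ω, gammaWeight c j (inverseProcess H t.toNNReal ω) ∂P) -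
        c * ∫ ω, gammaWeight c (j + 1) (inverseProcess H t.toNNReal ω) ∂P) := by
  refine ((hH.hasCaputo_potentialMeasure hB hc j).add
    ((hH.hasCaputo_potentialMeasure hB hc (j + 1)).const_mul (-c))).congr
    (fun t ht => ?_) fun t ht => ?_
  · rw [hH.integral_gammaWeight_succ hB hc, Real.coe_toNNReal t ht]; ring
  · ring

/-- The expectation of `1 - e^{-Y_0}` is the potential mass of `{0}`, which vanishes because the
potential has a density. -/
theorem inverse_zero (hH : IsSubordinator P B H) (hB : B.ConditionI) :
    ∀ᵐ ω ∂P, inverseProcess H 0 ω = 0 := by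
  have := hH.isFiniteMeasure_potentialMeasure one_pos
  obtain ⟨h0, -, -⟩ := hasCaputo_potentials hB one_pos (potentialMeasure P H 1)
    (potentialMeasure_Iio P H 1) fun j θ hθ => hH.lap_potentialMeasure one_pos j hθ
  have h1 := hH.potentialMeasure_real_Iic hB 1 0 0
  rw [NNReal.coe_zero, Measure.real, h0, ENNReal.toReal_zero, eq_comm,
    integral_eq_zero_iff_of_nonneg (fun ω => integral_gammaWeight_nonneg 1 0 _)
    (hH.integrable_integral_gammaWeight hB one_pos 0 0)] at h1
  filter_upwards [h1] with ω hω
  have h2 := gammaWeight_zero_eq 1 (inverseProcess H 0 ω)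
  rw [hω] at h2
  simpa [gammaWeight] using h2

open Polynomial in
/-- The Caputo-Djrbashian derivative of `E g(Y_t)` is `E g'(Y_t)`, for `g(s) = q(s) e^{-c s}` with
a polynomial `q`. -/
theorem hasCaputo_polynomial (hH : IsSubordinator P B H) (hB : B.ConditionI) {c : ℝ}
    (hc : 0 < c) (q : ℝ[X]) :
    (∀ t : ℝ≥0, Integrable (fun ω => q.eval (inverseProcess H t ω : ℝ) *
      Real.exp (-(c * inverseProcess H t ω))) P) ∧
    HasCaputo B (fun t => ∫ ω, q.eval (inverseProcess H t.toNNReal ω : ℝ) *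
        Real.exp (-(c * inverseProcess H t.toNNReal ω)) ∂P)
      (fun t => ∫ ω, (derivative q - C c * q).eval (inverseProcess H t.toNNReal ω : ℝ) *
        Real.exp (-(c * inverseProcess H t.toNNReal ω)) ∂P) := by
  have hint : ∀ (q : ℝ[X]) (t : ℝ≥0), Integrable (fun ω => q.eval (inverseProcess H t ω : ℝ) *
      Real.exp (-(c * inverseProcess H t ω))) P := by
    intro q t
    induction q using Polynomial.induction_on' with
    | add p q hp hq => simp only [eval_add, add_mul]; exact hp.add hq
    | monomial n a =>
      -- A monomial times the exponential is `n!` times a gamma weight, so linearity reduces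
      -- everything to gamma weights.
      refine ((hH.integrable_gammaWeight hB hc n t).const_mul (a * n !)).congr
        (Filter.Eventually.of_forall fun ω => ?_)
      have : ((n ! : ℕ) : ℝ) ≠ 0 := by positivity
      simp only [eval_monomial, gammaWeight]
      field_simp
  refine ⟨hint q, ?_⟩
  induction q using Polynomial.induction_on' with
  | add p q hp hq =>
    refine (hp.add hq).congr (fun t _ => ?_) fun t _ => ?_
    · rw [← integral_add (hint _ _) (hint _ _)]
      simp only [eval_add, add_mul]
    · rw [← integral_add (hint _ _) (hint _ _)]
      refine integral_congr_ae (Filter.Eventually.of_forall fun ω => ?_)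
      simp only [derivative_add, mul_add, eval_add, eval_sub]
      ring
  | monomial n a =>
    have hn : ((n ! : ℕ) : ℝ) ≠ 0 := by positivity
    cases n with
    | zero =>
      refine ((hH.hasCaputo_gammaWeight_zero hB hc).const_mul a).congr (fun t _ => ?_)
        fun t _ => ?_
      · rw [← integral_const_mul]
        simp [gammaWeight]
      · rw [← integral_const_mul, ← integral_neg, ← integral_const_mul]
        simp [gammaWeight]
        congr 1; ext ω; ring
    | succ n =>
      refine ((hH.hasCaputo_gammaWeight_succ hB hc n).const_mul (a * (n + 1)!)).congr
        (fun t _ => ?_) fun t _ => ?_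
      · rw [← integral_const_mul]
        refine integral_congr_ae (Filter.Eventually.of_forall fun ω => ?_)
        simp only [eval_monomial, gammaWeight]
        field_simp
      · rw [← integral_const_mul, ← integral_sub (hH.integrable_gammaWeight hB hc n _)
          ((hH.integrable_gammaWeight hB hc (n + 1) _).const_mul c), ← integral_const_mul]
        refine integral_congr_ae (Filter.Eventually.of_forall fun ω => ?_)
        have hn' : ((n ! : ℕ) : ℝ) ≠ 0 := by positivity
        simp only [derivative_monomial, eval_sub, eval_mul, eval_C, eval_monomial, gammaWeight,
          Nat.factorial_succ, Nat.cast_mul, add_tsub_cancel_right]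
        push_cast
        have : ((n : ℝ) + 1) ≠ 0 := by positivity
        field_simp

end IsSubordinator

/-! ### Sums over the index sets and the law of the counting process. -/

section Combinatorics

variable {k : ℕ}

/-- The weights `∏ μ_j^{x_j} / x_j!`. -/
def multiWeight (μ : Fin k → ℝ) (x : Fin k → ℕ) : ℝ := ∏ j, μ j ^ x j / (x j)!

theorem multiWeight_add (μ : Fin k → ℝ) (a b : Fin k → ℕ) :
    multiWeight μ (a + b) * ∏ j, ((a j + b j).choose (a j) : ℝ) =
      multiWeight μ a * multiWeight μ b := by
  unfold multiWeight
  rw [← Finset.prod_mul_distrib, ← Finset.prod_mul_distrib]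
  refine Finset.prod_congr rfl fun j _ => ?_
  have h' : ((a j + b j).choose (a j) : ℝ) * (a j)! * (b j)! = (a j + b j)! := by
    have h := Nat.choose_mul_factorial_mul_factorial (Nat.le_add_right (a j) (b j))
    rw [Nat.add_sub_cancel_left] at h
    exact_mod_cast h
  have h1 : ((a j)! : ℝ) ≠ 0 := by positivity
  have h2 : ((b j)! : ℝ) ≠ 0 := by positivity
  have h3 : ((a j + b j)! : ℝ) ≠ 0 := by positivity
  simp only [Pi.add_apply, pow_add]
  rw [← h']
  have h4 : ((a j + b j).choose (a j) : ℝ) ≠ 0 := by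
    intro h0; rw [h0] at h'; simp at h'; exact h3 (by exact_mod_cast h'.symm)
  field_simp

/-- Vandermonde's identity for several variables, in umbral form. -/
theorem sum_antidiagonal_choose_mul (A B : ℕ → ℝ) (x : Fin k → ℕ) :
    ∑ p ∈ Finset.HasAntidiagonal.antidiagonal (∑ j, x j), ((∑ j, x j).choose p.1 : ℝ) * (A p.1 * B p.2) =
      ∑ y ∈ Fintype.piFinset fun j => Finset.HasAntidiagonal.antidiagonal (x j),
        (∏ j, ((x j).choose (y j).1 : ℝ)) * (A (∑ j, (y j).1) * B (∑ j, (y j).2)) := by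
  -- The umbral functional `X^i Y^j ↦ A_i B_j`, applied to the two expansions of `(X + Y)^{∑ x_j} =
  -- ∏ (X + Y)^{x_j}`.
  set L : MvPolynomial (Fin 2) ℝ →ₗ[ℝ] ℝ :=
    (MvPolynomial.basisMonomials (Fin 2) ℝ).constr ℝ fun m => A (m 0) * B (m 1)
  set X : MvPolynomial (Fin 2) ℝ := MvPolynomial.X 0
  set Y : MvPolynomial (Fin 2) ℝ := MvPolynomial.X 1
  have hL : ∀ (c : ℝ) (i j : ℕ), L (MvPolynomial.C c * (X ^ i * Y ^ j)) = c * (A i * B j) := by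
    intro c i j
    have h1 : X ^ i * Y ^ j =
        MvPolynomial.basisMonomials (Fin 2) ℝ (Finsupp.single 0 i + Finsupp.single 1 j) := by
      simp [X, Y, MvPolynomial.X_pow_eq_monomial, MvPolynomial.monomial_mul]
    rw [← MvPolynomial.smul_eq_C_mul, map_smul, h1, Module.Basis.constr_basis]
    simp
  have e1 : ∀ n : ℕ, (X + Y) ^ n =
      ∑ p ∈ Finset.HasAntidiagonal.antidiagonal n, MvPolynomial.C (n.choose p.1 : ℝ) * (X ^ p.1 * Y ^ p.2) := by
    intro n
    rw [(Commute.all X Y).add_pow']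
    refine Finset.sum_congr rfl fun p _ => ?_
    simp [nsmul_eq_mul]
  have e2 : (X + Y) ^ (∑ j, x j) = ∑ y ∈ Fintype.piFinset fun j => Finset.HasAntidiagonal.antidiagonal (x j),
      MvPolynomial.C (∏ j, ((x j).choose (y j).1 : ℝ)) *
        (X ^ (∑ j, (y j).1) * Y ^ (∑ j, (y j).2)) := by
    rw [← Finset.prod_pow_eq_pow_sum]
    simp only [e1]
    rw [Finset.prod_univ_sum]
    refine Finset.sum_congr rfl fun y _ => ?_
    rw [Finset.prod_mul_distrib, Finset.prod_mul_distrib, Finset.prod_pow_eq_pow_sum,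
      Finset.prod_pow_eq_pow_sum, map_prod]
  have h := congrArg L ((e1 _).symm.trans e2)
  simpa only [map_sum, hL] using h

/-- Multiplicativity of the coefficients `∑_{Ω(k,n)} ∏ μ_j^{x_j} / x_j! · A_{|x|}` with respect to
the binomial convolution of sequences. -/
theorem sum_OmegaSet_binomial (μ : Fin k → ℝ) (A B : ℕ → ℝ) (n : ℕ) :
    ∑ x ∈ OmegaSet k n, multiWeight μ x *
        ∑ p ∈ Finset.HasAntidiagonal.antidiagonal (∑ j, x j), ((∑ j, x j).choose p.1 : ℝ) * (A p.1 * B p.2) =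
      ∑ q ∈ Finset.HasAntidiagonal.antidiagonal n, (∑ x ∈ OmegaSet k q.1, multiWeight μ x * A (∑ j, x j)) *
        ∑ x ∈ OmegaSet k q.2, multiWeight μ x * B (∑ j, x j) := by
  simp only [Finset.sum_mul_sum]
  simp only [sum_antidiagonal_choose_mul, Finset.mul_sum]
  simp only [Finset.sum_sigma']
  -- Both sides run over the decompositions `x = a + b`; the left side lists them by `x`, the right
  -- side by the weighted degrees of `a` and `b`. The weights match by `multiWeight_add`.
  refine Finset.sum_bij' (fun z _ => ⟨(∑ j : Fin k, ((j : ℕ) + 1) * (z.2 j).1,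
      ∑ j : Fin k, ((j : ℕ) + 1) * (z.2 j).2), ⟨fun j => (z.2 j).1, fun j => (z.2 j).2⟩⟩)
    (fun z _ => ⟨z.2.1 + z.2.2, fun j => (z.2.1 j, z.2.2 j)⟩) ?_ ?_ ?_ ?_ ?_
  · rintro ⟨x, y⟩ hz
    simp only [Finset.mem_sigma, mem_OmegaSet, Fintype.mem_piFinset,
      Finset.HasAntidiagonal.mem_antidiagonal] at hz ⊢
    refine ⟨?_, trivial, trivial⟩
    rw [← hz.1, ← Finset.sum_add_distrib]
    refine Finset.sum_congr rfl fun j _ => ?_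
    rw [← mul_add, hz.2 j]
  · rintro ⟨q, a, b⟩ hz
    simp only [Finset.mem_sigma, mem_OmegaSet, Fintype.mem_piFinset,
      Finset.HasAntidiagonal.mem_antidiagonal] at hz ⊢
    refine ⟨?_, fun j => rfl⟩
    simp only [Pi.add_apply, mul_add, Finset.sum_add_distrib]
    rw [hz.2.1, hz.2.2, hz.1]
  · rintro ⟨x, y⟩ hz
    simp only [Finset.mem_sigma, Fintype.mem_piFinset,
      Finset.HasAntidiagonal.mem_antidiagonal] at hz
    have : (fun j => (y j).1) + (fun j => (y j).2) = x := funext hz.2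
    simp only [Prod.mk.eta]
    subst this
    rfl
  · rintro ⟨⟨q1, q2⟩, a, b⟩ hz
    simp only [Finset.mem_sigma, mem_OmegaSet] at hz
    obtain ⟨-, rfl, rfl⟩ := hz
    rfl
  · rintro ⟨x, y⟩ hz
    simp only [Finset.mem_sigma, Fintype.mem_piFinset,
      Finset.HasAntidiagonal.mem_antidiagonal] at hz
    have hx : x = (fun j => (y j).1) + (fun j => (y j).2) := (funext hz.2).symm
    have := multiWeight_add μ (fun j => (y j).1) (fun j => (y j).2)
    rw [← hx] at this
    have h2 : ∀ j, (y j).1 + (y j).2 = x j := hz.2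
    simp only [h2] at this
    simp only
    linear_combination (A (∑ j, (y j).1) * B (∑ j, (y j).2)) * this

theorem OmegaSet_zero : OmegaSet k 0 = {0} := by
  ext x
  rw [mem_OmegaSet, Finset.mem_singleton]
  constructor
  · intro h
    ext j
    have := (Finset.sum_eq_zero_iff.1 h) j (Finset.mem_univ j)
    simpa using this
  · rintro rfl; simp

theorem sum_pos_of_mem_OmegaSet {n : ℕ} (hn : n ≠ 0) {x : Fin k → ℕ} (hx : x ∈ OmegaSet k n) :
    ∑ j, x j ≠ 0 := by
  intro h
  rw [mem_OmegaSet] at hx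
  have h1 : ∀ j, x j = 0 := fun j => (Finset.sum_eq_zero_iff.1 h) j (Finset.mem_univ j)
  exact hn (by rw [← hx]; simp [h1])

theorem hasSum_mul_prod {α β : Type*} {f : α → ℝ} {g : β → ℝ} {a b : ℝ} (hf : HasSum f a)
    (hg : HasSum g b) : HasSum (fun z : α × β => f z.1 * g z.2) (a * b) :=
  hf.mul hg (summable_mul_of_summable_norm hf.summable.norm hg.summable.norm)

theorem hasSum_pi_prod {k : ℕ} (f : Fin k → ℕ → ℝ) (a : Fin k → ℝ) (h : ∀ j, HasSum (f j) (a j)) :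
    HasSum (fun x : Fin k → ℕ => ∏ j, f j (x j)) (∏ j, a j) := by
  induction k with
  | zero => simp
  | succ k ih =>
    have h1 := ih (fun j => f j.succ) (fun j => a j.succ) fun j => h j.succ
    rw [← (Fin.consEquiv fun _ : Fin (k + 1) => ℕ).hasSum_iff, Fin.prod_univ_succ]
    have h2 := hasSum_mul_prod (h 0) h1
    have e : (fun x : Fin (k + 1) → ℕ => ∏ j, f j (x j)) ∘ (Fin.consEquiv fun _ : Fin (k + 1) => ℕ) =
        fun z => f 0 z.1 * ∏ j : Fin k, f j.succ (z.2 j) := by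
      ext z
      simp only [Function.comp_apply, Fin.prod_univ_succ, Fin.consEquiv_apply, Fin.cons_zero,
        Fin.cons_succ]
    rw [e]
    exact h2

/-- The product of the exponential series of `λ_j z u^j` is a sum over all `x`; it is grouped by the
weighted degree of `x`, whose fibres are the sets `OmegaSet k n`. -/
theorem hasSum_gcpProb (lam : Fin k → ℝ) (u z : ℝ) :
    HasSum (fun n => u ^ n * gcpProb lam n z)
      (Real.exp (-((∑ j : Fin k, lam j * (1 - u ^ ((j : ℕ) + 1))) * z))) := by
  have h1 : ∀ j : Fin k, HasSum (fun m : ℕ => (lam j * z * u ^ ((j : ℕ) + 1)) ^ m / m !)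
      (Real.exp (lam j * z * u ^ ((j : ℕ) + 1))) := fun j => by
    rw [Real.exp_eq_exp_ℝ]; exact NormedSpace.expSeries_div_hasSum_exp _
  have h2 := (hasSum_pi_prod _ _ h1).mul_right (Real.exp (-((∑ j, lam j) * z)))
  have h3 := h2.tsum_fiberwise fun x : Fin k → ℕ => ∑ j : Fin k, ((j : ℕ) + 1) * x j
  rw [← Real.exp_sum, ← Real.exp_add] at h3
  have e1 : ∀ n : ℕ, ∑' x : ((fun x : Fin k → ℕ => ∑ j : Fin k, ((j : ℕ) + 1) * x j) ⁻¹' {n}),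
      ((∏ j, (lam j * z * u ^ ((j : ℕ) + 1)) ^ (x : Fin k → ℕ) j / ((x : Fin k → ℕ) j)!) *
        Real.exp (-((∑ j, lam j) * z))) = u ^ n * gcpProb lam n z := by
    intro n
    have hset : ((fun x : Fin k → ℕ => ∑ j : Fin k, ((j : ℕ) + 1) * x j) ⁻¹' {n}) =
        (OmegaSet k n : Set (Fin k → ℕ)) := by
      ext x; simp [mem_OmegaSet]
    rw [hset, Finset.tsum_subtype' (OmegaSet k n) fun x : Fin k → ℕ =>
      (∏ j, (lam j * z * u ^ ((j : ℕ) + 1)) ^ x j / (x j)!) * Real.exp (-((∑ j, lam j) * z)),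
      gcpProb, Finset.mul_sum]
    refine Finset.sum_congr rfl fun x hx => ?_
    rw [mem_OmegaSet] at hx
    rw [← mul_assoc]
    congr 1
    rw [← hx, ← Finset.prod_pow_eq_pow_sum, ← Finset.prod_mul_distrib]
    refine Finset.prod_congr rfl fun j _ => ?_
    rw [mul_pow _ (u ^ _), pow_mul]; ring
  have e2 : (∑ j : Fin k, lam j * z * u ^ ((j : ℕ) + 1)) + -((∑ j, lam j) * z) =
      -((∑ j : Fin k, lam j * (1 - u ^ ((j : ℕ) + 1))) * z) := by
    simp only [Finset.sum_mul, ← Finset.sum_neg_distrib, ← Finset.sum_add_distrib]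
    refine Finset.sum_congr rfl fun j _ => ?_
    ring
  rw [e2] at h3
  simpa only [e1] using h3

end Combinatorics

/-! ### Derivatives of `e^{-sψ}` as polynomials in `s`. -/

section ExpDeriv

open Polynomial

variable {ψ : ℝ → ℝ} {c : ℝ}

theorem analyticAt_exp_neg_mul (hψ : AnalyticAt ℝ ψ c) (s : ℝ) :
    AnalyticAt ℝ (fun y => Real.exp (-(s * ψ y))) c :=
  (analyticAt_const.mul hψ).neg.rexp

/-- Leibniz' rule applied to `-s ψ' e^{-sψ}`. It gives a recursion in which each step contributes an
explicit factor `s`. -/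
theorem iteratedDeriv_exp_neg_mul_succ (hψ : AnalyticAt ℝ ψ c) (s : ℝ) (z : ℕ) :
    iteratedDeriv (z + 1) (fun y => Real.exp (-(s * ψ y))) c =
      -s * ∑ i ∈ Finset.range (z + 1), (z.choose i : ℝ) * iteratedDeriv (i + 1) ψ c *
        iteratedDeriv (z - i) (fun y => Real.exp (-(s * ψ y))) c := by
  have h1 : deriv (fun y => Real.exp (-(s * ψ y))) =ᶠ[nhds c]
      fun y => -s * (deriv ψ y * Real.exp (-(s * ψ y))) := by
    filter_upwards [hψ.eventually_analyticAt] with y hy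
    have := ((hy.differentiableAt.hasDerivAt.const_mul s).fun_neg).exp
    rw [this.deriv]; ring
  rw [iteratedDeriv_succ', h1.iteratedDeriv_eq, iteratedDeriv_const_mul_field,
    iteratedDeriv_fun_mul hψ.deriv.contDiffAt (analyticAt_exp_neg_mul hψ s).contDiffAt]
  simp only [iteratedDeriv_succ']

theorem iteratedDeriv_exp_neg_mul_add (hψ : AnalyticAt ℝ ψ c) (h s : ℝ) (z : ℕ) :
    iteratedDeriv z (fun y => Real.exp (-((h + s) * ψ y))) c =
      ∑ p ∈ Finset.HasAntidiagonal.antidiagonal z, (z.choose p.1 : ℝ) *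
        (iteratedDeriv p.1 (fun y => Real.exp (-(h * ψ y))) c *
          iteratedDeriv p.2 (fun y => Real.exp (-(s * ψ y))) c) := by
  have h1 : (fun y => Real.exp (-((h + s) * ψ y))) =
      fun y => Real.exp (-(h * ψ y)) * Real.exp (-(s * ψ y)) := by
    ext y; rw [← Real.exp_add]; ring_nf
  rw [h1, iteratedDeriv_fun_mul (analyticAt_exp_neg_mul hψ h).contDiffAt
    (analyticAt_exp_neg_mul hψ s).contDiffAt, Finset.Nat.sum_antidiagonal_eq_sum_range_succ_mk]
  simp only [mul_assoc]

/-- The derivatives of `e^{-s ψ}` are polynomials in `s` times `e^{-s ψ}`. -/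
theorem exists_polynomial_iteratedDeriv_exp (hψ : AnalyticAt ℝ ψ c) (z : ℕ) :
    ∃ q : ℝ[X], (∀ s, iteratedDeriv z (fun y => Real.exp (-(s * ψ y))) c =
        q.eval s * Real.exp (-(s * ψ c))) ∧
      q.eval 0 = (if z = 0 then 1 else 0) ∧
      (derivative q).eval 0 = (if z = 0 then 0 else -iteratedDeriv z ψ c) ∧
      ((∀ i, 1 ≤ i → iteratedDeriv i ψ c = 0) → q = C (if z = 0 then 1 else 0)) := by
  induction z using Nat.strong_induction_on with
  | _ z ih =>
    obtain _ | z := z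
    · exact ⟨1, by simp⟩
    · choose! Q hQ using ih
      refine ⟨-X * ∑ i ∈ Finset.range (z + 1), C ((z.choose i : ℝ) * iteratedDeriv (i + 1) ψ c) *
        Q (z - i), fun s => ?_, by simp, ?_, fun h0 => ?_⟩
      · rw [iteratedDeriv_exp_neg_mul_succ hψ]
        simp only [eval_mul, eval_neg, eval_X, eval_finsetSum, eval_C, mul_assoc]
        rw [Finset.sum_mul]
        congr 1
        refine Finset.sum_congr rfl fun i hi => ?_
        rw [(hQ (z - i) (by omega)).1 s]; ring
      · simp only [derivative_mul, derivative_neg, derivative_X, eval_add, eval_mul, eval_neg,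
          eval_X, eval_one, neg_zero, zero_mul, add_zero, eval_finsetSum, eval_C,
          Nat.add_eq_zero_iff, one_ne_zero, and_false, if_false]
        -- The factor `-X` makes the linear coefficient minus the value of the sum at `0`, where
        -- only the polynomial of order `z - i = 0` is nonzero.
        rw [Finset.sum_eq_single_of_mem z (by simp)]
        · rw [(hQ _ (by omega)).2.1]; simp
        · intro i hi hiz
          rw [(hQ _ (by omega)).2.1, if_neg (by have := Finset.mem_range.1 hi; omega), mul_zero]
      · simp [h0]

variable {k : ℕ}

/-- The polynomials form a convolution semigroup in `s`, so their derivatives are determined by the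
derivatives at `0`. The last clause serves the degenerate case of vanishing `ψ`. -/
theorem exists_polynomial_OmegaSet (hψ : AnalyticAt ℝ ψ c) (μ : Fin k → ℝ) :
    ∃ p : ℕ → ℝ[X],
      (∀ n s, ∑ x ∈ OmegaSet k n, multiWeight μ x *
          iteratedDeriv (∑ j, x j) (fun y => Real.exp (-(s * ψ y))) c =
        (p n).eval s * Real.exp (-(s * ψ c))) ∧
      (∀ n s, (derivative (p n)).eval s = -∑ m ∈ Finset.Icc 1 n, ∑ x ∈ OmegaSet k m,
        iteratedDeriv (∑ j, x j) ψ c * multiWeight μ x * (p (n - m)).eval s) ∧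
      (∀ n, (p n).eval 0 = if n = 0 then 1 else 0) ∧
      ((∀ i, 1 ≤ i → iteratedDeriv i ψ c = 0) → ∀ n, p n = C (if n = 0 then 1 else 0)) := by
  choose Q hQ hQ0 hQ1 hQc using exists_polynomial_iteratedDeriv_exp hψ
  have hw : multiWeight μ 0 = 1 := by simp [multiWeight]
  set p : ℕ → ℝ[X] := fun n => ∑ x ∈ OmegaSet k n, C (multiWeight μ x) * Q (∑ j, x j) with hp
  have hpA : ∀ n s, ∑ x ∈ OmegaSet k n, multiWeight μ x *
      iteratedDeriv (∑ j, x j) (fun y => Real.exp (-(s * ψ y))) c =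
        (p n).eval s * Real.exp (-(s * ψ c)) := by
    intro n s
    simp only [hp, eval_finsetSum, eval_mul, eval_C, hQ, Finset.sum_mul, mul_assoc]
  -- The semigroup property: Leibniz' rule for `e^{-hψ} e^{-sψ}` is a binomial convolution, which
  -- `sum_OmegaSet_binomial` turns into a convolution in `n`.
  have hadd : ∀ n h s, (p n).eval (h + s) =
      ∑ q ∈ Finset.HasAntidiagonal.antidiagonal n, (p q.1).eval h * (p q.2).eval s := by
    intro n h s
    have h1 := sum_OmegaSet_binomial μ
      (fun z => iteratedDeriv z (fun y => Real.exp (-(h * ψ y))) c)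
      (fun z => iteratedDeriv z (fun y => Real.exp (-(s * ψ y))) c) n
    simp only [← iteratedDeriv_exp_neg_mul_add hψ, hpA] at h1
    have h2 : Real.exp (-((h + s) * ψ c)) = Real.exp (-(h * ψ c)) * Real.exp (-(s * ψ c)) := by
      rw [← Real.exp_add]; ring_nf
    have h3 : Real.exp (-((h + s) * ψ c)) ≠ 0 := (Real.exp_pos _).ne'
    refine mul_right_cancel₀ h3 ?_
    rw [h1, Finset.sum_mul]
    refine Finset.sum_congr rfl fun q _ => ?_
    rw [h2]; ring
  have hd : ∀ m, (derivative (p m)).eval 0 =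
      if m = 0 then 0 else -∑ x ∈ OmegaSet k m, iteratedDeriv (∑ j, x j) ψ c * multiWeight μ x := by
    intro m
    simp only [hp, derivative_sum, eval_finsetSum, derivative_C_mul, eval_mul, eval_C, hQ1]
    split_ifs with hm
    · subst hm; simp [OmegaSet_zero]
    · rw [← Finset.sum_neg_distrib]
      refine Finset.sum_congr rfl fun x hx => ?_
      rw [if_neg (sum_pos_of_mem_OmegaSet hm hx)]; ring
  refine ⟨p, hpA, fun n s => ?_, fun n => ?_, fun h0 n => ?_⟩
  -- Both sides of `hadd` are differentiated in `h` at `0`; the term of index `0` drops out since `p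
  -- 0` has derivative `0` there.
  · have h1 : HasDerivAt (fun h => (p n).eval (h + s)) ((derivative (p n)).eval (0 + s)) 0 :=
      ((p n).hasDerivAt (0 + s)).comp_add_const 0 s
    have h2 : HasDerivAt (fun h => (p n).eval (h + s)) (∑ q ∈ Finset.HasAntidiagonal.antidiagonal n,
        (derivative (p q.1)).eval 0 * (p q.2).eval s) 0 := by
      simp only [hadd]
      exact HasDerivAt.fun_sum fun q _ => ((p q.1).hasDerivAt 0).mul_const _
    have h3 := h1.unique h2
    rw [zero_add] at h3
    rw [h3, Finset.Nat.sum_antidiagonal_eq_sum_range_succ_mk, Finset.range_eq_Ico,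
      Finset.sum_eq_sum_Ico_succ_bot (Nat.succ_pos n)]
    simp only [hd, if_true, zero_mul, zero_add]
    rw [← Finset.sum_neg_distrib]
    refine Finset.sum_congr (by ext; simp) fun m hm => ?_
    rw [if_neg (by simp at hm; omega), neg_mul, Finset.sum_mul]
  · simp only [hp, eval_finsetSum, eval_mul, eval_C, hQ0]
    split_ifs with hn
    · subst hn; simp [OmegaSet_zero, hw]
    · refine Finset.sum_eq_zero fun x hx => ?_
      rw [if_neg (sum_pos_of_mem_OmegaSet hn hx), mul_zero]
  · simp only [hp, hQc _ h0]
    split_ifs with hn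
    · subst hn; simp [OmegaSet_zero, hw]
    · rw [C_0]
      refine Finset.sum_eq_zero fun x hx => ?_
      rw [if_neg (sum_pos_of_mem_OmegaSet hn hx), C_0, mul_zero]

end ExpDeriv

/-! ### Processes evaluated at independent random times. -/

/-- The point of the grid of width `1 / (m + 1)` that follows `s`. -/
def gridSucc (m : ℕ) (s : ℝ≥0) : ℝ≥0 := (⌊(m + 1) * s⌋₊ + 1) / (m + 1)

/-- Approximation from the right suits right-continuous paths, and for fixed `m` the grid points are
countable. -/
theorem tendsto_gridSucc (s : ℝ≥0) :
    Filter.Tendsto (fun m => gridSucc m s) Filter.atTop (nhdsWithin s (Ici s)) := by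
  have h1 : ∀ m : ℕ, s ≤ gridSucc m s := fun m => by
    rw [gridSucc, le_div_iff₀ (by positivity), mul_comm]
    exact (Nat.lt_floor_add_one _).le
  have h2 : ∀ m : ℕ, gridSucc m s ≤ s + 1 / (m + 1) := fun m => by
    have h : (0 : ℝ≥0) < m + 1 := by positivity
    rw [gridSucc, div_le_iff₀ h, add_mul s, one_div, inv_mul_cancel₀ h.ne', mul_comm s]
    gcongr
    exact Nat.floor_le zero_le
  refine tendsto_nhdsWithin_iff.2 ⟨?_, Filter.Eventually.of_forall h1⟩
  refine tendsto_of_tendsto_of_tendsto_of_le_of_le tendsto_const_nhds ?_ h1 h2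
  have h3 : Filter.Tendsto (fun m : ℕ => 1 / ((m : ℝ≥0) + 1)) Filter.atTop (nhds 0) :=
    tendsto_one_div_add_atTop_nhds_zero_nat
  simpa using h3.const_add s

theorem measurable_eval_gridSucc {S : Type*} [MeasurableSpace S] (m : ℕ) :
    Measurable fun z : (ℝ≥0 → S) × ℝ≥0 => z.1 (gridSucc m z.2) := by
  have h1 : Measurable fun z : (ℝ≥0 → S) × ℕ => z.1 ((z.2 + 1) / (m + 1)) :=
    measurable_from_prod_countable_left fun j =>
      measurable_pi_apply (((j : ℝ≥0) + 1) / (m + 1))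
  have h2 : Measurable fun z : (ℝ≥0 → S) × ℝ≥0 => (z.1, ⌊(m + 1) * z.2⌋₊) :=
    measurable_fst.prodMk (Nat.measurable_floor.comp (measurable_snd.const_mul _))
  exact h1.comp h2

section RandomTime

variable {Ω : Type*} [MeasurableSpace Ω] {P : Measure Ω}

theorem aemeasurable_eval_randomTime {S : Type*} [TopologicalSpace S]
    [TopologicalSpace.PseudoMetrizableSpace S] [MeasurableSpace S] [BorelSpace S]
    {N : ℝ≥0 → Ω → S} (hN : ∀ t, Measurable (N t))
    (hr : ∀ᵐ ω ∂P, ∀ t, ContinuousWithinAt (fun s => N s ω) (Ici t) t) {T : Ω → ℝ≥0}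
    (hT : AEMeasurable T P) : AEMeasurable (fun ω => N (T ω) ω) P := by
  refine aemeasurable_of_tendsto_metrizable_ae Filter.atTop
    (f := fun m ω => N (gridSucc m (T ω)) ω) (fun m => ?_) ?_
  · exact (measurable_eval_gridSucc m).comp_aemeasurable
      ((measurable_pi_lambda (fun ω t => N t ω) hN).aemeasurable.prodMk hT)
  · filter_upwards [hr] with ω hω
    exact (hω (T ω)).tendsto.comp (tendsto_gridSucc (T ω))

/-- Independence of the path of a process at an independent random time, from the independence
of the pair of both. -/
theorem indepFun_eval_randomTime {S : Type*} [MeasurableSpace S] {W : Ω → S}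
    {H : ℝ≥0 → Ω → ℝ≥0∞} {Y : ℝ≥0 → Ω → ℝ≥0}
    (hr : ∀ᵐ ω ∂P, ∀ t, ContinuousWithinAt (fun s => H s ω) (Ici t) t)
    (h : IndepFun W (fun ω => ((fun t => H t ω), (fun t => Y t ω))) P) (t : ℝ≥0) :
    IndepFun W (fun ω => H (Y t ω) ω) P := by
  -- A pathwise limit need not exist for every pair of functions, but the upper limit is a
  -- measurable functional of the pair of paths and agrees almost surely with the evaluation.
  have h1 : Measurable fun z : (ℝ≥0 → ℝ≥0∞) × (ℝ≥0 → ℝ≥0) =>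
      Filter.limsup (fun m => z.1 (gridSucc m (z.2 t))) Filter.atTop :=
    Measurable.limsup fun m => (measurable_eval_gridSucc m).comp
      (measurable_fst.prodMk ((measurable_pi_apply t).comp measurable_snd))
  refine (h.comp measurable_id h1).congr (ae_eq_refl _) ?_
  filter_upwards [hr] with ω hω
  exact ((hω (Y t ω)).tendsto.comp (tendsto_gridSucc (Y t ω))).limsup_eq

variable [IsProbabilityMeasure P] {E : Type*} [MeasurableSpace E] {U : Ω → E} {C D : ℝ}

/-- On each event where `κ(U)` takes a given value the process is a fixed random variable, and
independence factorises the integral. -/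
theorem integral_mul_eval_countable {ι : Type*} [Countable ι] [MeasurableSpace ι]
    [MeasurableSingletonClass ι] {F : ι → Ω → ℝ} (hF : ∀ i, Measurable (F i))
    (hFC : ∀ i ω, |F i ω| ≤ C) (hU : AEMeasurable U P) (hFU : ∀ i, IndepFun (F i) U P)
    {κ : E → ι} (hκ : Measurable κ) {w : E → ℝ} (hw : Measurable w) (hwD : ∀ e, |w e| ≤ D) :
    ∫ ω, w (U ω) * F (κ (U ω)) ω ∂P = ∫ ω, w (U ω) * ∫ ω', F (κ (U ω)) ω' ∂P ∂P := by
  obtain ⟨V, hV, hUV⟩ := hU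
  have e1 : ∫ ω, w (U ω) * F (κ (U ω)) ω ∂P = ∫ ω, w (V ω) * F (κ (V ω)) ω ∂P :=
    integral_congr_ae (by filter_upwards [hUV] with ω hω; rw [hω])
  have e2 : ∫ ω, w (U ω) * ∫ ω', F (κ (U ω)) ω' ∂P ∂P =
      ∫ ω, w (V ω) * ∫ ω', F (κ (V ω)) ω' ∂P ∂P :=
    integral_congr_ae (by filter_upwards [hUV] with ω hω; rw [hω])
  rw [e1, e2]
  have hFV : ∀ i, IndepFun (F i) V P := fun i => (hFU i).congr (ae_eq_refl _) hUV
  have hbd : ∀ e x, |x| ≤ C → ‖w e * x‖ ≤ D * C := fun e x hx => by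
    rw [Real.norm_eq_abs, abs_mul]
    exact mul_le_mul (hwD e) hx (abs_nonneg _) ((abs_nonneg _).trans (hwD e))
  have hmF : Measurable fun ω => F (κ (V ω)) ω :=
    (measurable_from_prod_countable_right (f := fun z : ι × Ω => F z.1 z.2) hF).comp
      ((hκ.comp hV).prodMk measurable_id)
  have hmr : Measurable fun ω => ∫ ω', F (κ (V ω)) ω' ∂P :=
    (measurable_of_countable fun i => ∫ ω', F i ω' ∂P).comp (hκ.comp hV)
  have hint : ∀ i, |∫ ω', F i ω' ∂P| ≤ C := fun i => by
    have := norm_integral_le_of_norm_le_const (μ := P) (f := F i) (C := C)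
      (Filter.Eventually.of_forall (hFC i))
    simpa using this
  have i1 : Integrable (fun ω => w (V ω) * F (κ (V ω)) ω) P :=
    Integrable.of_bound ((hw.comp hV).mul hmF).aestronglyMeasurable (D * C)
      (Filter.Eventually.of_forall fun ω => hbd _ _ (hFC _ _))
  have i2 : Integrable (fun ω => w (V ω) * ∫ ω', F (κ (V ω)) ω' ∂P) P :=
    Integrable.of_bound ((hw.comp hV).mul hmr).aestronglyMeasurable (D * C)
      (Filter.Eventually.of_forall fun ω => hbd _ _ (hint _))
  set s : ι → Set Ω := fun i => (fun ω => κ (V ω)) ⁻¹' {i} with hs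
  have hsm : ∀ i, MeasurableSet (s i) := fun i => (hκ.comp hV) (measurableSet_singleton i)
  have hsd : Pairwise (Function.onFun Disjoint s) := fun i j hij =>
    Disjoint.preimage _ (by simpa using hij)
  have hsu : ⋃ i, s i = univ := by ext ω; simp [hs]
  have j1 := hasSum_integral_iUnion hsm hsd i1.integrableOn
  have j2 := hasSum_integral_iUnion hsm hsd i2.integrableOn
  rw [hsu, setIntegral_univ] at j1 j2
  refine j1.unique ?_
  convert j2 using 2 with i
  have k1 : ∫ ω in s i, w (V ω) * F (κ (V ω)) ω ∂P =
      ∫ ω, F i ω * (κ ⁻¹' {i}).indicator w (V ω) ∂P := by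
    rw [← integral_indicator (hsm i)]
    refine integral_congr_ae (Filter.Eventually.of_forall fun ω => ?_)
    by_cases h : κ (V ω) = i
    · simp [indicator, hs, h, mul_comm]
    · simp [indicator, hs, h]
  have k2 : ∫ ω in s i, w (V ω) * ∫ ω', F (κ (V ω)) ω' ∂P ∂P =
      (∫ ω, F i ω ∂P) * ∫ ω, (κ ⁻¹' {i}).indicator w (V ω) ∂P := by
    rw [← integral_indicator (hsm i), ← integral_const_mul]
    refine integral_congr_ae (Filter.Eventually.of_forall fun ω => ?_)
    by_cases h : κ (V ω) = i
    · simp [indicator, hs, h, mul_comm]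
    · simp [indicator, hs, h]
  have hwi : Measurable ((κ ⁻¹' {i}).indicator w) :=
    hw.indicator (hκ (measurableSet_singleton i))
  rw [k1, k2]
  exact ((hFV i).comp measurable_id hwi).integral_fun_mul_eq_mul_integral
    (hF i).aestronglyMeasurable (hwi.comp hV).aestronglyMeasurable

/-- Integration of a right-continuous process at an independent random time. -/
theorem integral_mul_eval_randomTime {F : ℝ≥0 → Ω → ℝ} (hF : ∀ t, Measurable (F t))
    (hFC : ∀ t ω, |F t ω| ≤ C)
    (hr : ∀ᵐ ω ∂P, ∀ t, ContinuousWithinAt (fun s => F s ω) (Ici t) t)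
    (hU : AEMeasurable U P) (hFU : ∀ t, IndepFun (F t) U P)
    {τ : E → ℝ≥0} (hτ : Measurable τ) {w : E → ℝ} (hw : Measurable w) (hwD : ∀ e, |w e| ≤ D) :
    ∫ ω, w (U ω) * F (τ (U ω)) ω ∂P = ∫ ω, w (U ω) * ∫ ω', F (τ (U ω)) ω' ∂P ∂P := by
  have hbd : ∀ e x, |x| ≤ C → ‖w e * x‖ ≤ D * C := fun e x hx => by
    rw [Real.norm_eq_abs, abs_mul]
    exact mul_le_mul (hwD e) hx (abs_nonneg _) ((abs_nonneg _).trans (hwD e))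
  have hint : ∀ t, |∫ ω', F t ω' ∂P| ≤ C := fun t => by
    have := norm_integral_le_of_norm_le_const (μ := P) (f := F t) (C := C)
      (Filter.Eventually.of_forall (hFC t))
    simpa using this
  -- The averaged process is right-continuous too, so the discretised identity passes to the limit
  -- on both sides.
  have hrint : ∀ t, ContinuousWithinAt (fun s => ∫ ω', F s ω' ∂P) (Ici t) t := fun t => by
    refine continuousWithinAt_of_dominated (bound := fun _ => C)
      (Filter.Eventually.of_forall fun s => (hF s).aestronglyMeasurable)
      (Filter.Eventually.of_forall fun s => Filter.Eventually.of_forall (hFC s))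
      (integrable_const C) ?_
    filter_upwards [hr] with ω hω using hω t
  have hκ : ∀ m : ℕ, Measurable fun e => ⌊(m + 1) * τ e⌋₊ := fun m =>
    Nat.measurable_floor.comp (hτ.const_mul _)
  have key : ∀ m : ℕ, ∫ ω, w (U ω) * F (gridSucc m (τ (U ω))) ω ∂P =
      ∫ ω, w (U ω) * ∫ ω', F (gridSucc m (τ (U ω))) ω' ∂P ∂P := fun m =>
    integral_mul_eval_countable (F := fun j : ℕ => F ((j + 1) / (m + 1))) (fun j => hF _)
      (fun j => hFC _) hU (fun j => hFU _) (hκ m) hw hwD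
  have l1 : Filter.Tendsto (fun m => ∫ ω, w (U ω) * F (gridSucc m (τ (U ω))) ω ∂P) Filter.atTop
      (nhds (∫ ω, w (U ω) * F (τ (U ω)) ω ∂P)) := by
    refine tendsto_integral_of_dominated_convergence (fun _ => D * C) (fun m => ?_)
      (integrable_const _) (fun m => Filter.Eventually.of_forall fun ω => hbd _ _ (hFC _ _)) ?_
    · refine ((hw.comp_aemeasurable hU).mul ?_).aestronglyMeasurable
      exact (measurable_eval_gridSucc m).comp_aemeasurable
        ((measurable_pi_lambda (fun ω t => F t ω) hF).aemeasurable.prodMk (hτ.comp_aemeasurable hU))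
    · filter_upwards [hr] with ω hω
      exact ((hω _).tendsto.comp (tendsto_gridSucc _)).const_mul _
  have l2 : Filter.Tendsto (fun m => ∫ ω, w (U ω) * ∫ ω', F (gridSucc m (τ (U ω))) ω' ∂P ∂P)
      Filter.atTop (nhds (∫ ω, w (U ω) * ∫ ω', F (τ (U ω)) ω' ∂P ∂P)) := by
    refine tendsto_integral_of_dominated_convergence (fun _ => D * C) (fun m => ?_)
      (integrable_const _) (fun m => Filter.Eventually.of_forall fun ω => hbd _ _ (hint _)) ?_
    · refine ((hw.comp_aemeasurable hU).mul ?_).aestronglyMeasurable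
      exact ((measurable_of_countable fun j : ℕ => ∫ ω', F ((j + 1) / (m + 1)) ω' ∂P).comp
        (hκ m)).comp_aemeasurable hU
    · refine Filter.Eventually.of_forall fun ω => ?_
      exact ((hrint _).tendsto.comp (tendsto_gridSucc _)).const_mul _
  simp only [key] at l1
  exact tendsto_nhds_unique l1 l2

end RandomTime

/-! ### Analyticity of Laplace transforms and conditioning on the inverse process. -/

section ExpNeg

variable {y : ℝ}

theorem pow_mul_expNeg_nonneg (z : ℕ) (y : ℝ) (x : ℝ≥0∞) : 0 ≤ x.toReal ^ z * expNeg y x :=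
  mul_nonneg (pow_nonneg ENNReal.toReal_nonneg _) (expNeg_nonneg _ _)

theorem pow_mul_expNeg_le (hy : 0 < y) (z : ℕ) (x : ℝ≥0∞) :
    x.toReal ^ z * expNeg y x ≤ z ! / y ^ z := by
  have h2 : (0 : ℝ) ≤ z ! / y ^ z := by positivity
  rw [expNeg]
  split_ifs with h
  · rwa [mul_zero]
  · have h1 := gammaWeight_le hy z (ENNReal.toReal_nonneg (a := x))
    have h3 : (z ! : ℝ) ≠ 0 := by positivity
    calc x.toReal ^ z * Real.exp (-(y * x.toReal)) = z ! * gammaWeight y z x.toReal := by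
          rw [gammaWeight]; field_simp
      _ ≤ z ! * (1 / y ^ z) := by gcongr
      _ = _ := by ring

theorem continuousAt_expNeg (y : ℝ) {x : ℝ≥0∞} (hx : x ≠ ∞) : ContinuousAt (expNeg y) x := by
  have h1 : ContinuousAt (fun x : ℝ≥0∞ => Real.exp (-(y * x.toReal))) x :=
    ((ENNReal.continuousAt_toReal hx).const_mul y).neg.rexp
  refine h1.congr ?_
  filter_upwards [isOpen_ne.mem_nhds hx] with z hz
  rw [expNeg, if_neg hz]

theorem measurable_pow_mul_expNeg (z : ℕ) (y : ℝ) :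
    Measurable fun x : ℝ≥0∞ => x.toReal ^ z * expNeg y x :=
  (ENNReal.measurable_toReal.pow_const z).mul (measurable_expNeg y)

theorem integrable_pow_mul_expNeg (μ : Measure ℝ≥0∞) [IsFiniteMeasure μ] (hy : 0 < y) (z : ℕ) :
    Integrable (fun x : ℝ≥0∞ => x.toReal ^ z * expNeg y x) μ :=
  Integrable.of_bound (measurable_pow_mul_expNeg z y).aestronglyMeasurable (z ! / y ^ z)
    (Filter.Eventually.of_forall fun x => by
      rw [Real.norm_of_nonneg (pow_mul_expNeg_nonneg z y x)]; exact pow_mul_expNeg_le hy z x)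

theorem integral_pow_mul_expNeg (μ : Measure ℝ≥0∞) (y : ℝ) (z : ℕ) :
    ∫ x, x.toReal ^ z * expNeg y x ∂μ =
      ∫ x, x.toReal ^ z * Real.exp (-y * x.toReal) ∂(μ.restrict {∞}ᶜ) := by
  rw [← integral_indicator (measurableSet_singleton _).compl]
  refine integral_congr_ae (Filter.Eventually.of_forall fun x => ?_)
  by_cases hx : x = ∞ <;> simp [hx, expNeg]

theorem integral_expNeg_eq_mgf (μ : Measure ℝ≥0∞) (y : ℝ) :
    ∫ x, expNeg y x ∂μ = mgf ENNReal.toReal (μ.restrict {∞}ᶜ) (-y) := by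
  simpa [mgf] using integral_pow_mul_expNeg μ y 0

theorem neg_mem_interior_integrableExpSet (μ : Measure ℝ≥0∞) [IsFiniteMeasure μ] (hy : 0 < y) :
    -y ∈ interior (integrableExpSet ENNReal.toReal (μ.restrict {∞}ᶜ)) := by
  refine mem_interior.2 ⟨Iio 0, fun t ht => ?_, isOpen_Iio, by simpa using hy⟩
  refine Integrable.of_bound (by fun_prop) 1 (Filter.Eventually.of_forall fun x => ?_)
  rw [Real.norm_of_nonneg (Real.exp_nonneg _), Real.exp_le_one_iff]
  exact mul_nonpos_of_nonpos_of_nonneg (le_of_lt ht) ENNReal.toReal_nonneg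

/-- The Laplace transform is a moment generating function at `-y` of the finite part of the law, and
every negative argument is interior to its domain. -/
theorem analyticAt_integral_expNeg (μ : Measure ℝ≥0∞) [IsFiniteMeasure μ] (hy : 0 < y) :
    AnalyticAt ℝ (fun y => ∫ x, expNeg y x ∂μ) y := by
  simp only [integral_expNeg_eq_mgf]
  exact (analyticAt_mgf (neg_mem_interior_integrableExpSet μ hy)).comp_of_eq analyticAt_id.neg rfl

theorem iteratedDeriv_integral_expNeg (μ : Measure ℝ≥0∞) [IsFiniteMeasure μ] (hy : 0 < y) (z : ℕ) :
    iteratedDeriv z (fun y => ∫ x, expNeg y x ∂μ) y =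
      (-1) ^ z * ∫ x, x.toReal ^ z * expNeg y x ∂μ := by
  simp only [integral_expNeg_eq_mgf]
  rw [iteratedDeriv_comp_neg, iteratedDeriv_mgf (neg_mem_interior_integrableExpSet μ hy),
    integral_pow_mul_expNeg, smul_eq_mul]

end ExpNeg

namespace IsSubordinator

variable {Ω : Type*} [MeasurableSpace Ω] {P : Measure Ω}
  {B : BernsteinTriplet} {H : ℝ≥0 → Ω → ℝ≥0∞} {y : ℝ}

theorem integral_expNeg_map (hH : IsSubordinator P B H) (s : ℝ≥0) (hy : 0 < y) :
    ∫ x, expNeg y x ∂(P.map (H s)) = Real.exp (-(s * B.toFun y)) := by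
  rw [integral_map (hH.measurable s).aemeasurable (measurable_expNeg y).aestronglyMeasurable,
    hH.laplace s y hy]

variable {Y : Ω → ℝ≥0}

theorem aemeasurable_eval (hH : IsSubordinator P B H) (hY : AEMeasurable Y P) :
    AEMeasurable (fun ω => H (Y ω) ω) P :=
  aemeasurable_eval_randomTime hH.measurable hH.right_continuous hY

variable [IsProbabilityMeasure P]

/-- Reading the exponent as `-log E e^{-y H_1}` avoids differentiating under the Lévy integral. -/
theorem analyticAt_toFun (hH : IsSubordinator P B H) (hy : 0 < y) : AnalyticAt ℝ B.toFun y := by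
  have := Measure.isProbabilityMeasure_map (μ := P) (hH.measurable 1).aemeasurable
  have h1 := analyticAt_integral_expNeg (P.map (H 1)) hy
  have h2 : 0 < ∫ x, expNeg y x ∂(P.map (H 1)) := by
    rw [hH.integral_expNeg_map 1 hy]; positivity
  refine (h1.log h2).neg.congr ?_
  filter_upwards [isOpen_Ioi.mem_nhds hy] with r hr
  simp only [Pi.neg_apply]
  rw [hH.integral_expNeg_map 1 hr, Real.log_exp]; simp

theorem integral_pow_mul_expNeg (hH : IsSubordinator P B H) (s : ℝ≥0) (hy : 0 < y) (z : ℕ) :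
    ∫ ω, (H s ω).toReal ^ z * expNeg y (H s ω) ∂P =
      (-1) ^ z * iteratedDeriv z (fun y => Real.exp (-(s * B.toFun y))) y := by
  have := Measure.isProbabilityMeasure_map (μ := P) (hH.measurable s).aemeasurable
  have h1 : (fun y => ∫ x, expNeg y x ∂(P.map (H s))) =ᶠ[nhds y]
      fun y => Real.exp (-(s * B.toFun y)) := by
    filter_upwards [isOpen_Ioi.mem_nhds hy] with r hr using hH.integral_expNeg_map s hr
  rw [← h1.iteratedDeriv_eq, iteratedDeriv_integral_expNeg _ hy, ← mul_assoc, ← mul_pow,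
    integral_map (hH.measurable s).aemeasurable (measurable_pow_mul_expNeg z y).aestronglyMeasurable]
  simp

/-- If `E e^{-c H_1} = 1`, then `H_1 = 0` almost surely, and the exponent vanishes identically. -/
theorem toFun_eq_zero_of_eq_zero (hH : IsSubordinator P B H) {c : ℝ} (hc : 0 < c)
    (h0 : B.toFun c = 0) (hy : 0 < y) : B.toFun y = 0 := by
  have i1 : ∀ {θ : ℝ}, 0 < θ → Integrable (fun ω => expNeg θ (H 1 ω)) P := fun {θ} hθ =>
    Integrable.of_bound ((measurable_expNeg θ).comp (hH.measurable 1)).aestronglyMeasurable 1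
      (Filter.Eventually.of_forall fun ω => by
        rw [Real.norm_of_nonneg (expNeg_nonneg _ _)]; exact expNeg_le_one hθ.le _)
  have h1 : ∫ ω, (1 - expNeg c (H 1 ω)) ∂P = 0 := by
    rw [integral_sub (integrable_const _) (i1 hc), hH.laplace 1 c hc, h0]; simp
  rw [integral_eq_zero_iff_of_nonneg (fun ω => sub_nonneg.2 (expNeg_le_one hc.le _))
    ((integrable_const _).sub (i1 hc))] at h1
  have h2 : ∀ᵐ ω ∂P, expNeg y (H 1 ω) = 1 := by
    filter_upwards [h1] with ω hω
    simp only [Pi.zero_apply, expNeg] at hω ⊢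
    split_ifs at hω ⊢ with h
    · norm_num at hω
    · have h3 : Real.exp (-(c * (H 1 ω).toReal)) = 1 := by linarith
      rw [Real.exp_eq_one_iff, neg_eq_zero, mul_eq_zero] at h3
      rw [h3.resolve_left hc.ne']; simp
  have h3 := hH.laplace 1 y hy
  rw [integral_congr_ae h2] at h3
  simpa using h3.symm

theorem integral_eval (hH : IsSubordinator P B H) (hY : AEMeasurable Y P)
    (hHY : ∀ s, IndepFun (H s) Y P) {q : ℝ≥0∞ → ℝ} (hq : Measurable q)
    (hqc : ∀ x, x ≠ ∞ → ContinuousAt q x) {C : ℝ} (hqC : ∀ x, |q x| ≤ C) :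
    ∫ ω, q (H (Y ω) ω) ∂P = ∫ ω, ∫ ω', q (H (Y ω) ω') ∂P ∂P := by
  have := integral_mul_eval_randomTime (P := P) (F := fun s ω => q (H s ω)) (U := Y) (τ := id)
    (w := fun _ => 1) (C := C) (D := 1) (fun s => hq.comp (hH.measurable s)) (fun s ω => hqC _) ?_
    hY (fun s => (hHY s).comp hq measurable_id) measurable_id measurable_const (by simp)
  · simpa using this
  · filter_upwards [hH.right_continuous, hH.mono] with ω hr hm t
    -- The function `q` may be discontinuous at `∞`. This is harmless: a monotone path stays at `∞`
    -- once it is there.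
    by_cases h : H t ω = ∞
    · refine (continuousWithinAt_const (b := q ∞)).congr (fun s hs => ?_) (by rw [h])
      have h1 : H t ω ≤ H s ω := hm hs
      rw [h, top_le_iff] at h1
      rw [h1]
    · exact ContinuousAt.comp_continuousWithinAt (f := fun s => H s ω) (hqc _ h) (hr t)

theorem integral_expNeg_eval (hH : IsSubordinator P B H) (hY : AEMeasurable Y P)
    (hHY : ∀ s, IndepFun (H s) Y P) (hy : 0 < y) :
    ∫ ω, expNeg y (H (Y ω) ω) ∂P = ∫ ω, Real.exp (-(B.toFun y * Y ω)) ∂P := by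
  rw [hH.integral_eval hY hHY (measurable_expNeg y) (fun x hx => continuousAt_expNeg y hx) (C := 1)
    fun x => by rw [abs_of_nonneg (expNeg_nonneg _ _)]; exact expNeg_le_one hy.le _]
  simp only [hH.laplace _ y hy, mul_comm]

/-- By conditioning, the function is the Laplace transform of the law of `H (Y)`, so its derivatives
are signed moments of that law. -/
theorem analyticAt_integral_eval (hH : IsSubordinator P B H) (hY : AEMeasurable Y P)
    (hHY : ∀ s, IndepFun (H s) Y P) (hy : 0 < y) :
    AnalyticAt ℝ (fun y => ∫ ω, Real.exp (-(B.toFun y * Y ω)) ∂P) y ∧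
      ∀ z, iteratedDeriv z (fun y => ∫ ω, Real.exp (-(B.toFun y * Y ω)) ∂P) y =
        (-1) ^ z * ∫ ω, (H (Y ω) ω).toReal ^ z * expNeg y (H (Y ω) ω) ∂P := by
  have hZ := hH.aemeasurable_eval hY
  have := Measure.isProbabilityMeasure_map (μ := P) hZ
  have h1 : (fun y => ∫ x, expNeg y x ∂(P.map fun ω => H (Y ω) ω)) =ᶠ[nhds y]
      fun y => ∫ ω, Real.exp (-(B.toFun y * Y ω)) ∂P := by
    filter_upwards [isOpen_Ioi.mem_nhds hy] with r hr
    rw [integral_map hZ (measurable_expNeg r).aestronglyMeasurable,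
      hH.integral_expNeg_eval hY hHY hr]
  refine ⟨(analyticAt_integral_expNeg _ hy).congr h1, fun z => ?_⟩
  rw [← h1.iteratedDeriv_eq, iteratedDeriv_integral_expNeg _ hy,
    integral_map hZ (measurable_pow_mul_expNeg z y).aestronglyMeasurable]

/-- Conditioning on `Y` first puts the derivatives inside the expectation, acting on `e^{-Y ψ}`.
This is the form in which the polynomials in `Y` appear. -/
theorem integral_sum_pow_mul_expNeg_eval {ι : Type*} (hH : IsSubordinator P B H)
    (hY : AEMeasurable Y P) (hHY : ∀ s, IndepFun (H s) Y P) (hy : 0 < y) (I : Finset ι) (a : ι → ℝ)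
    (e : ι → ℕ) :
    ∫ ω, ∑ i ∈ I, a i * ((H (Y ω) ω).toReal ^ e i * expNeg y (H (Y ω) ω)) ∂P =
      ∫ ω, ∑ i ∈ I, a i * ((-1) ^ e i *
        iteratedDeriv (e i) (fun y => Real.exp (-(Y ω * B.toFun y))) y) ∂P := by
  have hi : ∀ s z, Integrable (fun ω => (H s ω).toReal ^ z * expNeg y (H s ω)) P := fun s z =>
    Integrable.of_bound
      ((measurable_pow_mul_expNeg z y).comp (hH.measurable s)).aestronglyMeasurable (z ! / y ^ z)
      (Filter.Eventually.of_forall fun ω => by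
        rw [Real.norm_of_nonneg (pow_mul_expNeg_nonneg z y _)]; exact pow_mul_expNeg_le hy z _)
  rw [hH.integral_eval hY hHY (q := fun x => ∑ i ∈ I, a i * (x.toReal ^ e i * expNeg y x))
    (C := ∑ i ∈ I, |a i| * ((e i)! / y ^ e i))
    (Finset.measurable_fun_sum _ fun i _ => (measurable_pow_mul_expNeg (e i) y).const_mul _)
    (fun x hx => ?_) fun x => ?_]
  · refine integral_congr_ae (Filter.Eventually.of_forall fun ω => ?_)
    simp only
    rw [integral_finsetSum _ fun i _ => (hi _ _).const_mul _]
    simp only [integral_const_mul, hH.integral_pow_mul_expNeg _ hy]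
  · have h1 := ENNReal.continuousAt_toReal hx
    have h2 := continuousAt_expNeg y hx
    exact tendsto_finsetSum _ fun i _ => ((h1.pow (e i)).mul h2).const_mul (a i)
  · refine (Finset.abs_sum_le_sum_abs _ _).trans (Finset.sum_le_sum fun i _ => ?_)
    rw [abs_mul, abs_of_nonneg (pow_mul_expNeg_nonneg _ _ _)]
    exact mul_le_mul_of_nonneg_left (pow_mul_expNeg_le hy _ _) (abs_nonneg _)

end IsSubordinator

/-! ### The counting process at a random time. -/

namespace IsGCP

variable {Ω : Type*} [MeasurableSpace Ω] {P : Measure Ω} {k : ℕ} {lam : Fin k → ℝ}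
  {M : ℝ≥0 → Ω → ℕ}

theorem real_eq (hM : IsGCP P lam M) (s : ℝ≥0) (n : ℕ) :
    P.real {ω | M s ω = n} = gcpProb lam n s := by
  rw [← hM.increments_law 0 s n]
  refine measureReal_congr ?_
  filter_upwards [hM.zero] with ω hω
  refine propext ?_
  change M s ω = n ↔ M (0 + s) ω = M 0 ω + n
  rw [hω, zero_add, zero_add]

theorem integral_indicator (hM : IsGCP P lam M) (s : ℝ≥0) (n : ℕ) :
    ∫ ω, (if M s ω = n then (1 : ℝ) else 0) ∂P = gcpProb lam n s := by
  rw [← hM.real_eq s n]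
  exact (integral_congr_ae (Filter.Eventually.of_forall fun ω => by simp [indicator])).trans
    (integral_indicator_one (hM.measurable s (measurableSet_singleton n)))

variable [IsProbabilityMeasure P]

theorem integral_pow (hM : IsGCP P lam M) (s : ℝ≥0) {u : ℝ} (hu : |u| < 1) :
    ∫ ω, u ^ M s ω ∂P = Real.exp (-((∑ j : Fin k, lam j * (1 - u ^ ((j : ℕ) + 1))) * s)) := by
  have hm := (hM.measurable s).aemeasurable (μ := P)
  have := Measure.isProbabilityMeasure_map hm
  have hb : ∀ n : ℕ, ‖u ^ n‖ ≤ 1 := fun n => by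
    rw [norm_pow]; exact pow_le_one₀ (norm_nonneg _) hu.le
  have h1 : Integrable (fun n : ℕ => u ^ n) (P.map (M s)) :=
    Integrable.of_bound (measurable_of_countable _).aestronglyMeasurable 1
      (Filter.Eventually.of_forall hb)
  rw [← integral_map hm (measurable_of_countable fun n : ℕ => u ^ n).aestronglyMeasurable,
    integral_countable h1, ← (hasSum_gcpProb lam u s).tsum_eq]
  refine tsum_congr fun n => ?_
  rw [map_measureReal_apply (hM.measurable s) (measurableSet_singleton n), smul_eq_mul, mul_comm,
    ← hM.real_eq s n]
  rfl

/-- The weight that vanishes at `∞` handles the cemetery, where `toNNReal` takes a meaningless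
value. -/
theorem integral_eval (hM : IsGCP P lam M) {Z : Ω → ℝ≥0∞} (hZ : AEMeasurable Z P)
    (hMZ : ∀ s, IndepFun (M s) Z P) {q : ℕ → ℝ} (hq : ∀ n, |q n| ≤ 1) :
    ∫ ω, (if Z ω = ∞ then 0 else q (M (Z ω).toNNReal ω)) ∂P =
      ∫ ω, (if Z ω = ∞ then 0 else ∫ ω', q (M (Z ω).toNNReal ω') ∂P) ∂P := by
  have h := integral_mul_eval_randomTime (P := P) (F := fun s ω => q (M s ω)) (U := Z)
    (τ := ENNReal.toNNReal) (w := fun x => if x = ∞ then 0 else 1) (C := 1) (D := 1)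
    (fun s => (measurable_of_countable q).comp (hM.measurable s)) (fun s ω => hq _) ?_
    hZ (fun s => (hMZ s).comp (measurable_of_countable q) measurable_id) ENNReal.measurable_toNNReal
    (Measurable.ite (measurableSet_singleton ∞) measurable_const measurable_const)
    (fun x => by split_ifs <;> simp)
  · simpa only [ite_mul, zero_mul, one_mul] using h
  · filter_upwards [hM.right_continuous] with ω hr t
    exact ContinuousAt.comp_continuousWithinAt (f := fun s => M s ω)
      continuous_of_discreteTopology.continuousAt (hr t)

end IsGCP

section TimeChanged

variable {Ω : Type*} [MeasurableSpace Ω] {P : Measure Ω} {k : ℕ} {lam : Fin k → ℝ}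
  {M : ℝ≥0 → Ω → ℕ} {H : ℝ≥0 → Ω → ℝ≥0∞} {Y : ℝ≥0 → Ω → ℝ≥0}

theorem aemeasurable_timeChanged (hM : IsGCP P lam M) {t : ℝ≥0}
    (hZ : AEMeasurable (fun ω => H (Y t ω) ω) P) : AEMeasurable (timeChanged M H Y t) P := by
  have h1 := aemeasurable_eval_randomTime hM.measurable hM.right_continuous
    (ENNReal.measurable_toNNReal.comp_aemeasurable hZ)
  have h2 : Measurable fun z : ℝ≥0∞ × ℕ => if z.1 = ∞ then (⊤ : ℕ∞) else z.2 :=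
    Measurable.ite (measurable_fst (measurableSet_singleton ∞)) measurable_const
      ((measurable_of_countable _).comp measurable_snd)
  exact h2.comp_aemeasurable (hZ.prodMk h1)

variable [IsProbabilityMeasure P]

theorem processProb_timeChanged (hM : IsGCP P lam M) {t : ℝ}
    (hZ : AEMeasurable (fun ω => H (Y t.toNNReal ω) ω) P)
    (hMZ : ∀ s, IndepFun (M s) (fun ω => H (Y t.toNNReal ω) ω) P) (n : ℕ) :
    processProb P (timeChanged M H Y) n t =
      ∫ ω, ∑ x ∈ OmegaSet k n, multiWeight lam x * ((H (Y t.toNNReal ω) ω).toReal ^ (∑ j, x j) *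
        expNeg (∑ j, lam j) (H (Y t.toNNReal ω) ω)) ∂P := by
  have h1 := hM.integral_eval hZ hMZ (q := fun m => if m = n then 1 else 0)
    (fun m => by split_ifs <;> simp)
  simp only [hM.integral_indicator] at h1
  have h2 : NullMeasurableSet {ω | timeChanged M H Y t.toNNReal ω = n} P :=
    (aemeasurable_timeChanged hM hZ).nullMeasurable (measurableSet_singleton (n : ℕ∞))
  have h3 : processProb P (timeChanged M H Y) n t =
      ∫ ω, {ω | timeChanged M H Y t.toNNReal ω = n}.indicator (1 : Ω → ℝ) ω ∂P := by
    rw [integral_indicator₀ h2]; simp [processProb]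
  rw [h3]
  refine Eq.trans (integral_congr_ae (Filter.Eventually.of_forall fun ω => ?_)) (h1.trans
    (integral_congr_ae (Filter.Eventually.of_forall fun ω => ?_)))
  · simp only [indicator, mem_ofPred_eq, timeChanged, Pi.one_apply]
    by_cases h : H (Y t.toNNReal ω) ω = ∞
    · simp [h]
    · simp [h]
  · simp only [expNeg]
    by_cases h : H (Y t.toNNReal ω) ω = ∞
    · simp [h]
    · simp only [if_neg h, gcpProb]
      refine Finset.sum_congr rfl fun x _ => ?_
      rw [multiWeight, ← mul_assoc, ← Finset.prod_pow_eq_pow_sum, ← Finset.prod_mul_distrib]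
      congr 1
      refine Finset.prod_congr rfl fun j _ => ?_
      rw [mul_pow, ENNReal.coe_toNNReal_eq_toReal]; ring

theorem processPGF_timeChanged (hM : IsGCP P lam M) {t : ℝ}
    (hZ : AEMeasurable (fun ω => H (Y t.toNNReal ω) ω) P)
    (hMZ : ∀ s, IndepFun (M s) (fun ω => H (Y t.toNNReal ω) ω) P) {u : ℝ} (hu : |u| < 1) :
    processPGF P (timeChanged M H Y) u t =
      ∫ ω, expNeg (∑ j : Fin k, lam j * (1 - u ^ ((j : ℕ) + 1))) (H (Y t.toNNReal ω) ω) ∂P := by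
  have h1 := hM.integral_eval hZ hMZ (q := fun m => u ^ m)
    (fun m => by rw [abs_pow]; exact pow_le_one₀ (abs_nonneg _) hu.le)
  simp only [hM.integral_pow _ hu] at h1
  refine Eq.trans (integral_congr_ae (Filter.Eventually.of_forall fun ω => ?_)) (h1.trans
    (integral_congr_ae (Filter.Eventually.of_forall fun ω => ?_)))
  · by_cases h : H (Y t.toNNReal ω) ω = ∞ <;> simp [timeChanged, h]
  · simp only [expNeg]
    by_cases h : H (Y t.toNNReal ω) ω = ∞
    · simp [h]
    · simp only [if_neg h, ENNReal.coe_toNNReal_eq_toReal]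

end TimeChanged

/-! ### The governing equations and the main theorem. -/

open Polynomial in
/-- The system of Caputo-Djrbashian equations solved by the functions `E p_n(Y_t) e^{-c Y_t}`. -/
theorem IsSubordinator.hasCaputo_polynomial_system {Ω ι : Type*} [MeasurableSpace Ω]
    {P : Measure Ω} [IsProbabilityMeasure P] {B : BernsteinTriplet} {H : ℝ≥0 → Ω → ℝ≥0∞}
    (hH : IsSubordinator P B H) (hB : B.ConditionI) {c : ℝ} (hc : 0 < c) (p : ℕ → ℝ[X]) (n : ℕ)
    (I : ℕ → Finset ι) (a : ι → ℝ)
    (hp : ∀ s, (derivative (p n)).eval s =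
      -∑ m ∈ Finset.Icc 1 n, ∑ x ∈ I m, a x * (p (n - m)).eval s) :
    HasCaputo B (fun t => ∫ ω, (p n).eval (inverseProcess H t.toNNReal ω : ℝ) *
        Real.exp (-(c * inverseProcess H t.toNNReal ω)) ∂P)
      (fun t => -(c * ∫ ω, (p n).eval (inverseProcess H t.toNNReal ω : ℝ) *
          Real.exp (-(c * inverseProcess H t.toNNReal ω)) ∂P) -
        ∑ m ∈ Finset.Icc 1 n, ∑ x ∈ I m, a x *
          ∫ ω, (p (n - m)).eval (inverseProcess H t.toNNReal ω : ℝ) *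
            Real.exp (-(c * inverseProcess H t.toNNReal ω)) ∂P) := by
  refine (hH.hasCaputo_polynomial hB hc (p n)).2.congr (fun t _ => rfl) fun t _ => ?_
  have hi : ∀ m, Integrable (fun ω => (p m).eval (inverseProcess H t.toNNReal ω : ℝ) *
      Real.exp (-(c * inverseProcess H t.toNNReal ω))) P := fun m =>
    (hH.hasCaputo_polynomial hB hc (p m)).1 _
  simp only [← integral_const_mul, ← integral_neg]
  simp only [← integral_finsetSum _ fun x _ => (hi _).const_mul (a x)]
  rw [← integral_finsetSum _ fun m _ => integrable_finsetSum _ fun x _ => (hi _).const_mul (a x),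
    ← integral_sub ((hi n).const_mul c).fun_neg
      (integrable_finsetSum _ fun m _ => integrable_finsetSum _ fun x _ => (hi _).const_mul (a x))]
  refine integral_congr_ae (Filter.Eventually.of_forall fun ω => ?_)
  simp only [eval_sub, eval_mul, eval_C, hp]
  simp only [← mul_assoc, ← Finset.sum_mul]
  ring

theorem mainTheorem1 {Ω : Type*} [MeasurableSpace Ω] (P : Measure Ω) [IsProbabilityMeasure P]
    (k : ℕ) (hk : 1 ≤ k) (lam : Fin k → ℝ) (hlam : ∀ j, 0 < lam j)
    (ψ f : BernsteinTriplet) (hf : f.ConditionI)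
    (M : ℝ≥0 → Ω → ℕ) (Hψ Hf : ℝ≥0 → Ω → ℝ≥0∞)
    (hM : IsGCP P lam M) (hHψ : IsSubordinator P ψ Hψ) (hHf : IsSubordinator P f Hf)
    (Y : ℝ≥0 → Ω → ℝ≥0) (hY : Y = inverseProcess Hf)
    (hindepM : IndepFun (fun ω t => M t ω) (fun ω => ((fun t => Hψ t ω), (fun t => Y t ω))) P)
    (hindepH : IndepFun (fun ω t => Hψ t ω) (fun ω t => Y t ω) P)
    (X : ℝ≥0 → Ω → ℕ∞) (hX : X = timeChanged M Hψ Y)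
    (p : ℕ → ℝ → ℝ) (hp : p = processProb P X)
    (G : ℝ → ℝ → ℝ) (hG : G = processPGF P X)
    (Lam : ℝ) (hLam : Lam = ∑ j, lam j) :
    (∀ t, AEMeasurable (X t) P) ∧
    -- the probabilities
    ContDiffOn ℝ (⊤ : ℕ∞) ψ.toFun (Ioi 0) ∧
    (∀ t : ℝ, 0 ≤ t → ContDiffOn ℝ (⊤ : ℕ∞) (fun y => laplaceOf P Y t (ψ.toFun y)) (Ioi 0)) ∧
    (∀ (n : ℕ) (t : ℝ), 0 ≤ t →
      p n t = ∑ x ∈ OmegaSet k n, (∏ j, lam j ^ x j / (x j)!) *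
        ((-1) ^ (∑ j, x j) *
          iteratedDeriv (∑ j, x j) (fun y => laplaceOf P Y t (ψ.toFun y)) Lam)) ∧
    -- their governing equation
    (∀ (n : ℕ) (T : ℝ), 0 ≤ T → AbsolutelyContinuousOnInterval (p n) 0 T) ∧
    (∀ (n : ℕ) (t : ℝ), 0 < t → f.CaputoDefinedAt (p n) t ∧
      f.caputo (p n) t = -(ψ.toFun Lam * p n t) -
        ∑ m ∈ Finset.Icc 1 n, ∑ x ∈ OmegaSet k m,
          iteratedDeriv (∑ j, x j) ψ.toFun Lam * (∏ j, (-lam j) ^ x j / (x j)!) *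
            p (n - m) t) ∧
    (∀ n : ℕ, p n 0 = if n = 0 then 1 else 0) ∧
    -- the probability generating function and its governing equation
    (∀ u : ℝ, |u| < 1 →
      (∀ t : ℝ, 0 ≤ t →
        G u t = laplaceOf P Y t (ψ.toFun (∑ j : Fin k, lam j * (1 - u ^ ((j : ℕ) + 1))))) ∧
      (∀ T : ℝ, 0 ≤ T → AbsolutelyContinuousOnInterval (G u) 0 T) ∧
      (∀ t : ℝ, 0 < t → f.CaputoDefinedAt (G u) t ∧
        f.caputo (G u) t =
          -(ψ.toFun (∑ j : Fin k, lam j * (1 - u ^ ((j : ℕ) + 1))) * G u t)) ∧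
      G u 0 = 1) := by
  have hne : (Finset.univ : Finset (Fin k)).Nonempty := ⟨⟨0, hk⟩, Finset.mem_univ _⟩
  have hLam0 : 0 < Lam := hLam ▸ Finset.sum_pos (fun j _ => hlam j) hne
  have hYm : ∀ t, AEMeasurable (Y t) P := fun t => hY ▸ hHf.aemeasurable_inverse hf t
  have hHY : ∀ t s, IndepFun (Hψ s) (Y t) P := fun t s =>
    hindepH.comp (measurable_pi_apply s) (measurable_pi_apply t)
  have hZ : ∀ t, AEMeasurable (fun ω => Hψ (Y t ω) ω) P := fun t => hHψ.aemeasurable_eval (hYm t)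
  have hMZ : ∀ t s, IndepFun (M s) (fun ω => Hψ (Y t ω) ω) P := fun t s =>
    (indepFun_eval_randomTime hHψ.right_continuous hindepM t).comp (measurable_pi_apply s)
      measurable_id
  have hψan : ∀ y, 0 < y → AnalyticAt ℝ ψ.toFun y := fun y hy => hHψ.analyticAt_toFun hy
  have hlap : ∀ t, (fun y => laplaceOf P Y t (ψ.toFun y)) =
      fun y => ∫ ω, Real.exp (-(ψ.toFun y * Y t.toNNReal ω)) ∂P := fun t => rfl
  -- The signs of the repeated derivatives are absorbed into the rates, which produces the factors
  -- `(-λ_j)^{x_j}`.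
  have hw : ∀ x : Fin k → ℕ, multiWeight lam x * (-1) ^ (∑ j, x j) =
      multiWeight (fun j => -lam j) x := fun x => by
    rw [multiWeight, multiWeight, ← Finset.prod_pow_eq_pow_sum, ← Finset.prod_mul_distrib]
    refine Finset.prod_congr rfl fun j _ => ?_
    rw [neg_pow (lam j)]; ring
  have hpn : ∀ n t, p n t = ∫ ω, ∑ x ∈ OmegaSet k n, multiWeight lam x *
      ((Hψ (Y t.toNNReal ω) ω).toReal ^ (∑ j, x j) * expNeg Lam (Hψ (Y t.toNNReal ω) ω)) ∂P := by
    intro n t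
    rw [hp, hX, hLam]
    exact processProb_timeChanged hM (hZ _) (hMZ _) n
  -- the probabilities in terms of polynomials of the inverse process
  obtain ⟨q, hq1, hq2, hq3, hq4⟩ := exists_polynomial_OmegaSet (hψan Lam hLam0) fun j => -lam j
  have hpq : ∀ n t, p n t = ∫ ω, (q n).eval (Y t.toNNReal ω : ℝ) *
      Real.exp (-(ψ.toFun Lam * Y t.toNNReal ω)) ∂P := by
    intro n t
    rw [hpn, hHψ.integral_sum_pow_mul_expNeg_eval (hYm _) (hHY _) hLam0]
    refine integral_congr_ae (Filter.Eventually.of_forall fun ω => ?_)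
    simp only [← mul_assoc, hw, hq1, mul_comm (ψ.toFun Lam)]
  have hY0 : ∀ᵐ ω ∂P, Y 0 ω = 0 := hY ▸ hHf.inverse_zero hf
  -- the equation of the probabilities
  have hcap : ∀ n, HasCaputo f (p n) fun t => -(ψ.toFun Lam * p n t) -
      ∑ m ∈ Finset.Icc 1 n, ∑ x ∈ OmegaSet k m,
        iteratedDeriv (∑ j, x j) ψ.toFun Lam * (∏ j, (-lam j) ^ x j / (x j)!) * p (n - m) t := by
    intro n
    -- The potential argument needs a positive rate `c = ψ(Λ)`. If it is zero, `ψ` vanishes on `(0,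
    -- ∞)` and the probabilities are constant in time.
    rcases (ψ.toFun_nonneg hLam0).eq_or_lt with h0 | h0
    · have hz : ∀ i, 1 ≤ i → iteratedDeriv i ψ.toFun Lam = 0 := fun i hi => by
        have : ψ.toFun =ᶠ[nhds Lam] fun _ => 0 := by
          filter_upwards [isOpen_Ioi.mem_nhds hLam0] with y hy
          exact hHψ.toFun_eq_zero_of_eq_zero hLam0 h0.symm hy
        rw [this.iteratedDeriv_eq, iteratedDeriv_const]; simp
      refine (HasCaputo.const f (if n = 0 then 1 else 0)).congr (fun t _ => ?_) fun t _ => ?_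
      · rw [hpq, hq4 hz, ← h0]; simp only [Polynomial.eval_C]; simp
      · rw [← h0, Finset.sum_eq_zero fun m hm => Finset.sum_eq_zero fun x hx => ?_]
        · simp
        · have := sum_pos_of_mem_OmegaSet (by simp at hm; omega) hx
          rw [hz _ (Nat.one_le_iff_ne_zero.2 this)]; simp
    · have := hHf.hasCaputo_polynomial_system hf h0 q n (OmegaSet k)
        (fun x => iteratedDeriv (∑ j, x j) ψ.toFun Lam * multiWeight (fun j => -lam j) x) (hq2 n)
      rw [← hY] at this
      exact this.congr (fun t _ => hpq n t) fun t _ => by simp only [hpq, multiWeight]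
  refine ⟨fun t => hX ▸ aemeasurable_timeChanged hM (hZ t),
    fun y hy => (hψan y hy).contDiffAt.contDiffWithinAt,
    fun t _ y hy => (hHψ.analyticAt_integral_eval (hYm _) (hHY _) hy).1.contDiffAt.contDiffWithinAt,
    fun n t _ => ?_, fun n T hT => (hcap n).absolutelyContinuousOnInterval hT,
    fun n t ht => (hcap n).definedAt_and_caputo ht, fun n => ?_, fun u hu => ?_⟩
  · have := Measure.isProbabilityMeasure_map (μ := P) (hZ t.toNNReal)
    have hi : ∀ z, Integrable (fun ω => (Hψ (Y t.toNNReal ω) ω).toReal ^ z *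
        expNeg Lam (Hψ (Y t.toNNReal ω) ω)) P := fun z =>
      (integrable_pow_mul_expNeg (P.map fun ω => Hψ (Y t.toNNReal ω) ω) hLam0 z).comp_aemeasurable
        (hZ _)
    rw [hpn, integral_finsetSum _ fun x _ => (hi _).const_mul _]
    refine Finset.sum_congr rfl fun x _ => ?_
    rw [hlap, (hHψ.analyticAt_integral_eval (hYm _) (hHY _) hLam0).2, integral_const_mul,
      multiWeight, ← mul_assoc ((-1 : ℝ) ^ _), ← mul_pow]
    simp
  · rw [hpq, Real.toNNReal_zero, integral_congr_ae (g := fun _ => if n = 0 then (1 : ℝ) else 0)]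
    · simp
    · filter_upwards [hY0] with ω hω
      rw [hω, NNReal.coe_zero, hq3]; simp
  · have hθ : 0 < ∑ j : Fin k, lam j * (1 - u ^ ((j : ℕ) + 1)) := by
      refine Finset.sum_pos (fun j _ => mul_pos (hlam j) (sub_pos.2 ?_)) hne
      refine (le_abs_self _).trans_lt ?_
      rw [abs_pow]
      exact pow_lt_one₀ (abs_nonneg _) hu (Nat.succ_ne_zero _)
    set θ := ∑ j : Fin k, lam j * (1 - u ^ ((j : ℕ) + 1)) with hθdef
    have hGl : ∀ t, G u t = laplaceOf P Y t (ψ.toFun θ) := fun t => by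
      rw [hG, hX, processPGF_timeChanged hM (hZ _) (hMZ _) hu]
      exact hHψ.integral_expNeg_eval (hYm _) (hHY _) hθ
    have hcapG : HasCaputo f (G u) fun t => -(ψ.toFun θ * G u t) := by
      rcases (ψ.toFun_nonneg hθ).eq_or_lt with h0 | h0
      · refine (HasCaputo.const f 1).congr (fun t _ => ?_) fun t _ => ?_
        · rw [hGl, ← h0]; simp [laplaceOf]
        · rw [← h0]; simp
      -- The generating function is `E e^{-cY}` with `c = ψ(θ)`, so the constant polynomial `1`
      -- suffices and the coupling sums are empty.
      · have h1 := hHf.hasCaputo_polynomial_system hf h0 (fun _ => 1) 0 (fun _ => (∅ : Finset ℕ))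
          (fun _ => 0) (by simp)
        rw [← hY] at h1
        simp only [Polynomial.eval_one, one_mul, Finset.sum_empty, Finset.sum_const_zero,
          sub_zero] at h1
        exact h1.congr (fun t _ => hGl t) fun t _ => by rw [hGl]; rfl
    refine ⟨fun t _ => hGl t, fun T hT => hcapG.absolutelyContinuousOnInterval hT,
      fun t ht => hcapG.definedAt_and_caputo ht, ?_⟩
    rw [hGl, laplaceOf, Real.toNNReal_zero, integral_congr_ae (g := fun _ => (1 : ℝ))]
    · simp
    · filter_upwards [hY0] with ω hω
      rw [hω]; simp

end
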